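/- Let $d\in\{2,3\}$, $k\ge 1$, and let $\Omega\subset\mathbb R^d$ be a bounded polygonal (polyhedral) domain whose boundary does not touch itself, i.e. every $p\in\partial\Omega$ has arbitrarily small neighbourhoods $U$ with $U\cap\Omega$ connected (every Lipschitz domain has this property). Let $\hat{\mathbf z}\in H^{k+1,\infty}(\Omega)^d$ with $\|\hat{\mathbf z}\|=1$ a.e. on $\Omega$. Write $(u,w)_1=\int_\Omega \nabla u\cdot\nabla w+uw\,dx$ for the scalar product of $H^1(\Omega)$ (for vector fields: the sum over the components) and $\|\cdot\|_1$ for the corresponding norms. For $\mathbf v,\mathbf w\in H^1(\Omega)^d$ and $\lambda\in H^1(\Omega)$ let $$a(\mathbf v,\mathbf w)=\int_\Omega \mathbf E(\mathbf v):\mathbf E(\mathbf w)\,dx,\quad \mathbf E(\mathbf v)=\nabla\mathbf v+\nabla\mathbf v^T,\qquad b(\lambda,\mathbf v)=(\lambda,\mathbf v\cdot\hat{\mathbf z})_1,$$ and let $K=\{\mathbf v\in H^1(\Omega)^d : a(\mathbf v,\mathbf v)=0\}$. Let $\{\mathcal T_h\}$ be a shape regular (not necessarily quasi-uniform) family of conforming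 simplicial triangulations of $\Omega$, where $h$ denotes the mesh size, i.e. the largest diameter of an element of $\mathcal T_h$. Let $V_h$ be the space of continuous functions on $\overline\Omega$ that are polynomials of degree at most $k$ on each element of $\mathcal T_h$, let $\mathbf V_h=V_h^d$, and $$\ker_h(b)=\{\mathbf v_h\in\mathbf V_h : b(\mu_h,\mathbf v_h)=0\ \ \forall \mu_h\in V_h\},\quad \mathcal K_{\hat{\mathbf z},h}=\ker_h(b)\cap K,$$ $$\mathbf V_{h,\ast}=\{\mathbf v_h\in\mathbf V_h : (\mathbf v_h,\mathbf w)_1=0\ \ \forall \mathbf w\in\mathcal K_{\hat{\mathbf z},h}\}.$$ Then there are constants $\beta>0$ and $h_0>0$, independent of $h$, such that for every triangulation of the family with mesh size $h\le h_0$ $$\sup_{0\neq\mathbf v_h\in\mathbf V_{h,\ast}}\frac{b(\lambda_h,\mathbf v_h)}{\|\mathbf v_h\|_1}\ \ge\ \beta\,\|\lambda_h\|_1\qquad\text{for all }\lambda_h\in V_h .$$ In words: the equal-order $P_k$–$P_k$ pair $\mathbf V_{h,\ast}\times V_h$ is uniformly LBB stable. -/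

import Mathlib

open MeasureTheory
open scoped ENNReal ContDiff

noncomputable section

namespace StrainFEM

/-- The Euclidean space `ℝ^d`. -/
abbrev Pt (d : ℕ) : Type := EuclideanSpace ℝ (Fin d)

variable {d : ℕ}

/-! ### Weak derivatives and Sobolev spaces on an open set `Ω ⊆ ℝ^d` -/

/-- `g` is the weak partial derivative `∂ᵢ u` on `Ω`: both are locally integrable on `Ω` and
`∫_Ω u ∂ᵢφ = - ∫_Ω g φ` for all `φ ∈ C_c^∞(Ω)`. -/
def IsWeakDeriv (Ω : Set (Pt d)) (i : Fin d) (u g : Pt d → ℝ) : Prop :=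
  LocallyIntegrableOn u Ω volume ∧ LocallyIntegrableOn g Ω volume ∧
    ∀ φ : Pt d → ℝ, ContDiff ℝ ∞ φ → HasCompactSupport φ → tsupport φ ⊆ Ω →
      ∫ x in Ω, u x * fderiv ℝ φ x (EuclideanSpace.single i 1) = - ∫ x in Ω, g x * φ x

/-- `u` belongs to the Sobolev space `H^{m,p}(Ω)`: all weak derivatives of `u` of order at most `m`
exist and lie in `L^p(Ω)`. -/
def MemSobolev (Ω : Set (Pt d)) (p : ℝ≥0∞) : ℕ → (Pt d → ℝ) → Prop
  | 0, u => MemLp u p (volume.restrict Ω)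
  | m + 1, u => MemLp u p (volume.restrict Ω) ∧
      ∀ i : Fin d, ∃ g : Pt d → ℝ, IsWeakDeriv Ω i u g ∧ MemSobolev Ω p m g

open Classical in
/-- The weak partial derivative `∂ᵢ u` on `Ω` (a representative; it is unique up to null subsets of
`Ω` for open `Ω`), with value `0` if there is none. -/
def weakDeriv (Ω : Set (Pt d)) (i : Fin d) (u : Pt d → ℝ) : Pt d → ℝ :=
  if h : ∃ g, IsWeakDeriv Ω i u g then h.choose else 0

/-- `(u, w)_1 = ∫_Ω ∇u · ∇w + u w dx` for scalar functions. -/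
def inner1 (Ω : Set (Pt d)) (u w : Pt d → ℝ) : ℝ :=
  ∫ x in Ω, ((∑ i : Fin d, weakDeriv Ω i u x * weakDeriv Ω i w x) + u x * w x)

/-- The norm of `H^1(Ω)`. -/
def norm1 (Ω : Set (Pt d)) (u : Pt d → ℝ) : ℝ := √(inner1 Ω u u)

/-- The `j`-th component of a vector field. -/
def comp (v : Pt d → Pt d) (j : Fin d) : Pt d → ℝ := fun x => v x j

/-- `(v, w)_1` for vector fields. -/
def vinner1 (Ω : Set (Pt d)) (v w : Pt d → Pt d) : ℝ :=
  ∑ j : Fin d, inner1 Ω (comp v j) (comp w j)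

/-- The norm of `H^1(Ω)^d`. -/
def vnorm1 (Ω : Set (Pt d)) (v : Pt d → Pt d) : ℝ := √(vinner1 Ω v v)

/-! ### The bilinear forms and the kernel of the strain energy -/

/-- The entry `(i, j)` of `E(v) = ∇v + ∇vᵀ`. -/
def strain (Ω : Set (Pt d)) (v : Pt d → Pt d) (i j : Fin d) : Pt d → ℝ :=
  fun x => weakDeriv Ω j (comp v i) x + weakDeriv Ω i (comp v j) x

/-- `a(v, w) = ∫_Ω E(v) : E(w) dx`. -/
def aForm (Ω : Set (Pt d)) (v w : Pt d → Pt d) : ℝ :=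
  ∫ x in Ω, ∑ i : Fin d, ∑ j : Fin d, strain Ω v i j x * strain Ω w i j x

/-- `b(μ, v) = (μ, v · z)_1`. -/
def bForm (Ω : Set (Pt d)) (z : Pt d → Pt d) (μ : Pt d → ℝ) (v : Pt d → Pt d) : ℝ :=
  inner1 Ω μ (fun x => inner ℝ (v x) (z x))

/-- `K = {v ∈ H^1(Ω)^d | a(v, v) = 0}`. -/
def rigidKernel (Ω : Set (Pt d)) : Set (Pt d → Pt d) :=
  {v | (∀ j, MemSobolev Ω 2 1 (comp v j)) ∧ aForm Ω v v = 0}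

/-! ### Polygonal domains and triangulations -/

/-- `Ω` is locally connected at each of its boundary points `p`: `p` has arbitrarily small
neighbourhoods `U` such that `U ∩ Ω` is connected. Every Lipschitz domain has this property; it
says that the boundary does not touch itself. -/
def LocallyConnectedAtBoundary (Ω : Set (Pt d)) : Prop :=
  ∀ p ∈ frontier Ω, ∀ ε > 0, ∃ U ∈ nhds p, U ⊆ Metric.ball p ε ∧ IsConnected (U ∩ Ω)

/-- A (conforming) simplicial triangulation of the polygonal set `Ω`: a finite simplicial complex
whose underlying space is the closure of `Ω` and has interior `Ω`. -/
structure Triangulation (Ω : Set (Pt d)) where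
  complex : Geometry.SimplicialComplex ℝ (Pt d)
  finite_faces : complex.faces.Finite
  space_eq : complex.space = closure Ω
  interior_space : interior complex.space = Ω

/-- The elements: the `d`-dimensional simplices, as closed subsets of `ℝ^d`. -/
def Triangulation.elements {Ω : Set (Pt d)} (T : Triangulation Ω) : Set (Set (Pt d)) :=
  {τ | ∃ s ∈ T.complex.faces, s.card = d + 1 ∧ τ = convexHull ℝ (s : Set (Pt d))}

/-- The mesh size `h = max_τ diam τ`. -/
def Triangulation.meshSize {Ω : Set (Pt d)} (T : Triangulation Ω) : ℝ :=
  sSup (Metric.diam '' T.elements)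

/-- Shape regularity of a family of triangulations: there is `ρ > 0` such that every element `τ` of
every triangulation of the family contains a ball of radius `ρ * diam τ`. -/
def ShapeRegular {Ω : Set (Pt d)} {ι : Type*} (T : ι → Triangulation Ω) : Prop :=
  ∃ ρ > 0, ∀ i, ∀ τ ∈ (T i).elements, ∃ c, Metric.closedBall c (ρ * Metric.diam τ) ⊆ τ

/-! ### The finite element spaces

Functions are defined on all of `ℝ^d`; only their values on the closure of `Ω` matter. -/

/-- `V_h`: continuous functions that are polynomials of degree at most `k` on each element. -/
def femSpace {Ω : Set (Pt d)} (T : Triangulation Ω) (k : ℕ) : Set (Pt d → ℝ) :=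
  {f | ContinuousOn f (closure Ω) ∧ ∀ τ ∈ T.elements, ∃ p : MvPolynomial (Fin d) ℝ,
    p.totalDegree ≤ k ∧ ∀ x ∈ τ, f x = MvPolynomial.eval (fun i => x i) p}

/-- `V_h^d`. -/
def vfemSpace {Ω : Set (Pt d)} (T : Triangulation Ω) (k : ℕ) : Set (Pt d → Pt d) :=
  {v | ∀ j, comp v j ∈ femSpace T k}

/-- `ker_h(b) = {v ∈ V_h^d | b(μ, v) = 0 for all μ ∈ V_h}`. -/
def discreteKer {Ω : Set (Pt d)} (T : Triangulation Ω) (k : ℕ) (z : Pt d → Pt d) :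
    Set (Pt d → Pt d) :=
  {v | v ∈ vfemSpace T k ∧ ∀ μ ∈ femSpace T k, bForm Ω z μ v = 0}

/-- `K_{z,h} = ker_h(b) ∩ K`. -/
def discreteRigidKer {Ω : Set (Pt d)} (T : Triangulation Ω) (k : ℕ) (z : Pt d → Pt d) :
    Set (Pt d → Pt d) :=
  discreteKer T k z ∩ rigidKernel Ω

/-- `V_{h,*}`: the fields in `V_h^d` that are `H^1`-orthogonal to `K_{z,h}`. -/
def vfemSpaceStar {Ω : Set (Pt d)} (T : Triangulation Ω) (k : ℕ) (z : Pt d → Pt d) :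
    Set (Pt d → Pt d) :=
  {v | v ∈ vfemSpace T k ∧ ∀ w ∈ discreteRigidKer T k z, vinner1 Ω v w = 0}

/-- The quotients `b(μ, v) / ‖v‖_1` with `0 ≠ v ∈ V_{h,*}`. -/
def infSupQuotients {Ω : Set (Pt d)} (T : Triangulation Ω) (k : ℕ) (z : Pt d → Pt d)
    (μ : Pt d → ℝ) : Set ℝ :=
  {q | ∃ v ∈ vfemSpaceStar T k z, vnorm1 Ω v ≠ 0 ∧ q = bForm Ω z μ v / vnorm1 Ω v}

end StrainFEM

end

/-! For `μ ∈ V_h` the ideal test field is `μ z`: since `|z| = 1`, it gives `b(μ, μ z) = ‖μ‖₁²`, and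
`‖μ z‖₁ ≤ C ‖μ‖₁`. It does not lie in `V_h^d`, but it is superapproximated there: some `v ∈ V_h^d`
satisfies `‖v - μ z‖₁ ≤ C h ‖μ‖₁` (`exists_discrete_product`), so `b(μ, v) ≥ ‖μ‖₁² / 2` for small
`h` (`exists_test_field`). Subtracting the `H¹`-orthogonal projection onto the span of `K_{z,h}`
moves `v` into `V_{h,*}`. Because `K_{z,h} ⊆ ker_h(b)`, this leaves `b(μ, ·)` unchanged, and it does
not increase the norm (`UnitField.exists_star`). Neither Korn's inequality nor a description of the
rigid motions is needed.

The approximation `v` is not a Lagrange interpolant. On an element with vertices `q` and barycentric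
coordinates `t_q`, for a component `ζ` of `z` and `μ = p`, it is `∑_q t_q ζ(q) (p + k⁻¹ ∇p · (q -
x))`. The bracket is the polar form of `p` at `k - 1` copies of `x` and one copy of `q`. By Euler's
identity it has degree at most `k - 1` in `x`, so `v` has degree at most `k`
(`exists_poly_localProd`). On a common face it depends on face data only (`localProd_eq`). With `I`
the linear nodal interpolation, the error is `p (Iζ - ζ) + k⁻¹ ∑_q t_q (ζ(q) - ζ) ∇p · (q - x)`
(`localProd_sub_eq`). Lipschitz bounds for `ζ` and `∇ζ` suffice to estimate it, and the second
derivatives of `p` that arise are absorbed by an inverse inequality (`exists_inverse_inequality`).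
All estimates are local to an element, hence no quasi-uniformity.

The analytic groundwork: by mollification, functions in `H^{1,∞}` are Lipschitz on convex open
subsets of `Ω`, with one constant. Gluing these representatives over the closed elements needs equal
values at common boundary points, which is where the boundary must not touch itself
(`exists_cellwise_lipschitz`). All functions involved are then locally Lipschitz, and Rademacher's
theorem replaces weak derivatives by classical ones (`inner1_eq_energy`). -/

namespace StrainFEM
open Filter Topology Set

/-! ### Locally Lipschitz functions: weak and classical derivatives -/

/-- The partial derivative `∂ᵢ f`. -/
noncomputable def pd {d : ℕ} (i : Fin d) (f : Pt d → ℝ) (x : Pt d) : ℝ :=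
  fderiv ℝ f x (EuclideanSpace.single i 1)

/-- A function which satisfies a Lipschitz estimate with a uniform constant near each point of a
convex set is Lipschitz there. -/
theorem abs_sub_le_of_eventually {E : Type*} [NormedAddCommGroup E] [NormedSpace ℝ E] {D : Set E}
    (hD : Convex ℝ D) {f : E → ℝ} {K : ℝ}
    (h : ∀ x ∈ D, ∀ᶠ y in 𝓝[D] x, |f y - f x| ≤ K * ‖y - x‖) {x y : E} (hx : x ∈ D) (hy : y ∈ D) :
    |f y - f x| ≤ K * ‖y - x‖ := by
  set γ : ℝ → E := fun t => x + t • (y - x) with hγ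
  have hγD : ∀ t ∈ Icc (0 : ℝ) 1, γ t ∈ D := fun t ht => hD.add_smul_sub_mem hx hy ht
  have hγc : Continuous γ := by fun_prop
  have hcf : ContinuousOn f D := by
    intro p hp
    have h0 : Tendsto (fun q => K * ‖q - p‖) (𝓝[D] p) (𝓝 0) := by
      have : Continuous fun q : E => K * ‖q - p‖ := by fun_prop
      simpa using (this.tendsto p).mono_left nhdsWithin_le_nhds
    have := squeeze_zero_norm' (f := fun q => f q - f p)
      ((h p hp).mono fun q hq => by simpa using hq) h0
    change Tendsto f (𝓝[D] p) (𝓝 (f p))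
    simpa using this.add_const (f p)
  -- Continuous induction along the segment from `x` to `y`: the set of good parameters is closed,
  -- and the local estimate at `γ t` prolongs it to the right.
  have key : Icc (0 : ℝ) 1 ⊆ {t | |f (γ t) - f x| ≤ K * ‖y - x‖ * t} := by
    refine IsClosed.Icc_subset_of_forall_mem_nhdsWithin ?_ ?_ ?_
    · have hc : ContinuousOn (fun t => |f (γ t) - f x|) (Icc 0 1) :=
        ((hcf.comp hγc.continuousOn hγD).sub continuousOn_const).abs
      have := isClosed_Icc.isClosed_le hc
        (g := fun t => K * ‖y - x‖ * t) (by fun_prop)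
      convert this using 1
      ext t; simp [and_comm]
    · simp [hγ]
    · rintro t ⟨ht, ht0, ht1⟩
      have h1 : Tendsto γ (𝓝[Ioo t 1] t) (𝓝[D] (γ t)) := by
        refine tendsto_nhdsWithin_iff.2 ⟨(hγc.tendsto t).mono_left nhdsWithin_le_nhds, ?_⟩
        filter_upwards [self_mem_nhdsWithin] with s hs
        exact hγD s ⟨ht0.trans hs.1.le, hs.2.le⟩
      rw [← nhdsWithin_Ioo_eq_nhdsGT ht1]
      filter_upwards [h1.eventually (h _ (hγD t ⟨ht0, ht1.le⟩)), self_mem_nhdsWithin] with s hs hst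
      have hd : ‖γ s - γ t‖ = (s - t) * ‖y - x‖ := by
        rw [show γ s - γ t = (s - t) • (y - x) by simp [hγ, sub_smul], norm_smul,
          Real.norm_of_nonneg (by linarith [hst.1])]
      rw [hd] at hs
      have ht' : |f (γ t) - f x| ≤ K * ‖y - x‖ * t := ht
      change |f (γ s) - f x| ≤ K * ‖y - x‖ * s
      calc |f (γ s) - f x| ≤ |f (γ s) - f (γ t)| + |f (γ t) - f x| := abs_sub_le _ _ _
        _ ≤ K * ((s - t) * ‖y - x‖) + K * ‖y - x‖ * t := add_le_add hs ht'
        _ = _ := by ring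
  simpa [hγ] using key (right_mem_Icc.2 zero_le_one)

theorem lipschitzOnWith_of_eventually {E : Type*} [NormedAddCommGroup E] [NormedSpace ℝ E]
    {D : Set E} (hD : Convex ℝ D) {f : E → ℝ} {K : ℝ}
    (h : ∀ x ∈ D, ∀ᶠ y in 𝓝[D] x, |f y - f x| ≤ K * ‖y - x‖) :
    LipschitzOnWith K.toNNReal f D := by
  refine LipschitzOnWith.of_dist_le_mul fun x hx y hy => ?_
  rw [Real.dist_eq, dist_eq_norm]
  exact (abs_sub_le_of_eventually hD h hy hx).trans
    (mul_le_mul_of_nonneg_right (Real.le_coe_toNNReal K) (norm_nonneg _))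

/-- Bounded functions on `Ω` that are Lipschitz with a uniform constant near each point of `Ω`. -/
def UnifLocLip {d : ℕ} (Ω : Set (Pt d)) (f : Pt d → ℝ) : Prop :=
  ∃ K B : ℝ, 0 ≤ K ∧ 0 ≤ B ∧
    ∀ x ∈ Ω, |f x| ≤ B ∧ ∀ᶠ y in 𝓝 x, |f y - f x| ≤ K * ‖y - x‖

variable {d : ℕ} {Ω : Set (Pt d)} {f g : Pt d → ℝ}

theorem unifLocLip_const (Ω : Set (Pt d)) (c : ℝ) : UnifLocLip Ω fun _ => c :=
  ⟨0, |c|, le_rfl, abs_nonneg _, fun _ _ => ⟨le_rfl, by simp⟩⟩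

theorem UnifLocLip.add (hf : UnifLocLip Ω f) (hg : UnifLocLip Ω g) :
    UnifLocLip Ω fun x => f x + g x := by
  obtain ⟨K, B, hK, hB, h⟩ := hf
  obtain ⟨K', B', hK', hB', h'⟩ := hg
  refine ⟨K + K', B + B', by positivity, by positivity, fun x hx => ⟨?_, ?_⟩⟩
  · exact (abs_add_le _ _).trans (add_le_add (h x hx).1 (h' x hx).1)
  · filter_upwards [(h x hx).2, (h' x hx).2] with y h1 h2
    calc |f y + g y - (f x + g x)| = |(f y - f x) + (g y - g x)| := by ring_nf
      _ ≤ _ := abs_add_le _ _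
      _ ≤ _ := by linarith

theorem UnifLocLip.mul (hΩ : IsOpen Ω) (hf : UnifLocLip Ω f) (hg : UnifLocLip Ω g) :
    UnifLocLip Ω fun x => f x * g x := by
  obtain ⟨K, B, hK, hB, h⟩ := hf
  obtain ⟨K', B', hK', hB', h'⟩ := hg
  refine ⟨K * B' + B * K', B * B', by positivity, by positivity, fun x hx => ⟨?_, ?_⟩⟩
  · rw [abs_mul]
    exact mul_le_mul (h x hx).1 (h' x hx).1 (abs_nonneg _) hB
  · filter_upwards [(h x hx).2, (h' x hx).2, hΩ.mem_nhds hx] with y h1 h2 hy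
    calc |f y * g y - f x * g x| = |(f y - f x) * g y + f x * (g y - g x)| := by ring_nf
      _ ≤ |f y - f x| * |g y| + |f x| * |g y - g x| := by
        rw [← abs_mul, ← abs_mul]; exact abs_add_le _ _
      _ ≤ (K * ‖y - x‖) * B' + B * (K' * ‖y - x‖) := by
        have := (h' y hy).1
        have := (h x hx).1
        gcongr
      _ = _ := by ring

theorem UnifLocLip.const_mul (hf : UnifLocLip Ω f) (c : ℝ) : UnifLocLip Ω fun x => c * f x := by
  obtain ⟨K, B, hK, hB, h⟩ := hf
  refine ⟨|c| * K, |c| * B, by positivity, by positivity, fun x hx => ⟨?_, ?_⟩⟩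
  · rw [abs_mul]
    exact mul_le_mul_of_nonneg_left (h x hx).1 (abs_nonneg _)
  · filter_upwards [(h x hx).2] with y h1
    rw [← mul_sub, abs_mul, mul_assoc]
    exact mul_le_mul_of_nonneg_left h1 (abs_nonneg _)

theorem UnifLocLip.sub (hf : UnifLocLip Ω f) (hg : UnifLocLip Ω g) :
    UnifLocLip Ω fun x => f x - g x := by
  have := hf.add (hg.const_mul (-1))
  simpa [sub_eq_add_neg] using this

theorem UnifLocLip.sum {ι : Type*} (s : Finset ι) {F : ι → Pt d → ℝ}
    (h : ∀ i ∈ s, UnifLocLip Ω (F i)) : UnifLocLip Ω fun x => ∑ i ∈ s, F i x := by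
  classical
  induction s using Finset.induction_on with
  | empty => simpa using unifLocLip_const Ω 0
  | insert a s ha ih =>
    simp only [Finset.sum_insert ha]
    exact (h a (by simp)).add (ih fun i hi => h i (by simp [hi]))

theorem continuousAt_of_eventually {x : Pt d} {K : ℝ}
    (h : ∀ᶠ y in 𝓝 x, |f y - f x| ≤ K * ‖y - x‖) : ContinuousAt f x := by
  have h0 : Tendsto (fun q => K * ‖q - x‖) (𝓝 x) (𝓝 0) := by
    have : Continuous fun q : Pt d => K * ‖q - x‖ := by fun_prop
    simpa using this.tendsto x
  have := squeeze_zero_norm' (f := fun q => f q - f x) (h.mono fun q hq => by simpa using hq) h0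
  change Tendsto f (𝓝 x) (𝓝 (f x))
  simpa using this.add_const (f x)

theorem UnifLocLip.continuousOn (hf : UnifLocLip Ω f) : ContinuousOn f Ω := by
  obtain ⟨K, B, -, -, h⟩ := hf
  exact fun x hx => (continuousAt_of_eventually (h x hx).2).continuousWithinAt

theorem abs_pd_le {x : Pt d} {K : ℝ} (hK : 0 ≤ K)
    (h : ∀ᶠ y in 𝓝 x, |f y - f x| ≤ K * ‖y - x‖) (i : Fin d) : |pd i f x| ≤ K := by
  have := norm_fderiv_le_of_lip' ℝ hK (f := f) (x₀ := x) (by simpa using h)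
  have h2 := (fderiv ℝ f x).le_opNorm (EuclideanSpace.single i 1)
  simp only [Real.norm_eq_abs, PiLp.norm_single, abs_one, mul_one] at h2
  exact h2.trans this

/-- On small balls inside `Ω` the function is genuinely Lipschitz, so Rademacher's theorem applies
there, and a locally null set is null. -/
theorem ae_differentiableAt_of_eventually (hΩ : IsOpen Ω) {K : ℝ}
    (h : ∀ x ∈ Ω, ∀ᶠ y in 𝓝 x, |f y - f x| ≤ K * ‖y - x‖) :
    ∀ᵐ x ∂(volume.restrict Ω), DifferentiableAt ℝ f x := by
  rw [ae_restrict_iff' hΩ.measurableSet]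
  have : volume {x | ¬ (x ∈ Ω → DifferentiableAt ℝ f x)} = 0 := by
    refine measure_null_of_locally_null _ fun x hx => ?_
    simp only [mem_ofPred_eq, Classical.not_imp] at hx
    obtain ⟨ε, hε, hb⟩ := Metric.isOpen_iff.1 hΩ x hx.1
    have hl : LipschitzOnWith K.toNNReal f (Metric.ball x ε) :=
      lipschitzOnWith_of_eventually (convex_ball x ε)
        fun y hy => nhdsWithin_le_nhds (h y (hb hy))
    refine ⟨Metric.ball x ε ∩ {x | ¬ (x ∈ Ω → DifferentiableAt ℝ f x)}, ?_, ?_⟩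
    · exact inter_mem (nhdsWithin_le_nhds (Metric.ball_mem_nhds x hε)) self_mem_nhdsWithin
    · refine measure_mono_null ?_ (ae_iff.1 (hl.ae_differentiableWithinAt_of_mem (μ := volume)))
      rintro y ⟨hy, hy'⟩
      simp only [mem_ofPred_eq, Classical.not_imp] at hy' ⊢
      exact ⟨hy, fun h => hy'.2 (h.differentiableAt (Metric.isOpen_ball.mem_nhds hy))⟩
  exact ae_iff.2 this

theorem UnifLocLip.ae_differentiableAt (hΩ : IsOpen Ω) (hf : UnifLocLip Ω f) :
    ∀ᵐ x ∂(volume.restrict Ω), DifferentiableAt ℝ f x := by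
  obtain ⟨K, B, -, -, h⟩ := hf
  exact ae_differentiableAt_of_eventually hΩ fun x hx => (h x hx).2

theorem measurable_pd (i : Fin d) (f : Pt d → ℝ) : Measurable (pd i f) :=
  measurable_fderiv_apply_const ℝ f _

/-- Bounded functions, measurable on the set `Ω` of finite measure. -/
structure BddMeas (Ω : Set (Pt d)) (f : Pt d → ℝ) : Prop where
  aesm : AEStronglyMeasurable f (volume.restrict Ω)
  bdd : ∃ C, ∀ x ∈ Ω, |f x| ≤ C

theorem BddMeas.mul (hf : BddMeas Ω f) (hg : BddMeas Ω g) : BddMeas Ω fun x => f x * g x := by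
  obtain ⟨C, hC⟩ := hf.bdd
  obtain ⟨C', hC'⟩ := hg.bdd
  refine ⟨hf.aesm.mul hg.aesm, C * C', fun x hx => ?_⟩
  rw [abs_mul]
  exact mul_le_mul (hC x hx) (hC' x hx) (abs_nonneg _) ((abs_nonneg _).trans (hC x hx))

theorem BddMeas.add (hf : BddMeas Ω f) (hg : BddMeas Ω g) : BddMeas Ω fun x => f x + g x := by
  obtain ⟨C, hC⟩ := hf.bdd
  obtain ⟨C', hC'⟩ := hg.bdd
  exact ⟨hf.aesm.add hg.aesm, C + C', fun x hx =>
    (abs_add_le _ _).trans (add_le_add (hC x hx) (hC' x hx))⟩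

theorem BddMeas.sum {ι : Type*} (s : Finset ι) {F : ι → Pt d → ℝ}
    (h : ∀ i ∈ s, BddMeas Ω (F i)) : BddMeas Ω fun x => ∑ i ∈ s, F i x := by
  classical
  induction s using Finset.induction_on with
  | empty => exact ⟨by simpa using aestronglyMeasurable_const, 0, by simp⟩
  | insert a s ha ih =>
    simp only [Finset.sum_insert ha]
    exact (h a (by simp)).add (ih fun i hi => h i (by simp [hi]))

theorem BddMeas.integrableOn (hΩ : IsOpen Ω) (hv : volume Ω ≠ ⊤) (hf : BddMeas Ω f) :
    IntegrableOn f Ω volume := by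
  obtain ⟨C, hC⟩ := hf.bdd
  exact IntegrableOn.of_bound hv.lt_top hf.aesm C
    ((ae_restrict_iff' hΩ.measurableSet).2 (ae_of_all _ fun x hx => by simpa using hC x hx))

theorem UnifLocLip.bddMeas (hΩ : IsOpen Ω) (hf : UnifLocLip Ω f) : BddMeas Ω f := by
  have hc := hf.continuousOn
  obtain ⟨K, B, -, -, h⟩ := hf
  exact ⟨hc.aestronglyMeasurable hΩ.measurableSet, B, fun x hx => (h x hx).1⟩

theorem UnifLocLip.bddMeas_pd (hf : UnifLocLip Ω f) (i : Fin d) : BddMeas Ω (pd i f) := by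
  obtain ⟨K, B, hK, -, h⟩ := hf
  exact ⟨(measurable_pd i f).aestronglyMeasurable, K, fun x hx => abs_pd_le hK (h x hx).2 i⟩

theorem pd_mul {x : Pt d} (hf : DifferentiableAt ℝ f x) (hg : DifferentiableAt ℝ g x) (i : Fin d) :
    pd i (fun y => f y * g y) x = pd i f x * g x + f x * pd i g x := by
  simp only [pd, fderiv_fun_mul hf hg]
  simp; ring

theorem pd_add {x : Pt d} (hf : DifferentiableAt ℝ f x) (hg : DifferentiableAt ℝ g x) (i : Fin d) :
    pd i (fun y => f y + g y) x = pd i f x + pd i g x := by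
  simp [pd, fderiv_fun_add hf hg]

theorem pd_const_mul {x : Pt d} (hf : DifferentiableAt ℝ f x) (c : ℝ) (i : Fin d) :
    pd i (fun y => c * f y) x = c * pd i f x := by
  simp [pd, fderiv_const_mul hf]

theorem pd_sum {ι : Type*} (s : Finset ι) {F : ι → Pt d → ℝ} {x : Pt d}
    (h : ∀ j ∈ s, DifferentiableAt ℝ (F j) x) (i : Fin d) :
    pd i (fun y => ∑ j ∈ s, F j y) x = ∑ j ∈ s, pd i (F j) x := by
  simp [pd, fderiv_fun_sum h]

theorem pd_congr {x : Pt d} (h : f =ᶠ[𝓝 x] g) (i : Fin d) : pd i f x = pd i g x := by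
  simp [pd, h.fderiv_eq]

/-- The classical partial derivatives of a locally Lipschitz function are its weak derivatives. -/
theorem UnifLocLip.isWeakDeriv (hΩ : IsOpen Ω) (hv : volume Ω ≠ ⊤) (hf : UnifLocLip Ω f)
    (i : Fin d) : IsWeakDeriv Ω i f (pd i f) := by
  refine ⟨((hf.bddMeas hΩ).integrableOn hΩ hv).locallyIntegrableOn,
    ((hf.bddMeas_pd i).integrableOn hΩ hv).locallyIntegrableOn, fun φ hφ hφc hφΩ => ?_⟩
  obtain ⟨Lφ, hLφ⟩ := hφ.lipschitzWith_of_hasCompactSupport hφc (by simp)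
  obtain ⟨Bφ, hBφ⟩ := hφc.exists_bound_of_continuous hφ.continuous
  have hφl : UnifLocLip Ω φ := by
    refine ⟨Lφ, |Bφ|, Lφ.2, abs_nonneg _, fun x _ => ⟨(hBφ x).trans (le_abs_self _),
      Eventually.of_forall fun y => ?_⟩⟩
    simpa [Real.dist_eq, dist_eq_norm] using hLφ.dist_le_mul y x
  have hprod : UnifLocLip Ω fun x => f x * φ x := hf.mul hΩ hφl
  have hzero : ∀ x ∉ Ω, (fun y => f y * φ y) =ᶠ[𝓝 x] 0 := by
    intro x hx
    filter_upwards [(isClosed_tsupport φ).isOpen_compl.mem_nhds fun h => hx (hφΩ h)] with y hy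
    simp [image_eq_zero_of_notMem_tsupport hy]
  -- The product `f φ` vanishes near every point outside `Ω`, so the local Lipschitz bound holds
  -- around every point of `ℝ^d` and is therefore global.
  have hlip : ∃ C, LipschitzWith C fun x => f x * φ x := by
    obtain ⟨K, B, hK, -, h⟩ := hprod
    refine ⟨K.toNNReal, lipschitzOnWith_univ.1 (lipschitzOnWith_of_eventually convex_univ ?_)⟩
    intro x _
    rw [nhdsWithin_univ]
    by_cases hx : x ∈ Ω
    · exact (h x hx).2
    · filter_upwards [hzero x hx] with y hy
      rw [hy, (hzero x hx).eq_of_nhds]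
      simp; positivity
  obtain ⟨C, hC⟩ := hlip
  have hcs : HasCompactSupport fun x => f x * φ x := hφc.mul_left
  -- Integration by parts against the constant `1` shows that the derivative of `f φ` has integral
  -- zero. The formula reverses the direction, hence the sign in front of the basis vector.
  have hint := LipschitzWith.integral_lineDeriv_mul_eq (μ := volume)
    (LipschitzWith.const (1 : ℝ) : LipschitzWith 0 fun _ : Pt d => (1 : ℝ)) hC hcs
    (-EuclideanSpace.single i 1)
  have h1 : ∫ x, pd i (fun x => f x * φ x) x = 0 := by
    have h2 : ∀ᵐ x : Pt d, lineDeriv ℝ (fun x => f x * φ x) x (EuclideanSpace.single i 1)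
        = pd i (fun x => f x * φ x) x := by
      filter_upwards [hC.ae_differentiableAt] with x hx
      exact hx.lineDeriv_eq_fderiv
    simp only [neg_neg, mul_one] at hint
    rw [← integral_congr_ae h2, ← hint]
    simp [lineDeriv]
  have h3 : ∫ x in Ω, pd i (fun x => f x * φ x) x = 0 := by
    rw [setIntegral_eq_integral_of_forall_compl_eq_zero, h1]
    intro x hx
    rw [pd_congr (hzero x hx)]
    simp [pd]
  have h4 : ∀ᵐ x ∂(volume.restrict Ω), pd i (fun x => f x * φ x) x
      = pd i f x * φ x + f x * pd i φ x := by
    filter_upwards [hf.ae_differentiableAt hΩ] with x hx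
    exact pd_mul hx (hφ.differentiable (by simp) x) i
  rw [integral_congr_ae h4, integral_add
    (((hf.bddMeas_pd i).mul (hφl.bddMeas hΩ)).integrableOn hΩ hv)
    (((hf.bddMeas hΩ).mul (hφl.bddMeas_pd i)).integrableOn hΩ hv)] at h3
  change ∫ x in Ω, f x * pd i φ x = _
  linarith

theorem IsWeakDeriv.congr_left {i : Fin d} {u u' g : Pt d → ℝ} (hΩ : IsOpen Ω)
    (h : IsWeakDeriv Ω i u g) (huu : u =ᵐ[volume.restrict Ω] u') : IsWeakDeriv Ω i u' g := by
  refine ⟨?_, h.2.1, fun φ h1 h2 h3 => ?_⟩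
  · rw [locallyIntegrableOn_iff hΩ.isLocallyClosed] at *
    intro K hK hKc
    exact (((locallyIntegrableOn_iff hΩ.isLocallyClosed).1 h.1) K hK hKc).congr
      (ae_restrict_of_ae_restrict_of_subset hK huu)
  · rw [← h.2.2 φ h1 h2 h3]
    refine integral_congr_ae ?_
    filter_upwards [huu] with x hx
    rw [hx]

/-- The fundamental lemma of the calculus of variations. It makes `weakDeriv`, an arbitrary choice
of witness, computable up to null sets. -/
theorem IsWeakDeriv.ae_eq {i : Fin d} {u g g' : Pt d → ℝ} (hΩ : IsOpen Ω)
    (h : IsWeakDeriv Ω i u g) (h' : IsWeakDeriv Ω i u g') : g =ᵐ[volume.restrict Ω] g' := by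
  have hl : LocallyIntegrableOn (fun x => g x - g' x) Ω volume := h.2.1.sub h'.2.1
  have := hΩ.ae_eq_zero_of_integral_contDiff_smul_eq_zero hl fun φ h1 h2 h3 => ?_
  · refine (ae_restrict_iff' hΩ.measurableSet).2 ?_
    filter_upwards [this] with x hx hxΩ
    linarith [hx hxΩ]
  · have key : ∀ q : Pt d → ℝ, LocallyIntegrableOn q Ω volume →
        Integrable (fun x => φ x • q x) volume := by
      intro q hq
      have h4 : IntegrableOn q (tsupport φ) volume :=
        hq.integrableOn_compact_subset h3 h2
      have h5 : IntegrableOn (fun x => φ x • q x) (tsupport φ) volume :=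
        h4.continuousOn_smul h1.continuous.continuousOn h2
      exact (integrableOn_iff_integrable_of_support_subset fun x hx => by
        by_contra hx'
        simp [image_eq_zero_of_notMem_tsupport hx'] at hx).1 h5
    have e : ∀ q : Pt d → ℝ, ∫ x in Ω, q x * φ x = ∫ x, φ x • q x := by
      intro q
      rw [setIntegral_eq_integral_of_forall_compl_eq_zero]
      · simp [mul_comm]
      · intro x hx
        simp [image_eq_zero_of_notMem_tsupport fun hx' => hx (h3 hx')]
    have h6 := h.2.2 φ h1 h2 h3
    rw [h'.2.2 φ h1 h2 h3, neg_inj, e, e] at h6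
    simp only [smul_sub]
    rw [integral_sub (key g h.2.1) (key g' h'.2.1), h6, sub_self]

theorem UnifLocLip.weakDeriv_ae_eq (hΩ : IsOpen Ω) (hv : volume Ω ≠ ⊤) (hf : UnifLocLip Ω f)
    {u : Pt d → ℝ} (hu : u =ᵐ[volume.restrict Ω] f) (i : Fin d) :
    weakDeriv Ω i u =ᵐ[volume.restrict Ω] pd i f := by
  have hw : IsWeakDeriv Ω i u (pd i f) := (hf.isWeakDeriv hΩ hv i).congr_left hΩ hu.symm
  have hex : ∃ g, IsWeakDeriv Ω i u g := ⟨_, hw⟩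
  rw [weakDeriv, dif_pos hex]
  exact hex.choose_spec.ae_eq hΩ hw

/-- The `H¹` scalar product expressed by classical partial derivatives. -/
noncomputable def energy (Ω : Set (Pt d)) (f g : Pt d → ℝ) : ℝ :=
  ∫ x in Ω, ((∑ i : Fin d, pd i f x * pd i g x) + f x * g x)

/-- The bridge from the weak formulation to classical calculus: all later estimates concern
`energy`. The functions `u`, `w` may be mere a.e. copies because `z` is replaced by a Lipschitz
representative. -/
theorem inner1_eq_energy (hΩ : IsOpen Ω) (hv : volume Ω ≠ ⊤) (hf : UnifLocLip Ω f)
    (hg : UnifLocLip Ω g) {u w : Pt d → ℝ} (hu : u =ᵐ[volume.restrict Ω] f)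
    (hw : w =ᵐ[volume.restrict Ω] g) : inner1 Ω u w = energy Ω f g := by
  refine integral_congr_ae ?_
  have h1 := ae_all_iff.2 fun i => hf.weakDeriv_ae_eq hΩ hv hu i
  have h2 := ae_all_iff.2 fun i => hg.weakDeriv_ae_eq hΩ hv hw i
  filter_upwards [h1, h2, hu, hw] with x h1 h2 h3 h4
  simp [h1, h2, h3, h4]

theorem bddMeas_energy (hΩ : IsOpen Ω) (hf : UnifLocLip Ω f) (hg : UnifLocLip Ω g) :
    BddMeas Ω fun x => (∑ i : Fin d, pd i f x * pd i g x) + f x * g x :=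
  (BddMeas.sum _ fun i _ => (hf.bddMeas_pd i).mul (hg.bddMeas_pd i)).add
    ((hf.bddMeas hΩ).mul (hg.bddMeas hΩ))

theorem energy_comm (f g : Pt d → ℝ) : energy Ω f g = energy Ω g f := by
  simp [energy, mul_comm]

theorem energy_self_nonneg (f : Pt d → ℝ) : 0 ≤ energy Ω f f :=
  integral_nonneg fun _ => add_nonneg (Finset.sum_nonneg fun _ _ => mul_self_nonneg _)
    (mul_self_nonneg _)

theorem energy_add_right (hΩ : IsOpen Ω) (hv : volume Ω ≠ ⊤) {f g g' : Pt d → ℝ}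
    (hf : UnifLocLip Ω f) (hg : UnifLocLip Ω g) (hg' : UnifLocLip Ω g') :
    energy Ω f (fun x => g x + g' x) = energy Ω f g + energy Ω f g' := by
  rw [energy, energy, energy, ← integral_add ((bddMeas_energy hΩ hf hg).integrableOn hΩ hv)
    ((bddMeas_energy hΩ hf hg').integrableOn hΩ hv)]
  refine integral_congr_ae ?_
  filter_upwards [hg.ae_differentiableAt hΩ, hg'.ae_differentiableAt hΩ] with x h1 h2
  simp only [pd_add h1 h2, mul_add, Finset.sum_add_distrib]
  ring

theorem energy_smul_right (hΩ : IsOpen Ω) {f g : Pt d → ℝ}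
    (hg : UnifLocLip Ω g) (c : ℝ) :
    energy Ω f (fun x => c * g x) = c * energy Ω f g := by
  rw [energy, energy, ← integral_const_mul]
  refine integral_congr_ae ?_
  filter_upwards [hg.ae_differentiableAt hΩ] with x h1
  simp only [pd_const_mul h1, mul_add, Finset.mul_sum]
  congr 1
  · exact Finset.sum_congr rfl fun i _ => by ring
  · ring

end StrainFEM

/-! ### Lipschitz representatives by mollification -/

namespace StrainFEM
open Filter Topology Set
variable {d : ℕ} {Ω : Set (Pt d)}

theorem opNorm_le_sum_single (L : Pt d →L[ℝ] ℝ) :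
    ‖L‖ ≤ ∑ i, |L (EuclideanSpace.single i 1)| := by
  refine L.opNorm_le_bound (Finset.sum_nonneg fun i _ => abs_nonneg _) fun x => ?_
  have hx : x = ∑ i, x i • EuclideanSpace.single i (1 : ℝ) := by
    ext j
    simp [Finset.sum_apply, Pi.single_apply]
  conv_lhs => rw [hx]
  rw [map_sum, Finset.sum_mul]
  refine (norm_sum_le _ _).trans (Finset.sum_le_sum fun i _ => ?_)
  rw [map_smul, norm_smul, mul_comm, Real.norm_eq_abs]
  exact mul_le_mul_of_nonneg_left (PiLp.norm_apply_le x i) (abs_nonneg _)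

theorem abs_apply_single_le (L : Pt d →L[ℝ] ℝ) (i : Fin d) :
    |L (EuclideanSpace.single i 1)| ≤ ‖L‖ := by
  have h2 := L.le_opNorm (EuclideanSpace.single i 1)
  simpa using h2

-- When the ball around `w` lies in `D`, the reflected translate `ψ(w - ·)` is an admissible test
-- function. The derivative of the mollified `u` is therefore the mollified weak derivative, and
-- averaging with a nonnegative kernel of mass one preserves the bound `M`. The extension of `u` by
-- zero does no harm, as the kernel does not see it.
open scoped Convolution in
theorem abs_fderiv_convolution_le {D : Set (Pt d)} (hD : IsOpen D) {u g : Pt d → ℝ} {i : Fin d}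
    (hu : IntegrableOn u D volume) (hg : IsWeakDeriv D i u g) {M : ℝ}
    (hM : ∀ᵐ x ∂(volume.restrict D), |g x| ≤ M) (φ : ContDiffBump (0 : Pt d)) {w : Pt d}
    (hw : Metric.closedBall w φ.rOut ⊆ D) :
    |(fderiv ℝ (φ.normed volume) ⋆[(ContinuousLinearMap.lsmul ℝ ℝ).precompL (Pt d), volume]
      D.indicator u) w (EuclideanSpace.single i 1)| ≤ M := by
  set ψ := φ.normed volume with hψ
  have hψc : ContDiff ℝ ∞ ψ := φ.contDiff_normed
  have hψs : HasCompactSupport ψ := φ.hasCompactSupport_normed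
  have hU : LocallyIntegrable (D.indicator u) volume :=
    ((integrable_indicator_iff hD.measurableSet).2 hu).locallyIntegrable
  have hconv := (hψs.fderiv (𝕜 := ℝ)).convolutionExists_left
    ((ContinuousLinearMap.lsmul ℝ ℝ).precompL (Pt d)) (hψc.continuous_fderiv (by simp)) hU w
  set η : Pt d → ℝ := fun t => ψ (w - t) with hη
  have hηd : ∀ t, fderiv ℝ η t (EuclideanSpace.single i 1)
      = - fderiv ℝ ψ (w - t) (EuclideanSpace.single i 1) := by
    intro t
    have h1 : HasFDerivAt ψ (fderiv ℝ ψ (w - t)) (w - t) :=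
      (hψc.differentiable (by simp) _).hasFDerivAt
    have h2 : HasFDerivAt (fun t : Pt d => w - t) (-ContinuousLinearMap.id ℝ (Pt d)) t :=
      (hasFDerivAt_id t).const_sub w
    have := h1.comp t h2
    rw [show η = ψ ∘ fun t => w - t from rfl, this.fderiv]
    simp
  have hηts : tsupport η ⊆ Metric.closedBall w φ.rOut := by
    refine closure_minimal (fun t ht => ?_) Metric.isClosed_closedBall
    have : w - t ∈ Function.support ψ := ht
    rw [hψ, φ.support_normed_eq] at this
    rw [Metric.mem_ball, dist_zero_right] at this
    rw [Metric.mem_closedBall, dist_comm, dist_eq_norm]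
    exact this.le
  have hηs : HasCompactSupport η :=
    (isCompact_closedBall w φ.rOut).of_isClosed_subset (isClosed_tsupport _) hηts
  have hηc : ContDiff ℝ ∞ η := hψc.comp (contDiff_const.sub contDiff_id)
  have hweak := hg.2.2 η hηc hηs (hηts.trans hw)
  have hηint : ∫ t, η t = 1 := by
    rw [hη, integral_sub_left_eq_self (fun t => ψ t) volume w]
    exact φ.integral_normed
  have hηn : ∀ t, 0 ≤ η t := fun t => φ.nonneg_normed _
  have hηi : Integrable η volume := hηc.continuous.integrable_of_hasCompactSupport hηs
  have e1 : (fderiv ℝ ψ ⋆[(ContinuousLinearMap.lsmul ℝ ℝ).precompL (Pt d), volume]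
      D.indicator u) w (EuclideanSpace.single i 1) = ∫ x in D, g x * η x := by
    rw [convolution, ContinuousLinearMap.integral_apply hconv]
    simp only [ContinuousLinearMap.precompL_apply, ContinuousLinearMap.lsmul_apply, smul_eq_mul]
    rw [← integral_sub_left_eq_self _ volume w]
    simp only [sub_sub_cancel]
    rw [← neg_inj, ← hweak, ← integral_neg, ← integral_indicator hD.measurableSet]
    congr 1
    ext t
    by_cases ht : t ∈ D <;> simp [ht, hηd, mul_comm]
  rw [e1]
  calc |∫ x in D, g x * η x| ≤ ∫ x in D, M * η x := by
        rw [← Real.norm_eq_abs]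
        refine norm_integral_le_of_norm_le (hηi.integrableOn.const_mul M) ?_
        filter_upwards [hM] with x hx
        rw [norm_mul, Real.norm_eq_abs, Real.norm_of_nonneg (hηn x)]
        exact mul_le_mul_of_nonneg_right hx (hηn x)
    _ = M * ∫ x, η x := by
        rw [integral_const_mul, setIntegral_eq_integral_of_forall_compl_eq_zero]
        exact fun x hx => image_eq_zero_of_notMem_tsupport fun h => hx (hw (hηts h))
    _ = M := by rw [hηint, mul_one]

/-- A function with bounded weak derivatives on a convex open set has a Lipschitz
representative. -/
theorem exists_lipschitz_representative {D : Set (Pt d)} (hD : IsOpen D) (hDc : Convex ℝ D)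
    {u : Pt d → ℝ} {g : Fin d → Pt d → ℝ} (hu : IntegrableOn u D volume)
    (hg : ∀ i, IsWeakDeriv D i u (g i)) {M : ℝ} (hM0 : 0 ≤ M)
    (hM : ∀ i, ∀ᵐ x ∂(volume.restrict D), |g i x| ≤ M) :
    ∃ F : Pt d → ℝ, LipschitzWith (d * M).toNNReal F ∧ F =ᵐ[volume.restrict D] u := by
  have hU : LocallyIntegrable (D.indicator u) volume :=
    ((integrable_indicator_iff hD.measurableSet).2 hu).locallyIntegrable
  -- The inner radius is half the outer one because the a.e. convergence theorem needs a bounded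
  -- ratio of the radii; here the ratio is `2`.
  let φ : ℕ → ContDiffBump (0 : Pt d) := fun n =>
    ⟨1 / ((n : ℝ) + 1) / 2, 1 / ((n : ℝ) + 1), by positivity, half_lt_self (by positivity)⟩
  have hφ0 : Tendsto (fun n => (φ n).rOut) atTop (𝓝 0) := tendsto_one_div_add_atTop_nhds_zero_nat
  have hae := ContDiffBump.ae_convolution_tendsto_right_of_locallyIntegrable (μ := volume) (K := 2)
    hφ0 (Eventually.of_forall fun n => by simp only [φ]; linarith) hU
  set S : Set (Pt d) := {x | Tendsto (fun n => MeasureTheory.convolution ((φ n).normed volume)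
    (D.indicator u) (ContinuousLinearMap.lsmul ℝ ℝ) volume x) atTop (𝓝 (D.indicator u x))} with hS
  have hlip : LipschitzOnWith (d * M).toNNReal u (D ∩ S) := by
    refine LipschitzOnWith.of_dist_le_mul fun x hx y hy => ?_
    rw [Real.coe_toNNReal _ (by positivity)]
    have hseg : segment ℝ x y ⊆ D := hDc.segment_subset hx.1 hy.1
    have hcomp : IsCompact (segment ℝ x y) := by
      rw [segment_eq_image_lineMap]
      exact isCompact_Icc.image AffineMap.lineMap_continuous
    -- The compact segment has a neighbourhood of positive width in `D`, so for small mollification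
    -- radius the derivative bound holds along all of it. The mean value inequality then passes to
    -- the limit at both endpoints.
    obtain ⟨δ, hδ, hδD⟩ := hcomp.exists_cthickening_subset_open hD hseg
    have hlim := (hx.2.sub hy.2).norm
    rw [indicator_of_mem hx.1, indicator_of_mem hy.1] at hlim
    rw [dist_eq_norm, dist_eq_norm]
    refine le_of_tendsto hlim ?_
    filter_upwards [hφ0.eventually_lt_const hδ] with n hn
    refine Convex.norm_image_sub_le_of_norm_hasFDerivWithin_le
      (s := segment ℝ x y) (fun w _ => ((φ n).hasCompactSupport_normed.hasFDerivAt_convolution_left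
        (ContinuousLinearMap.lsmul ℝ ℝ) (φ n).contDiff_normed hU w).hasFDerivWithinAt)
      (fun w hw => ?_) (convex_segment x y) (right_mem_segment ℝ x y) (left_mem_segment ℝ x y)
    refine (opNorm_le_sum_single _).trans ?_
    have : ∀ i ∈ Finset.univ, |(MeasureTheory.convolution (fderiv ℝ ((φ n).normed volume))
        (D.indicator u) ((ContinuousLinearMap.lsmul ℝ ℝ).precompL (Pt d)) volume) w
        (EuclideanSpace.single i 1)| ≤ M := fun i _ =>
      abs_fderiv_convolution_le hD hu (hg i) (hM i) (φ n) ((Metric.closedBall_subset_cthickening hw _).trans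
        ((Metric.cthickening_mono hn.le _).trans hδD))
    refine (Finset.sum_le_sum this).trans ?_
    simp
  -- So far the Lipschitz bound concerns only points of convergence, which have full measure in `D`;
  -- the extension removes the exceptional null set.
  obtain ⟨F, hF, hFu⟩ := hlip.extend_real
  refine ⟨F, hF, (ae_restrict_iff' hD.measurableSet).2 ?_⟩
  filter_upwards [hae] with x hx hxD
  exact (hFu ⟨hxD, hx⟩).symm

theorem IsWeakDeriv.mono {D : Set (Pt d)} {i : Fin d} {u g : Pt d → ℝ}
    (h : IsWeakDeriv Ω i u g) (hD : D ⊆ Ω) : IsWeakDeriv D i u g := by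
  refine ⟨h.1.mono_set hD, h.2.1.mono_set hD, fun φ h1 h2 h3 => ?_⟩
  have hd : ∀ {x}, x ∉ tsupport φ → fderiv ℝ φ x = 0 := fun hx => fderiv_of_notMem_tsupport ℝ hx
  have key : ∀ {A : Set (Pt d)}, tsupport φ ⊆ A →
      (∫ x in A, u x * fderiv ℝ φ x (EuclideanSpace.single i 1)
        = ∫ x, u x * fderiv ℝ φ x (EuclideanSpace.single i 1)) ∧
      ∫ x in A, g x * φ x = ∫ x, g x * φ x := by
    intro A hA
    refine ⟨setIntegral_eq_integral_of_forall_compl_eq_zero fun x hx => ?_,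
      setIntegral_eq_integral_of_forall_compl_eq_zero fun x hx => ?_⟩
    · simp [hd fun h => hx (hA h)]
    · simp [image_eq_zero_of_notMem_tsupport fun h => hx (hA h)]
  rw [(key h3).1, (key h3).2, ← (key (h3.trans hD)).1, ← (key (h3.trans hD)).2]
  exact h.2.2 φ h1 h2 (h3.trans hD)

theorem IsWeakDeriv.sub {i : Fin d} {u g u' g' : Pt d → ℝ}
    (h : IsWeakDeriv Ω i u g) (h' : IsWeakDeriv Ω i u' g') :
    IsWeakDeriv Ω i (fun x => u x - u' x) (fun x => g x - g' x) := by
  refine ⟨h.1.sub h'.1, h.2.1.sub h'.2.1, fun φ h1 h2 h3 => ?_⟩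
  have key : ∀ q ψ : Pt d → ℝ, Continuous ψ → tsupport ψ ⊆ tsupport φ →
      LocallyIntegrableOn q Ω volume → IntegrableOn (fun x => q x * ψ x) Ω volume := by
    intro q ψ hψ hψs hq
    have h4 : IntegrableOn q (tsupport φ) volume := hq.integrableOn_compact_subset h3 h2
    have h5 : IntegrableOn (fun x => q x * ψ x) (tsupport φ) volume :=
      h4.mul_continuousOn hψ.continuousOn h2
    exact ((integrableOn_iff_integrable_of_support_subset fun x hx => by
      by_contra hx'
      simp [image_eq_zero_of_notMem_tsupport fun h => hx' (hψs h)] at hx).1 h5).integrableOn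
  have hcd : Continuous fun x => fderiv ℝ φ x (EuclideanSpace.single i 1) :=
    (h1.continuous_fderiv (by simp)).clm_apply continuous_const
  have hsd : tsupport (fun x => fderiv ℝ φ x (EuclideanSpace.single i 1)) ⊆ tsupport φ :=
    tsupport_fderiv_apply_subset ℝ _
  simp only [sub_mul]
  rw [integral_sub (key _ _ hcd hsd h.1) (key _ _ hcd hsd h'.1),
    integral_sub (key _ _ h1.continuous le_rfl h.2.1) (key _ _ h1.continuous le_rfl h'.2.1),
    h.2.2 φ h1 h2 h3, h'.2.2 φ h1 h2 h3]
  ring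

end StrainFEM

/-! ### Geometry of simplicial triangulations -/

namespace StrainFEM
open Filter Topology Set
variable {d : ℕ} {Ω : Set (Pt d)}

/-- The closed simplex with vertices `s`. -/
abbrev hull (s : Finset (Pt d)) : Set (Pt d) := convexHull ℝ (s : Set (Pt d))

theorem isCompact_hull (s : Finset (Pt d)) : IsCompact (hull s) :=
  s.finite_toSet.isCompact_convexHull ℝ

theorem isClosed_hull (s : Finset (Pt d)) : IsClosed (hull s) := (isCompact_hull s).isClosed

theorem convex_hull (s : Finset (Pt d)) : Convex ℝ (hull s) := convex_convexHull ℝ _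

theorem mem_hull {s : Finset (Pt d)} {p : Pt d} (hp : p ∈ s) : p ∈ hull s :=
  subset_convexHull ℝ _ hp

/-- At most `d` points span a proper affine subspace, by counting dimensions. -/
theorem volume_hull_eq_zero {s : Finset (Pt d)} (hs : s.card ≤ d) : volume (hull s) = 0 := by
  classical
  rcases s.eq_empty_or_nonempty with rfl | hne
  · simp [hull]
  · refine measure_mono_null (convexHull_subset_affineSpan _)
      (Measure.addHaar_affineSubspace volume _ fun htop => ?_)
    obtain ⟨n, hn⟩ := Nat.exists_eq_add_one_of_ne_zero hne.card_pos.ne'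
    have h1 := finrank_vectorSpan_image_finset_le ℝ (id : Pt d → Pt d) s hn
    rw [Finset.image_id] at h1
    have h2 : vectorSpan ℝ (s : Set (Pt d)) = ⊤ := by
      rw [← direction_affineSpan, htop, AffineSubspace.direction_top]
    rw [h2, finrank_top, finrank_euclideanSpace_fin] at h1
    omega

namespace Triangulation

variable (T : Triangulation Ω)

/-- The vertex sets of the elements. -/
noncomputable def cells : Finset (Finset (Pt d)) :=
  (T.finite_faces.subset (sep_subset _ fun s => s.card = d + 1)).toFinset

variable {T}

theorem mem_cells {s : Finset (Pt d)} : s ∈ T.cells ↔ s ∈ T.complex.faces ∧ s.card = d + 1 := by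
  simp [cells]

theorem mem_elements_iff {τ : Set (Pt d)} : τ ∈ T.elements ↔ ∃ s ∈ T.cells, τ = hull s := by
  simp only [elements, mem_cells]
  constructor
  · rintro ⟨s, h1, h2, h3⟩; exact ⟨s, ⟨h1, h2⟩, h3⟩
  · rintro ⟨s, ⟨h1, h2⟩, h3⟩; exact ⟨s, h1, h2, h3⟩

theorem hull_mem_elements {s : Finset (Pt d)} (hs : s ∈ T.cells) : hull s ∈ T.elements :=
  mem_elements_iff.2 ⟨s, hs, rfl⟩

theorem affineIndependent {s : Finset (Pt d)} (hs : s ∈ T.cells) :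
    AffineIndependent ℝ ((↑) : s → Pt d) := T.complex.indep (mem_cells.1 hs).1

theorem affineSpan_eq_top {s : Finset (Pt d)} (hs : s ∈ T.cells) :
    affineSpan ℝ (s : Set (Pt d)) = ⊤ := by
  have := (affineIndependent hs).affineSpan_eq_top_iff_card_eq_finrank_add_one.2
    (by simp [(mem_cells.1 hs).2])
  simpa using this

theorem interior_nonempty {s : Finset (Pt d)} (hs : s ∈ T.cells) : (interior (hull s)).Nonempty :=
  interior_convexHull_nonempty_iff_affineSpan_eq_top.2 (affineSpan_eq_top hs)

theorem closure_interior {s : Finset (Pt d)} (hs : s ∈ T.cells) :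
    closure (interior (hull s)) = hull s := by
  rw [(convex_hull s).closure_interior_eq_closure_of_nonempty_interior (interior_nonempty hs),
    (isClosed_hull s).closure_eq]

theorem hull_subset_closure {s : Finset (Pt d)} (hs : s ∈ T.cells) : hull s ⊆ closure Ω := by
  rw [← T.space_eq]
  exact T.complex.convexHull_subset_space (mem_cells.1 hs).1

theorem interior_subset {s : Finset (Pt d)} (hs : s ∈ T.cells) : interior (hull s) ⊆ Ω := by
  rw [← T.interior_space]
  exact interior_mono (T.complex.convexHull_subset_space (mem_cells.1 hs).1)

theorem isCompact_closure (T : Triangulation Ω) : IsCompact (closure Ω) := by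
  rw [← T.space_eq, Geometry.SimplicialComplex.space]
  exact T.finite_faces.isCompact_biUnion fun s _ => isCompact_hull s

theorem volume_ne_top (T : Triangulation Ω) : volume Ω ≠ ⊤ :=
  (T.isCompact_closure.isBounded.subset subset_closure).measure_lt_top.ne

theorem card_le {s : Finset (Pt d)} (hs : s ∈ T.complex.faces) : s.card ≤ d + 1 := by
  have h := (T.complex.indep hs).card_le_finrank_succ
  have h2 := Submodule.finrank_le (vectorSpan ℝ (range ((↑) : s → Pt d)))
  rw [finrank_euclideanSpace_fin] at h2
  simp only [Fintype.card_coe] at h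
  omega

/-- The complex is not assumed to be pure. What the full-dimensional simplices leave uncovered in
`Ω` is open and is contained in lower-dimensional simplices, hence null, hence empty. -/
theorem closure_eq_biUnion (T : Triangulation Ω) : closure Ω = ⋃ s ∈ T.cells, hull s := by
  have hcl : IsClosed (⋃ s ∈ T.cells, hull s) :=
    isClosed_biUnion_finset fun s _ => isClosed_hull s
  refine Subset.antisymm (closure_minimal ?_ hcl) (iUnion₂_subset fun s hs => hull_subset_closure hs)
  have hnull : volume (⋃ s ∈ T.complex.faces \ T.cells, hull s) = 0 := by
    refine (measure_biUnion_null_iff (T.finite_faces.subset sdiff_subset).countable).2 ?_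
    rintro s ⟨hs, hs'⟩
    refine volume_hull_eq_zero ?_
    have := card_le hs
    have : s.card ≠ d + 1 := fun h => hs' (mem_cells.2 ⟨hs, h⟩)
    omega
  intro x hx
  by_contra hxn
  have hΩ : IsOpen Ω := T.interior_space ▸ isOpen_interior
  have hopen : IsOpen (Ω \ ⋃ s ∈ T.cells, hull s) := hΩ.sdiff hcl
  have h1 : (Ω \ ⋃ s ∈ T.cells, hull s) ⊆ ⋃ s ∈ T.complex.faces \ T.cells, hull s := by
    rintro y ⟨hy, hy'⟩
    have hy2 : y ∈ T.complex.space := T.space_eq ▸ subset_closure hy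
    obtain ⟨s, hs, hys⟩ := T.complex.mem_space_iff.1 hy2
    refine mem_biUnion ⟨hs, fun hsc => hy' (mem_biUnion hsc hys)⟩ hys
  exact (hopen.measure_pos volume ⟨x, hx, hxn⟩).ne' (measure_mono_null h1 hnull)

theorem exists_mem_hull {x : Pt d} (hx : x ∈ closure Ω) : ∃ s ∈ T.cells, x ∈ hull s := by
  rw [T.closure_eq_biUnion] at hx
  simpa using hx

theorem hull_inter_hull [DecidableEq (Pt d)] {s t : Finset (Pt d)} (hs : s ∈ T.cells)
    (ht : t ∈ T.cells) : hull s ∩ hull t = hull (s ∩ t) := by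
  rw [hull, hull, T.complex.convexHull_inter_convexHull (mem_cells.1 hs).1 (mem_cells.1 ht).1]
  simp [hull]

/-- By conformity two distinct elements meet in the hull of at most `d` points. This is a null set,
so an open set contained in it is empty. -/
theorem pairwise_disjoint_interior (T : Triangulation Ω) :
    (T.cells : Set (Finset (Pt d))).Pairwise
      (Function.onFun Disjoint fun s => interior (hull s)) := by
  classical
  intro s hs t ht hst
  have hs' := mem_cells.1 hs
  have ht' := mem_cells.1 ht
  change Disjoint (interior (hull s)) (interior (hull t))
  rw [Set.disjoint_iff_inter_eq_empty, ← interior_inter, hull_inter_hull hs ht]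
  by_contra hne
  have hc : (s ∩ t).card ≤ d := by
    have h1 : (s ∩ t).card < s.card := by
      refine Finset.card_lt_card (Finset.inter_subset_left.ssubset_of_ne fun h => hst ?_)
      exact Finset.eq_of_subset_of_card_le (Finset.inter_eq_left.1 h) (by omega)
    omega
  exact (isOpen_interior.measure_pos volume (nonempty_iff_ne_empty.2 hne)).ne'
    (measure_mono_null _root_.interior_subset (volume_hull_eq_zero hc))

/-- Frontiers of convex sets are null. Integrals and a.e. statements over `Ω` thereby split over the
open elements. -/
theorem ae_eq_biUnion_interior (T : Triangulation Ω) :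
    (⋃ s ∈ T.cells, interior (hull s)) =ᵐ[volume] Ω := by
  refine ae_eq_set.2 ⟨?_, ?_⟩
  · rw [sdiff_eq_empty.2 (iUnion₂_subset fun s hs => interior_subset hs), measure_empty]
  · have hnull : volume (⋃ s ∈ T.cells, frontier (hull s)) = 0 := by
      refine (measure_biUnion_null_iff T.cells.countable_toSet).2 fun s _ => ?_
      exact (convex_hull s).addHaar_frontier volume
    refine measure_mono_null ?_ hnull
    rintro x ⟨hx, hx'⟩
    obtain ⟨s, hs, hxs⟩ := T.exists_mem_hull (subset_closure hx)
    refine mem_biUnion hs ⟨subset_closure hxs, fun h => hx' (mem_biUnion hs h)⟩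

theorem setIntegral_eq_sum (T : Triangulation Ω) {F : Pt d → ℝ} (hF : IntegrableOn F Ω volume) :
    ∫ x in Ω, F x = ∑ s ∈ T.cells, ∫ x in interior (hull s), F x := by
  rw [← setIntegral_congr_set T.ae_eq_biUnion_interior,
    integral_biUnion_finset _ (fun s _ => isOpen_interior.measurableSet)
      T.pairwise_disjoint_interior fun s hs => hF.mono_set (interior_subset hs)]

theorem ae_of_ae_interior (T : Triangulation Ω) {P : Pt d → Prop}
    (h : ∀ s ∈ T.cells, ∀ᵐ x ∂(volume.restrict (interior (hull s))), P x) :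
    ∀ᵐ x ∂(volume.restrict Ω), P x := by
  rw [← Measure.restrict_congr_set T.ae_eq_biUnion_interior]
  rw [ae_restrict_biUnion_finset_iff]
  exact h

theorem eventually_mem_hull (T : Triangulation Ω) (x : Pt d) :
    ∀ᶠ y in 𝓝 x, ∀ s ∈ T.cells, y ∈ hull s → x ∈ hull s := by
  refine (Finset.eventually_all T.cells).2 fun s _ => ?_
  by_cases hx : x ∈ hull s
  · exact Eventually.of_forall fun _ _ => hx
  · filter_upwards [(isClosed_hull s).isOpen_compl.mem_nhds hx] with y hy hy'
    exact absurd hy' hy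

/-- Functions on the elements that agree on common points can be glued. -/
theorem exists_glue (T : Triangulation Ω) {β : Type*} [Inhabited β] {F : Finset (Pt d) → Pt d → β}
    (h : ∀ s ∈ T.cells, ∀ t ∈ T.cells, ∀ x, x ∈ hull s → x ∈ hull t → F s x = F t x) :
    ∃ f : Pt d → β, ∀ s ∈ T.cells, ∀ x ∈ hull s, f x = F s x := by
  classical
  refine ⟨fun x => if hx : ∃ s ∈ T.cells, x ∈ hull s then F hx.choose x else default,
    fun s hs x hx => ?_⟩
  have hex : ∃ s ∈ T.cells, x ∈ hull s := ⟨s, hs, hx⟩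
  simp only [dif_pos hex]
  exact h _ hex.choose_spec.1 _ hs _ hex.choose_spec.2 hx

theorem continuousOn_closure (T : Triangulation Ω) {f : Pt d → ℝ}
    (h : ∀ s ∈ T.cells, ContinuousOn f (hull s)) : ContinuousOn f (closure Ω) := by
  have hU : closure Ω = ⋃ s : T.cells, hull s.1 := by
    rw [T.closure_eq_biUnion]
    ext x
    simp
  rw [hU]
  exact (locallyFinite_of_finite _).continuousOn_iUnion (fun s => isClosed_hull s.1)
    fun s => h s.1 s.2

/-- A point `y` near `x` lies in an element which, by closedness, already contains `x`. Hence no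
path crossing several elements has to be followed. -/
theorem eventually_of_cells (T : Triangulation Ω) {f : Pt d → ℝ} {K : ℝ}
    (h : ∀ s ∈ T.cells, ∀ x ∈ hull s, ∀ y ∈ hull s, |f y - f x| ≤ K * ‖y - x‖) {x : Pt d}
    (hx : x ∈ Ω) : ∀ᶠ y in 𝓝 x, |f y - f x| ≤ K * ‖y - x‖ := by
  have hΩ : IsOpen Ω := T.interior_space ▸ isOpen_interior
  filter_upwards [T.eventually_mem_hull x, hΩ.mem_nhds hx] with y hy hyΩ
  obtain ⟨s, hs, hys⟩ := T.exists_mem_hull (subset_closure hyΩ)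
  exact h s hs x (hy s hs hys) y hys

theorem unifLocLip_of_cells (T : Triangulation Ω) {f : Pt d → ℝ} {K : ℝ} (hK : 0 ≤ K)
    (h : ∀ s ∈ T.cells, ∀ x ∈ hull s, ∀ y ∈ hull s, |f y - f x| ≤ K * ‖y - x‖) :
    UnifLocLip Ω f := by
  have hc : ContinuousOn f (closure Ω) := T.continuousOn_closure fun s hs => by
    refine LipschitzOnWith.continuousOn (K := K.toNNReal)
      (LipschitzOnWith.of_dist_le_mul fun x hx y hy => ?_)
    rw [Real.dist_eq, dist_eq_norm, Real.coe_toNNReal _ hK]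
    exact h s hs y hy x hx
  obtain ⟨B, hB⟩ := T.isCompact_closure.exists_bound_of_continuousOn hc
  exact ⟨K, |B|, hK, abs_nonneg _, fun x hx =>
    ⟨(hB x (subset_closure hx)).trans (le_abs_self _), T.eventually_of_cells h hx⟩⟩

theorem diam_le_meshSize {s : Finset (Pt d)} (hs : s ∈ T.cells) :
    Metric.diam (hull s) ≤ T.meshSize := by
  refine le_csSup ?_ ⟨_, hull_mem_elements hs, rfl⟩
  have : T.elements = hull '' (T.cells : Set (Finset (Pt d))) := by
    ext τ
    rw [mem_elements_iff]
    simp [eq_comm]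
  rw [this]
  exact ((T.cells.finite_toSet.image _).image _).bddAbove

/-- Barycentric coordinates. -/
theorem exists_barycentric {s : Finset (Pt d)} (hs : s ∈ T.cells) :
    ∃ t : Pt d → Pt d →ᵃ[ℝ] ℝ, (∀ x, ∑ p ∈ s, t p x = 1) ∧ (∀ x, ∑ p ∈ s, t p x • p = x) ∧
      (∀ x ∈ hull s, ∀ p ∈ s, 0 ≤ t p x) ∧ ∀ p ∈ s, ∀ q ∈ s, p ≠ q → t p q = 0 := by
  classical
  let b : AffineBasis s ℝ (Pt d) := ⟨(↑), affineIndependent hs, by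
    simpa using affineSpan_eq_top hs⟩
  have hb : ∀ p : s, b p = (p : Pt d) := fun _ => rfl
  refine ⟨fun p => if hp : p ∈ s then b.coord ⟨p, hp⟩ else 0, fun x => ?_, fun x => ?_, ?_, ?_⟩
  · rw [← b.sum_coord_apply_eq_one x, ← Finset.sum_coe_sort s]
    simp
  · conv_rhs => rw [← b.linear_combination_coord_eq_self x]
    rw [← Finset.sum_coe_sort s]
    simp [hb]
  · intro x hx p hp
    have h1 : x ∈ convexHull ℝ (range b) := by
      have : range b = (s : Set (Pt d)) := Subtype.range_coe
      rwa [this]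
    rw [b.convexHull_eq_nonneg_coord] at h1
    simpa [hp] using h1 ⟨p, hp⟩
  · intro p hp q hq hpq
    simp only [hp, dif_pos]
    exact b.coord_apply_ne (i := ⟨p, hp⟩) (j := ⟨q, hq⟩) (by simpa using hpq)

end Triangulation
end StrainFEM

/-! ### Representatives of Sobolev functions that are regular on each closed element -/

namespace StrainFEM
open Filter Topology Set
variable {d : ℕ} {Ω : Set (Pt d)}

theorem abs_sub_le_of_lipschitzWith {F : Pt d → ℝ} {L : ℝ} (hL : 0 ≤ L)
    (hF : LipschitzWith L.toNNReal F) (x y : Pt d) : |F y - F x| ≤ L * ‖y - x‖ := by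
  have := hF.dist_le_mul y x
  rwa [Real.dist_eq, dist_eq_norm, Real.coe_toNNReal _ hL] at this

theorem eqOn_closure_of_ae_eq {D : Set (Pt d)} (hD : IsOpen D) {F G u : Pt d → ℝ}
    (hF : Continuous F) (hG : Continuous G)
    (h1 : F =ᵐ[volume.restrict D] u) (h2 : G =ᵐ[volume.restrict D] u) :
    EqOn F G (closure D) := by
  have h3 := Measure.eqOn_open_of_ae_eq (h1.trans h2.symm) hD hF.continuousOn hG.continuousOn
  exact h3.closure hF hG

/-- If `u` has Lipschitz representatives with a uniform constant on convex open subsets of `Ω` and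
the boundary of `Ω` does not touch itself, then `u` has a representative that is Lipschitz on each
closed element. -/
theorem exists_cellwise_lipschitz (hΩb : LocallyConnectedAtBoundary Ω) {u : Pt d → ℝ} {L : ℝ}
    (hL : 0 ≤ L)
    (hu : ∀ D ⊆ Ω, IsOpen D → Convex ℝ D →
      ∃ F : Pt d → ℝ, LipschitzWith L.toNNReal F ∧ F =ᵐ[volume.restrict D] u)
    (T : Triangulation Ω) :
    ∃ ζ : Pt d → ℝ, ζ =ᵐ[volume.restrict Ω] u ∧
      ∀ s ∈ T.cells, ∀ x ∈ hull s, ∀ y ∈ hull s, |ζ y - ζ x| ≤ L * ‖y - x‖ := by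
  have hΩ : IsOpen Ω := T.interior_space ▸ isOpen_interior
  have hF : ∀ s, ∃ F : Pt d → ℝ, s ∈ T.cells →
      LipschitzWith L.toNNReal F ∧ F =ᵐ[volume.restrict (interior (hull s))] u := by
    intro s
    by_cases hs : s ∈ T.cells
    · obtain ⟨F, hF⟩ := hu (interior (hull s)) (Triangulation.interior_subset hs) isOpen_interior
        (convex_hull s).interior
      exact ⟨F, fun _ => hF⟩
    · exact ⟨0, fun h => absurd h hs⟩
  choose F hF using hF
  -- At an interior point both extensions agree with the representative on a small ball, since each
  -- agrees with it a.e. on the part of the ball inside its element, and `x` is in the closure of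
  -- that part.
  have hΩeq : ∀ s ∈ T.cells, ∀ t ∈ T.cells, ∀ x ∈ Ω, x ∈ hull s → x ∈ hull t → F s x = F t x := by
    intro s hs t ht x hx hxs hxt
    obtain ⟨ε, hε, hb⟩ := Metric.isOpen_iff.1 hΩ x hx
    obtain ⟨G, hG, hGu⟩ := hu _ hb Metric.isOpen_ball (convex_ball x ε)
    have key : ∀ r ∈ T.cells, x ∈ hull r → F r x = G x := by
      intro r hr hxr
      have h1 : F r =ᵐ[volume.restrict (interior (hull r) ∩ Metric.ball x ε)] u :=
        ae_restrict_of_ae_restrict_of_subset inter_subset_left (hF r hr).2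
      have h2 : G =ᵐ[volume.restrict (interior (hull r) ∩ Metric.ball x ε)] u :=
        ae_restrict_of_ae_restrict_of_subset inter_subset_right hGu
      refine eqOn_closure_of_ae_eq (isOpen_interior.inter Metric.isOpen_ball)
        (hF r hr).1.continuous hG.continuous h1 h2 ?_
      rw [inter_comm]
      refine Metric.isOpen_ball.inter_closure ⟨Metric.mem_ball_self hε, ?_⟩
      rwa [Triangulation.closure_interior hr]
    rw [key s hs hxs, key t ht hxt]
  have heq : ∀ s ∈ T.cells, ∀ t ∈ T.cells, ∀ x, x ∈ hull s → x ∈ hull t → F s x = F t x := by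
    classical
    intro s hs t ht p hps hpt
    by_cases hp : p ∈ Ω
    · exact hΩeq s hs t ht p hp hps hpt
    by_contra hne
    have hpf : p ∈ frontier Ω := by
      rw [hΩ.frontier_eq]
      exact ⟨Triangulation.hull_subset_closure hs hps, hp⟩
    -- The finitely many values `F r p` are separated by a gap `δ`. Each `F r` is defined on all of
    -- `ℝ^d`, so elements not containing `p` need no special treatment.
    obtain ⟨δ, hδ, hgap⟩ : ∃ δ > 0, ∀ r ∈ T.cells, ∀ r' ∈ T.cells, F r p ≠ F r' p →
        δ ≤ |F r p - F r' p| := by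
      have hfin : ((fun a : Finset (Pt d) × Finset (Pt d) => |F a.1 p - F a.2 p|) ''
          {a | a ∈ T.cells ×ˢ T.cells ∧ F a.1 p ≠ F a.2 p}).Finite :=
        ((T.cells ×ˢ T.cells).finite_toSet.subset fun a ha => ha.1).image _
      have hneS : ((fun a : Finset (Pt d) × Finset (Pt d) => |F a.1 p - F a.2 p|) ''
          {a | a ∈ T.cells ×ˢ T.cells ∧ F a.1 p ≠ F a.2 p}).Nonempty :=
        ⟨_, (s, t), ⟨Finset.mk_mem_product hs ht, hne⟩, rfl⟩
      obtain ⟨m, ⟨a, ha, rfl⟩, hm⟩ := hfin.exists_minimal hneS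
      refine ⟨_, abs_pos.2 (sub_ne_zero.2 ha.2), fun r hr r' hr' hrr => ?_⟩
      have hmem : |F r p - F r' p| ∈ ((fun a : Finset (Pt d) × Finset (Pt d) =>
          |F a.1 p - F a.2 p|) '' {a | a ∈ T.cells ×ˢ T.cells ∧ F a.1 p ≠ F a.2 p}) :=
        ⟨(r, r'), ⟨Finset.mk_mem_product hr hr', hrr⟩, rfl⟩
      by_contra hlt
      exact hlt (hm hmem (not_le.1 hlt).le)
    obtain ⟨ε₁, hε₁, hball⟩ := Metric.eventually_nhds_iff_ball.1 (T.eventually_mem_hull p)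
    -- Within distance `ε` of `p` each `F r` moves by at most `δ / 4`; using `L + 1` avoids division
    -- by zero.
    set ε := min ε₁ (δ / (4 * (L + 1))) with hε
    have hε0 : 0 < ε := lt_min hε₁ (by positivity)
    obtain ⟨U, hU, hUb, hUc⟩ := hΩb p hpf ε hε0
    set A := ⋃ r ∈ T.cells.filter fun r => F r p = F s p, hull r with hA
    set B := ⋃ r ∈ T.cells.filter fun r => F r p ≠ F s p, hull r with hB
    have hmeet : ∀ r ∈ T.cells, p ∈ hull r → ((U ∩ Ω) ∩ hull r).Nonempty := by
      intro r hr hpr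
      rw [← Triangulation.closure_interior hr] at hpr
      obtain ⟨y, hy, hyr⟩ := mem_closure_iff_nhds.1 hpr U hU
      exact ⟨y, ⟨hy, Triangulation.interior_subset hr hyr⟩, interior_subset hyr⟩
    -- The closed sets `A` and `B` cover the connected set `U ∩ Ω` and both meet it, so they share a
    -- point `x` of it. There the two extensions agree, so their values at `p` differ by at most `δ
    -- / 2`, contradicting the gap.
    obtain ⟨x, ⟨hxU, hxΩ⟩, hxA, hxB⟩ := isPreconnected_closed_iff.1 hUc.isPreconnected A B
      (isClosed_biUnion_finset fun r _ => isClosed_hull r)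
      (isClosed_biUnion_finset fun r _ => isClosed_hull r)
      (by
        rintro x ⟨-, hx⟩
        obtain ⟨r, hr, hxr⟩ := T.exists_mem_hull (subset_closure hx)
        by_cases h : F r p = F s p
        · exact Or.inl (mem_biUnion (Finset.mem_coe.2 (Finset.mem_filter.2 ⟨hr, h⟩)) hxr)
        · exact Or.inr (mem_biUnion (Finset.mem_coe.2 (Finset.mem_filter.2 ⟨hr, h⟩)) hxr))
      ((hmeet s hs hps).mono (inter_subset_inter_right _ fun y hy =>
        mem_biUnion (Finset.mem_coe.2 (Finset.mem_filter.2 ⟨hs, rfl⟩)) hy))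
      ((hmeet t ht hpt).mono (inter_subset_inter_right _ fun y hy =>
        mem_biUnion (Finset.mem_coe.2 (Finset.mem_filter.2 ⟨ht, Ne.symm hne⟩)) hy))
    simp only [hA, hB, mem_iUnion, Finset.mem_filter, exists_prop] at hxA hxB
    obtain ⟨r, ⟨hr, hrs⟩, hxr⟩ := hxA
    obtain ⟨r', ⟨hr', hrs'⟩, hxr'⟩ := hxB
    have h1 := hgap r' hr' r hr (by rw [hrs]; exact hrs')
    have h2 := hΩeq r hr r' hr' x hxΩ hxr hxr'
    have h3 := abs_sub_le_of_lipschitzWith hL (hF r hr).1 p x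
    have h4 := abs_sub_le_of_lipschitzWith hL (hF r' hr').1 p x
    have h5 : ‖x - p‖ ≤ δ / (4 * (L + 1)) := by
      have := hUb hxU
      rw [Metric.mem_ball, dist_eq_norm] at this
      exact this.le.trans (min_le_right _ _)
    have h6 : L * ‖x - p‖ ≤ δ / 4 := by
      calc L * ‖x - p‖ ≤ (L + 1) * (δ / (4 * (L + 1))) := by gcongr; linarith
        _ = δ / 4 := by field_simp
    have h7 : |F r' p - F r p| ≤ |F r x - F r p| + |F r' x - F r' p| := by
      have : F r' p - F r p = (F r x - F r p) - (F r' x - F r' p) := by rw [h2]; ring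
      rw [this]
      exact abs_sub _ _
    linarith
  obtain ⟨ζ, hζ⟩ := T.exists_glue heq
  refine ⟨ζ, T.ae_of_ae_interior fun s hs => ?_, fun s hs x hx y hy => ?_⟩
  · filter_upwards [(hF s hs).2, ae_restrict_mem isOpen_interior.measurableSet] with x hx hxs
    rw [hζ s hs x (interior_subset hxs), hx]
  · rw [hζ s hs x hx, hζ s hs y hy]
    exact abs_sub_le_of_lipschitzWith hL (hF s hs).1 x y

theorem exists_bound_of_memLp_top {u : Pt d → ℝ} (hu : MemLp u ⊤ (volume.restrict Ω)) :
    ∃ M, 0 ≤ M ∧ ∀ᵐ x ∂(volume.restrict Ω), |u x| ≤ M := by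
  refine ⟨(eLpNormEssSup u (volume.restrict Ω)).toReal, ENNReal.toReal_nonneg, ?_⟩
  have h1 := hu.2
  rw [eLpNorm_exponent_top] at h1
  filter_upwards [enorm_ae_le_eLpNormEssSup u (volume.restrict Ω)] with x hx
  have := ENNReal.toReal_mono h1.ne hx
  simpa using this

theorem MemSobolev.memLp {p : ℝ≥0∞} {m : ℕ} {u : Pt d → ℝ} (h : MemSobolev Ω p m u) :
    MemLp u p (volume.restrict Ω) := by
  cases m with
  | zero => exact h
  | succ m => exact h.1

/-- Functions in `H^{1,∞}` have Lipschitz representatives on convex open subsets. -/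
theorem MemSobolev.exists_lipschitz (hv : volume Ω ≠ ⊤) {m : ℕ} {u : Pt d → ℝ}
    (h : MemSobolev Ω ⊤ (m + 1) u) :
    ∃ L : ℝ, 0 ≤ L ∧ ∀ D ⊆ Ω, IsOpen D → Convex ℝ D →
      ∃ F : Pt d → ℝ, LipschitzWith L.toNNReal F ∧ F =ᵐ[volume.restrict D] u := by
  choose g hg hgs using h.2
  choose M hM0 hM using fun i => exists_bound_of_memLp_top (hgs i).memLp
  have hfin : IsFiniteMeasure (volume.restrict Ω) := ⟨by simpa using hv.lt_top⟩
  have hS : ∀ i, M i ≤ ∑ i, M i := fun i =>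
    Finset.single_le_sum (fun i _ => hM0 i) (Finset.mem_univ i)
  have hS0 : 0 ≤ ∑ i, M i := Finset.sum_nonneg fun i _ => hM0 i
  refine ⟨d * ∑ i, M i, by positivity, fun D hD hDo hDc => ?_⟩
  have hui : IntegrableOn u Ω volume := h.1.integrable le_top
  refine exists_lipschitz_representative hDo hDc (hui.mono_set hD) (fun i => (hg i).mono hD) hS0
    fun i => ?_
  filter_upwards [ae_restrict_of_ae_restrict_of_subset hD (hM i)] with x hx
  exact hx.trans (hS i)

theorem isWeakDeriv_clm {D : Set (Pt d)} (hD : IsOpen D) (hb : Bornology.IsBounded D)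
    (a : Pt d →L[ℝ] ℝ) (i : Fin d) :
    IsWeakDeriv D i a fun _ => a (EuclideanSpace.single i 1) := by
  have h : UnifLocLip D a := by
    obtain ⟨R, hR⟩ := hb.exists_norm_le
    refine ⟨‖a‖, ‖a‖ * |R|, norm_nonneg _, by positivity, fun x hx => ⟨?_, ?_⟩⟩
    · exact (a.le_opNorm x).trans (mul_le_mul_of_nonneg_left ((hR x hx).trans (le_abs_self _))
        (norm_nonneg _))
    · refine Eventually.of_forall fun y => ?_
      rw [← map_sub]
      exact a.le_opNorm _
  have := h.isWeakDeriv hD hb.measure_lt_top.ne i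
  have e : pd i a = fun _ => a (EuclideanSpace.single i 1) := by
    ext x
    simp [pd]
  rwa [e] at this

/-- Functions in `H^{2,∞}` have a representative that is Lipschitz on each element and is affine
there up to a function with Lipschitz constant proportional to the diameter. -/
theorem exists_cellwise_taylor (hΩb : LocallyConnectedAtBoundary Ω) (hv : volume Ω ≠ ⊤) {m : ℕ}
    {u : Pt d → ℝ} (hu : MemSobolev Ω ⊤ (m + 2) u) :
    ∃ L : ℝ, 0 ≤ L ∧ ∀ T : Triangulation Ω, ∃ ζ : Pt d → ℝ, ζ =ᵐ[volume.restrict Ω] u ∧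
      ∀ s ∈ T.cells, (∀ x ∈ hull s, ∀ y ∈ hull s, |ζ y - ζ x| ≤ L * ‖y - x‖) ∧
        ∃ a : Pt d →L[ℝ] ℝ, ∀ x ∈ hull s, ∀ y ∈ hull s,
          |(ζ y - a y) - (ζ x - a x)| ≤ L * Metric.diam (hull s) * ‖y - x‖ := by
  obtain ⟨L, hL, hLip⟩ := hu.exists_lipschitz (m := m + 1) hv
  choose g hg hgs using hu.2
  choose M hM0 hM using fun i => (hgs i).exists_lipschitz (m := m) hv
  have hfin : IsFiniteMeasure (volume.restrict Ω) := ⟨by simpa using hv.lt_top⟩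
  have hS : ∀ i, M i ≤ ∑ i, M i := fun i =>
    Finset.single_le_sum (fun i _ => hM0 i) (Finset.mem_univ i)
  have hS0 : 0 ≤ ∑ i, M i := Finset.sum_nonneg fun i _ => hM0 i
  set M' := ∑ i, M i with hM'
  refine ⟨L + d * M', by positivity, fun T => ?_⟩
  obtain ⟨ζ, hζu, hζ⟩ := exists_cellwise_lipschitz hΩb hL hLip T
  refine ⟨ζ, hζu, fun s hs => ⟨fun x hx y hy => (hζ s hs x hx y hy).trans ?_, ?_⟩⟩
  · gcongr
    have : 0 ≤ d * M' := by positivity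
    linarith
  set D := interior (hull s) with hDdef
  have hDo : IsOpen D := isOpen_interior
  have hDΩ : D ⊆ Ω := Triangulation.interior_subset hs
  have hDc : Convex ℝ D := (convex_hull s).interior
  have hbd : Bornology.IsBounded (hull s) := (isCompact_hull s).isBounded
  obtain ⟨c, hc⟩ : D.Nonempty := Triangulation.interior_nonempty hs
  choose G hG hGg using fun i => hM i D hDΩ hDo hDc
  -- The gradient of `u` frozen at `c`. As the first derivatives are Lipschitz, those of `u - a` are
  -- of the order of the diameter, and `exists_lipschitz_representative` turns this into the
  -- Lipschitz constant. The constant term of the affine approximation cancels in differences, so a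
  -- linear `a` is enough.
  let a : Pt d →L[ℝ] ℝ := ∑ i, G i c • EuclideanSpace.proj i
  have ha : ∀ i, a (EuclideanSpace.single i 1) = G i c := by
    intro i
    simp [a]
  have hdiam : 0 ≤ Metric.diam (hull s) := Metric.diam_nonneg
  obtain ⟨F, hF, hFu⟩ := exists_lipschitz_representative (u := fun x => u x - a x)
    (g := fun i x => g i x - G i c) (M := M' * Metric.diam (hull s)) hDo hDc
    ((IntegrableOn.mono_set (hu.1.integrable le_top) hDΩ).sub
      ((a.continuous.continuousOn.integrableOn_compact (isCompact_hull s)).mono_set interior_subset))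
    (fun i => by
      have := ((hg i).mono hDΩ).sub (isWeakDeriv_clm hDo (hbd.subset interior_subset) a i)
      rwa [ha] at this) (by positivity)
    (fun i => by
      filter_upwards [hGg i, ae_restrict_mem hDo.measurableSet] with x hx hxD
      rw [← hx]
      refine (abs_sub_le_of_lipschitzWith (hM0 i) (hG i) c x).trans ?_
      rw [← dist_eq_norm]
      exact mul_le_mul (hS i) (Metric.dist_le_diam_of_mem hbd (interior_subset hxD)
        (interior_subset hc)) dist_nonneg hS0)
  have hζc : ContinuousOn ζ (hull s) := by
    refine LipschitzOnWith.continuousOn (K := L.toNNReal)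
      (LipschitzOnWith.of_dist_le_mul fun x hx y hy => ?_)
    rw [Real.dist_eq, dist_eq_norm, Real.coe_toNNReal _ hL]
    exact hζ s hs y hy x hx
  have hEq : EqOn (fun x => ζ x - a x) F D := by
    refine Measure.eqOn_open_of_ae_eq (μ := volume) ?_ hDo
      ((hζc.mono interior_subset).sub a.continuous.continuousOn) hF.continuous.continuousOn
    filter_upwards [hFu, ae_restrict_of_ae_restrict_of_subset hDΩ hζu] with x h1 h2
    rw [h1, h2]
  have hEq' : EqOn (fun x => ζ x - a x) F (hull s) := by
    have := hEq.of_subset_closure (t := hull s) (hζc.sub a.continuous.continuousOn)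
      hF.continuous.continuousOn interior_subset (Triangulation.closure_interior hs).ge
    exact this
  refine ⟨a, fun x hx y hy => ?_⟩
  have e1 := hEq' hx
  have e2 := hEq' hy
  simp only at e1 e2
  rw [e1, e2]
  refine (abs_sub_le_of_lipschitzWith (by positivity) hF x y).trans ?_
  rw [← mul_assoc (d : ℝ)]
  gcongr
  linarith

end StrainFEM

/-! ### Polynomials of bounded degree and the inverse inequality -/

namespace StrainFEM
open Filter Topology Set
variable {d : ℕ} {Ω : Set (Pt d)}

/-- The function on `ℝ^d` defined by a polynomial. -/
noncomputable def polyFun (p : MvPolynomial (Fin d) ℝ) (x : Pt d) : ℝ :=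
  MvPolynomial.eval (fun i => x i) p

theorem polyFun_C (a : ℝ) (x : Pt d) : polyFun (MvPolynomial.C a) x = a := by simp [polyFun]

theorem polyFun_X (i : Fin d) (x : Pt d) : polyFun (MvPolynomial.X i) x = x i := by simp [polyFun]

theorem polyFun_add (p q : MvPolynomial (Fin d) ℝ) (x : Pt d) :
    polyFun (p + q) x = polyFun p x + polyFun q x := by simp [polyFun]

theorem polyFun_sub (p q : MvPolynomial (Fin d) ℝ) (x : Pt d) :
    polyFun (p - q) x = polyFun p x - polyFun q x := by simp [polyFun]

theorem polyFun_mul (p q : MvPolynomial (Fin d) ℝ) (x : Pt d) :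
    polyFun (p * q) x = polyFun p x * polyFun q x := by simp [polyFun]

theorem polyFun_sum {ι : Type*} (s : Finset ι) (p : ι → MvPolynomial (Fin d) ℝ) (x : Pt d) :
    polyFun (∑ j ∈ s, p j) x = ∑ j ∈ s, polyFun (p j) x := by simp [polyFun]

/-- The differential of a polynomial function. -/
noncomputable def polyGrad (p : MvPolynomial (Fin d) ℝ) (x : Pt d) : Pt d →L[ℝ] ℝ :=
  ∑ i, polyFun (MvPolynomial.pderiv i p) x • (EuclideanSpace.proj i : Pt d →L[ℝ] ℝ)

theorem polyGrad_apply (p : MvPolynomial (Fin d) ℝ) (x v : Pt d) :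
    polyGrad p x v = ∑ i, polyFun (MvPolynomial.pderiv i p) x * v i := by
  simp [polyGrad]

theorem hasFDerivAt_polyFun (p : MvPolynomial (Fin d) ℝ) (x : Pt d) :
    HasFDerivAt (polyFun p) (polyGrad p x) x := by
  induction p using MvPolynomial.induction_on with
  | C a =>
    have h1 : polyFun (MvPolynomial.C a : MvPolynomial (Fin d) ℝ) = fun _ => a :=
      funext fun y => polyFun_C a y
    have h2 : polyGrad (MvPolynomial.C a : MvPolynomial (Fin d) ℝ) x = 0 := by
      ext v
      simp [polyGrad_apply, polyFun]
    rw [h1, h2]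
    exact hasFDerivAt_const a x
  | add p q hp hq =>
    have h1 : polyFun (p + q) = fun y => polyFun p y + polyFun q y :=
      funext fun y => polyFun_add p q y
    have h2 : polyGrad (p + q) x = polyGrad p x + polyGrad q x := by
      ext v
      simp [polyGrad_apply, polyFun_add, add_mul, Finset.sum_add_distrib]
    rw [h1, h2]
    exact hp.add hq
  | mul_X p j hp =>
    have hj : HasFDerivAt (fun y : Pt d => y j) (EuclideanSpace.proj j : Pt d →L[ℝ] ℝ) x :=
      (EuclideanSpace.proj j : Pt d →L[ℝ] ℝ).hasFDerivAt
    have h1 : polyFun (p * MvPolynomial.X j) = fun y => polyFun p y * y j :=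
      funext fun y => by rw [polyFun_mul, polyFun_X]
    have h2 : polyGrad (p * MvPolynomial.X j) x
        = polyFun p x • (EuclideanSpace.proj j : Pt d →L[ℝ] ℝ) + x j • polyGrad p x := by
      ext v
      have h3 : ∀ i, polyFun (MvPolynomial.pderiv i (p * MvPolynomial.X j)) x * v i
          = x j * (polyFun (MvPolynomial.pderiv i p) x * v i)
            + if i = j then polyFun p x * v i else 0 := by
        intro i
        rw [Derivation.leibniz, MvPolynomial.pderiv_X, smul_eq_mul, smul_eq_mul, polyFun_add,
          polyFun_mul, polyFun_mul, polyFun_X]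
        by_cases hij : i = j
        · subst hij
          simp only [Pi.single_eq_same, if_true, show polyFun (1 : MvPolynomial (Fin d) ℝ) x = 1 by
            simp [polyFun]]
          ring
        · simp only [Pi.single_eq_of_ne (Ne.symm hij), if_neg hij,
            show polyFun (0 : MvPolynomial (Fin d) ℝ) x = 0 by simp [polyFun]]
          ring
      rw [polyGrad_apply, Finset.sum_congr rfl fun i _ => h3 i, Finset.sum_add_distrib,
        ← Finset.mul_sum]
      simp [polyGrad_apply, add_comm]
    rw [h1, h2]
    exact hp.mul hj

theorem differentiable_polyFun (p : MvPolynomial (Fin d) ℝ) : Differentiable ℝ (polyFun p) :=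
  fun x => (hasFDerivAt_polyFun p x).differentiableAt

theorem continuous_polyFun (p : MvPolynomial (Fin d) ℝ) : Continuous (polyFun p) :=
  (differentiable_polyFun p).continuous

theorem pd_polyFun (i : Fin d) (p : MvPolynomial (Fin d) ℝ) (x : Pt d) :
    pd i (polyFun p) x = polyFun (MvPolynomial.pderiv i p) x := by
  rw [pd, (hasFDerivAt_polyFun p x).fderiv, polyGrad_apply]
  simp

theorem exists_lipschitz_polyFun (p : MvPolynomial (Fin d) ℝ) {A : Set (Pt d)} (hA : IsCompact A)
    (hAc : Convex ℝ A) :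
    ∃ K, 0 ≤ K ∧ ∀ x ∈ A, ∀ y ∈ A, |polyFun p y - polyFun p x| ≤ K * ‖y - x‖ := by
  have hc : Continuous (polyGrad p) :=
    continuous_finsetSum _ fun i _ => (continuous_polyFun _).smul continuous_const
  obtain ⟨K, hK⟩ := hA.exists_bound_of_continuousOn hc.continuousOn
  refine ⟨|K|, abs_nonneg _, fun x hx y hy => ?_⟩
  exact Convex.norm_image_sub_le_of_norm_hasFDerivWithin_le
    (fun z _ => (hasFDerivAt_polyFun p z).hasFDerivWithinAt)
    (fun z hz => (hK z hz).trans (le_abs_self _)) hAc hx hy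

/-- The ball contains an open cube, and a polynomial vanishing on a product of infinite sets is
zero. -/
theorem polyFun_eq_zero {p : MvPolynomial (Fin d) ℝ} {r : ℝ} (hr : 0 < r)
    (h : ∀ x ∈ Metric.ball (0 : Pt d) r, polyFun p x = 0) : p = 0 := by
  obtain ⟨ε, hε, hb⟩ : ∃ ε > 0, ∀ v : Fin d → ℝ, (∀ i, v i ∈ Ioo (-ε) ε) →
      WithLp.toLp 2 v ∈ Metric.ball (0 : Pt d) r := by
    have hc : Continuous fun v : Fin d → ℝ => (WithLp.toLp 2 v : Pt d) :=
      PiLp.continuous_toLp 2 _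
    have ho : (fun v : Fin d → ℝ => (WithLp.toLp 2 v : Pt d)) ⁻¹' Metric.ball 0 r ∈ 𝓝 0 :=
      hc.continuousAt.preimage_mem_nhds (by simpa using Metric.ball_mem_nhds (0 : Pt d) hr)
    obtain ⟨ε, hε, hs⟩ := Metric.mem_nhds_iff.1 ho
    refine ⟨ε, hε, fun v hv => hs ?_⟩
    rw [Metric.mem_ball, dist_zero_right, pi_norm_lt_iff hε]
    exact fun i => abs_lt.2 (hv i)
  refine MvPolynomial.funext_set (fun _ => Ioo (-ε) ε)
    (fun _ => (Ioo_infinite (by linarith))) fun v hv => ?_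
  have := h _ (hb v fun i => hv i (mem_univ i))
  simpa [polyFun] using this

/-- On a finite-dimensional space a linear map is bounded by any injective one. -/
theorem exists_norm_le_of_injective {E F G : Type*} [AddCommGroup E] [Module ℝ E]
    [FiniteDimensional ℝ E] [NormedAddCommGroup F] [NormedSpace ℝ F] [NormedAddCommGroup G]
    [NormedSpace ℝ G] (f : E →ₗ[ℝ] F) (g : E →ₗ[ℝ] G) (hf : Function.Injective f) :
    ∃ C : ℝ, 0 ≤ C ∧ ∀ x, ‖g x‖ ≤ C * ‖f x‖ := by
  let e := LinearEquiv.ofInjective f hf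
  have : FiniteDimensional ℝ (LinearMap.range f) := inferInstance
  let m := LinearMap.toContinuousLinearMap (g ∘ₗ e.symm.toLinearMap)
  refine ⟨‖m‖, m.opNorm_nonneg, fun x => ?_⟩
  have := m.le_opNorm (e x)
  simpa [m, e] using this

theorem memLp_polyFun (p : MvPolynomial (Fin d) ℝ) {A : Set (Pt d)} (hA : Bornology.IsBounded A) :
    MemLp (polyFun p) 2 (volume.restrict A) := by
  have : IsFiniteMeasure (volume.restrict A) := ⟨by simpa using hA.measure_lt_top⟩
  obtain ⟨C, hC⟩ := hA.isCompact_closure.exists_bound_of_continuousOn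
    (continuous_polyFun p).continuousOn
  refine MemLp.of_bound (continuous_polyFun p).aestronglyMeasurable C ?_
  exact ae_restrict_of_ae_restrict_of_subset subset_closure
    ((ae_restrict_iff' isClosed_closure.measurableSet).2 (ae_of_all _ hC))

/-- The `L²` class of a polynomial of bounded degree on a bounded set. -/
noncomputable def polyToLp (k : ℕ) {A : Set (Pt d)} (hA : Bornology.IsBounded A) :
    MvPolynomial.restrictTotalDegree (Fin d) ℝ k →ₗ[ℝ] Lp ℝ 2 (volume.restrict A) where
  toFun p := (memLp_polyFun p.1 hA).toLp
  map_add' p q := by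
    rw [← MemLp.toLp_add]
    exact MemLp.toLp_congr _ _ (ae_of_all _ fun x => polyFun_add p.1 q.1 x)
  map_smul' c p := by
    rw [RingHom.id_apply, ← MemLp.toLp_const_smul]
    exact MemLp.toLp_congr _ _ (ae_of_all _ fun x => by simp [polyFun])

theorem norm_sq_toLp {A : Set (Pt d)} {f : Pt d → ℝ} (hf : MemLp f 2 (volume.restrict A)) :
    ‖hf.toLp‖ ^ 2 = ∫ x in A, f x ^ 2 := by
  rw [← real_inner_self_eq_norm_sq, L2.inner_def]
  refine integral_congr_ae ?_
  filter_upwards [hf.coeFn_toLp] with x hx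
  simp [hx, sq]

theorem totalDegree_le_of_mem_support {p : MvPolynomial (Fin d) ℝ} {k : ℕ} (hp : p.totalDegree ≤ k)
    {m : Fin d →₀ ℕ} (hm : m ∈ p.support) : ∑ i, m i ≤ k := by
  have := (MvPolynomial.le_totalDegree hm).trans hp
  rwa [Finsupp.sum_fintype _ _ fun _ => rfl] at this

theorem totalDegree_pderiv_le {p : MvPolynomial (Fin d) ℝ} {k : ℕ} (hp : p.totalDegree ≤ k)
    (i : Fin d) : (MvPolynomial.pderiv i p).totalDegree ≤ k - 1 := by
  conv_lhs => rw [p.as_sum]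
  rw [map_sum]
  refine (MvPolynomial.totalDegree_finsetSum _ _).trans (Finset.sup_le fun m hm => ?_)
  rw [MvPolynomial.pderiv_monomial]
  have hk := totalDegree_le_of_mem_support hp hm
  by_cases h0 : m i = 0
  · simp [h0]
  · refine (MvPolynomial.totalDegree_monomial_le _ _).trans ?_
    rw [Finsupp.sum_fintype _ _ fun _ => rfl]
    have h1 : ∑ j, (m - Finsupp.single i 1 : Fin d →₀ ℕ) j + 1 = ∑ j, m j := by
      have h2 : m = (m - Finsupp.single i 1) + Finsupp.single i 1 := by
        ext j
        by_cases hij : i = j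
        · subst hij; simp; omega
        · simp [hij]
      conv_rhs => rw [h2]
      simp [Finset.sum_add_distrib]
    simp only [id]
    omega

/-- The operator `∑ xᵢ ∂ᵢ` multiplies a monomial by its degree, so the terms of degree exactly `k`
cancel. This is the cancellation that keeps the discrete product inside `V_h`. -/
theorem totalDegree_euler_le {p : MvPolynomial (Fin d) ℝ} {k : ℕ} (hp : p.totalDegree ≤ k) :
    (MvPolynomial.C (k : ℝ) * p
      - ∑ i, MvPolynomial.X i * MvPolynomial.pderiv i p).totalDegree ≤ k - 1 := by
  have e : MvPolynomial.C (k : ℝ) * p - ∑ i, MvPolynomial.X i * MvPolynomial.pderiv i p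
      = ∑ m ∈ p.support, MvPolynomial.monomial m (((k : ℝ) - ∑ i, (m i : ℝ)) * p.coeff m) := by
    have h1 : ∀ i, MvPolynomial.X i * MvPolynomial.pderiv i p
        = ∑ m ∈ p.support, MvPolynomial.monomial m ((m i : ℝ) * p.coeff m) := by
      intro i
      conv_lhs => rw [p.as_sum, map_sum, Finset.mul_sum]
      refine Finset.sum_congr rfl fun m _ => ?_
      rw [MvPolynomial.X_mul_pderiv_monomial, ← map_nsmul, nsmul_eq_mul]
    simp_rw [h1]
    rw [Finset.sum_comm]
    have h2 : MvPolynomial.C (k : ℝ) * p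
        = ∑ m ∈ p.support, MvPolynomial.monomial m ((k : ℝ) * p.coeff m) := by
      conv_lhs => rw [p.as_sum, Finset.mul_sum]
      exact Finset.sum_congr rfl fun m _ => MvPolynomial.C_mul_monomial
    rw [h2, ← Finset.sum_sub_distrib]
    refine Finset.sum_congr rfl fun m _ => ?_
    rw [← map_sum, ← map_sub, sub_mul, Finset.sum_mul]
  rw [e]
  refine (MvPolynomial.totalDegree_finsetSum _ _).trans (Finset.sup_le fun m hm => ?_)
  have hk := totalDegree_le_of_mem_support hp hm
  by_cases h0 : ∑ i, m i = k
  · have : (k : ℝ) - ∑ i, (m i : ℝ) = 0 := by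
      rw [← h0]; push_cast; ring
    simp [this]
  · refine (MvPolynomial.totalDegree_monomial_le _ _).trans ?_
    rw [Finsupp.sum_fintype _ _ fun _ => rfl]
    simp only [id]
    omega

/-- Affine substitution in a polynomial. -/
theorem exists_poly_comp_affine {p : MvPolynomial (Fin d) ℝ} {k : ℕ} (hp : p.totalDegree ≤ k)
    (c : Pt d) (h : ℝ) : ∃ q : MvPolynomial (Fin d) ℝ, q.totalDegree ≤ k ∧
      ∀ y, polyFun q y = polyFun p (c + h • y) := by
  set f : Fin d → MvPolynomial (Fin d) ℝ :=
    fun i => MvPolynomial.C (c i) + MvPolynomial.C h * MvPolynomial.X i with hf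
  have hfd : ∀ i, (f i).totalDegree ≤ 1 := by
    intro i
    refine (MvPolynomial.totalDegree_add _ _).trans (max_le (by simp) ?_)
    refine (MvPolynomial.totalDegree_mul _ _).trans ?_
    simp
  refine ⟨MvPolynomial.aeval f p, ?_, fun y => ?_⟩
  · rw [MvPolynomial.aeval_def, MvPolynomial.eval₂_eq']
    refine (MvPolynomial.totalDegree_finsetSum _ _).trans (Finset.sup_le fun m hm => ?_)
    refine (MvPolynomial.totalDegree_mul _ _).trans ?_
    rw [MvPolynomial.algebraMap_eq, MvPolynomial.totalDegree_C, zero_add]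
    refine (MvPolynomial.totalDegree_finsetProd _ _).trans ?_
    refine le_trans (Finset.sum_le_sum fun i _ => ?_) (totalDegree_le_of_mem_support hp hm)
    refine (MvPolynomial.totalDegree_pow _ _).trans ?_
    simpa using Nat.mul_le_mul_left (m i) (hfd i)
  · have h1 : ∀ p : MvPolynomial (Fin d) ℝ,
        (MvPolynomial.eval fun i => y i) (MvPolynomial.aeval f p)
          = MvPolynomial.eval (fun i => MvPolynomial.eval (fun i => y i) (f i)) p := by
      intro p
      induction p using MvPolynomial.induction_on with
      | C a => simp
      | add p q hp hq => simp only [map_add, hp, hq]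
      | mul_X p j hp => simp only [map_mul, hp, MvPolynomial.aeval_X, MvPolynomial.eval_X]
    rw [polyFun, h1, polyFun]
    simp [hf]

/-- The inverse inequality on the unit ball. -/
theorem exists_inverse_inequality_unit (k : ℕ) {ρ : ℝ} (hρ : 0 < ρ) (j : Fin d) :
    ∃ C, 0 ≤ C ∧ ∀ p : MvPolynomial (Fin d) ℝ, p.totalDegree ≤ k →
      ∫ x in Metric.closedBall (0 : Pt d) 1, polyFun (MvPolynomial.pderiv j p) x ^ 2
        ≤ C * ∫ x in Metric.ball (0 : Pt d) ρ, polyFun p x ^ 2 := by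
  let D : MvPolynomial.restrictTotalDegree (Fin d) ℝ k →ₗ[ℝ]
      MvPolynomial.restrictTotalDegree (Fin d) ℝ k :=
    (MvPolynomial.pderiv (R := ℝ) j).toLinearMap.restrict fun p hp => by
      rw [MvPolynomial.mem_restrictTotalDegree] at hp ⊢
      exact (totalDegree_pderiv_le hp j).trans (Nat.sub_le _ _)
  have hinj : Function.Injective (polyToLp k (Metric.isBounded_ball (x := (0 : Pt d)) (r := ρ))) := by
    refine (injective_iff_map_eq_zero _).2 fun p hp => Subtype.ext ?_
    refine polyFun_eq_zero hρ ?_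
    have h0 : polyFun p.1 =ᵐ[volume.restrict (Metric.ball (0 : Pt d) ρ)] 0 :=
      (memLp_polyFun p.1 Metric.isBounded_ball).coeFn_toLp.symm.trans (Lp.eq_zero_iff_ae_eq_zero.1 hp)
    exact Measure.eqOn_open_of_ae_eq h0 Metric.isOpen_ball (continuous_polyFun _).continuousOn
      continuousOn_const
  -- The derivative is measured on the large ball and the polynomial on the small one, so that after
  -- scaling every set between the two is covered by one constant.
  obtain ⟨C, hC, h⟩ := exists_norm_le_of_injective _
    ((polyToLp k (Metric.isBounded_closedBall (x := (0 : Pt d)) (r := 1))).comp D) hinj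
  refine ⟨C ^ 2, by positivity, fun p hp => ?_⟩
  have h1 := h ⟨p, (MvPolynomial.mem_restrictTotalDegree _ _ _).2 hp⟩
  have h2 := pow_le_pow_left₀ (norm_nonneg _) h1 2
  rw [mul_pow] at h2
  simp only [LinearMap.comp_apply, polyToLp, LinearMap.coe_mk, AddHom.coe_mk, norm_sq_toLp] at h2
  exact h2

theorem setIntegral_comp_affine (F : Pt d → ℝ) (c : Pt d) {h : ℝ} (hh : 0 < h) {A B : Set (Pt d)}
    (hA : MeasurableSet A) (hB : MeasurableSet B) (hAB : ∀ y, c + h • y ∈ B ↔ y ∈ A) :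
    ∫ y in A, F (c + h • y) = (h ^ d)⁻¹ * ∫ x in B, F x := by
  rw [← integral_indicator hA, ← integral_indicator hB,
    ← integral_add_left_eq_self (B.indicator F) c]
  have := Measure.integral_comp_smul volume (fun x => B.indicator F (c + x)) h
  rw [finrank_euclideanSpace_fin, abs_of_pos (by positivity), smul_eq_mul] at this
  rw [← this]
  congr 1
  ext y
  by_cases hy : y ∈ A
  · rw [indicator_of_mem hy, indicator_of_mem ((hAB y).2 hy)]
  · rw [indicator_of_notMem hy, indicator_of_notMem fun h => hy ((hAB y).1 h)]

theorem integrableOn_polyFun_sq (p : MvPolynomial (Fin d) ℝ) {A : Set (Pt d)}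
    (hA : Bornology.IsBounded A) : IntegrableOn (fun x => polyFun p x ^ 2) A volume :=
  (((continuous_polyFun p).pow 2).continuousOn.integrableOn_compact
    hA.isCompact_closure).mono_set subset_closure

/-- The inverse inequality on sets which contain a ball of comparable radius. -/
theorem exists_inverse_inequality (d k : ℕ) {ρ : ℝ} (hρ : 0 < ρ) :
    ∃ C, 0 ≤ C ∧ ∀ (j : Fin d) (p : MvPolynomial (Fin d) ℝ), p.totalDegree ≤ k →
      ∀ (c : Pt d) (h : ℝ), 0 < h → ∀ D : Set (Pt d), Metric.ball c (ρ * h) ⊆ D →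
        D ⊆ Metric.closedBall c h →
        h ^ 2 * ∫ x in D, polyFun (MvPolynomial.pderiv j p) x ^ 2
          ≤ C * ∫ x in D, polyFun p x ^ 2 := by
  choose C hC hCp using fun j : Fin d => exists_inverse_inequality_unit k hρ j
  refine ⟨∑ j, C j, Finset.sum_nonneg fun j _ => hC j, fun j p hp c h hh D hD1 hD2 => ?_⟩
  -- Pull back to the reference balls. The volume factors `h ^ d` cancel, and the chain rule leaves
  -- the factor `h ^ 2`.
  obtain ⟨q, hq, hqp⟩ := exists_poly_comp_affine hp c h
  have hder : ∀ y, polyFun (MvPolynomial.pderiv j q) y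
      = h * polyFun (MvPolynomial.pderiv j p) (c + h • y) := by
    intro y
    have h1 : HasFDerivAt (fun y : Pt d => c + h • y) (h • ContinuousLinearMap.id ℝ (Pt d)) y :=
      ((hasFDerivAt_id y).const_smul h).const_add c
    have h2 := (hasFDerivAt_polyFun p (c + h • y)).comp y h1
    have h3 : polyFun p ∘ (fun y => c + h • y) = polyFun q := (funext hqp).symm
    rw [h3] at h2
    have h4 := congrArg (fun L : Pt d →L[ℝ] ℝ => L (EuclideanSpace.single j 1))
      ((hasFDerivAt_polyFun q y).unique h2)
    simpa [polyGrad_apply] using h4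
  have hCj : C j ≤ ∑ j, C j := Finset.single_le_sum (fun j _ => hC j) (Finset.mem_univ j)
  have hbdD : Bornology.IsBounded D := Metric.isBounded_closedBall.subset hD2
  have hhd : 0 < h ^ d := by positivity
  have e1 := setIntegral_comp_affine (fun x => polyFun (MvPolynomial.pderiv j p) x ^ 2) c hh
    (A := Metric.closedBall 0 1) (B := Metric.closedBall c h) measurableSet_closedBall
    measurableSet_closedBall fun y => by
      rw [mem_closedBall_iff_norm, add_sub_cancel_left, norm_smul, Real.norm_of_nonneg hh.le,
        mem_closedBall_zero_iff]
      exact mul_le_iff_le_one_right hh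
  have e2 := setIntegral_comp_affine (fun x => polyFun p x ^ 2) c hh
    (A := Metric.ball 0 ρ) (B := Metric.ball c (ρ * h)) measurableSet_ball
    measurableSet_ball fun y => by
      rw [mem_ball_iff_norm, add_sub_cancel_left, norm_smul, Real.norm_of_nonneg hh.le,
        mem_ball_zero_iff, mul_comm ρ]
      exact mul_lt_mul_iff_right₀ hh
  have h5 := hCp j q hq
  simp only [hder, hqp, mul_pow] at h5
  rw [integral_const_mul, e1, e2] at h5
  have h6 : h ^ 2 * ∫ x in Metric.closedBall c h, polyFun (MvPolynomial.pderiv j p) x ^ 2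
      ≤ C j * ∫ x in Metric.ball c (ρ * h), polyFun p x ^ 2 := by
    have := mul_le_mul_of_nonneg_left h5 hhd.le
    calc _ = h ^ d * (h ^ 2 * ((h ^ d)⁻¹ *
          ∫ x in Metric.closedBall c h, polyFun (MvPolynomial.pderiv j p) x ^ 2)) := by
          field_simp
      _ ≤ _ := this
      _ = _ := by field_simp
  have h7 : ∫ x in D, polyFun (MvPolynomial.pderiv j p) x ^ 2
      ≤ ∫ x in Metric.closedBall c h, polyFun (MvPolynomial.pderiv j p) x ^ 2 :=
    setIntegral_mono_set (integrableOn_polyFun_sq _ Metric.isBounded_closedBall)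
      (ae_of_all _ fun x => sq_nonneg _) hD2.eventuallyLE
  have h8 : ∫ x in Metric.ball c (ρ * h), polyFun p x ^ 2 ≤ ∫ x in D, polyFun p x ^ 2 :=
    setIntegral_mono_set (integrableOn_polyFun_sq _ hbdD)
      (ae_of_all _ fun x => sq_nonneg _) hD1.eventuallyLE
  have h9 : 0 ≤ ∫ x in Metric.ball c (ρ * h), polyFun p x ^ 2 :=
    integral_nonneg fun x => sq_nonneg _
  calc _ ≤ h ^ 2 * ∫ x in Metric.closedBall c h, polyFun (MvPolynomial.pderiv j p) x ^ 2 := by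
        gcongr
    _ ≤ _ := h6
    _ ≤ (∑ j, C j) * ∫ x in D, polyFun p x ^ 2 :=
        mul_le_mul hCj h8 h9 (Finset.sum_nonneg fun j _ => hC j)

end StrainFEM

/-! ### The discrete product of a finite element function and a nodal function -/

namespace StrainFEM
open Filter Topology Set
variable {d : ℕ} {Ω : Set (Pt d)}

theorem mem_femSpace_iff {T : Triangulation Ω} {k : ℕ} {f : Pt d → ℝ} :
    f ∈ femSpace T k ↔ ContinuousOn f (closure Ω) ∧ ∀ s ∈ T.cells, ∃ p : MvPolynomial (Fin d) ℝ,
      p.totalDegree ≤ k ∧ ∀ x ∈ hull s, f x = polyFun p x := by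
  refine and_congr_right fun _ => ⟨fun h s hs => h _ (Triangulation.hull_mem_elements hs),
    fun h τ hτ => ?_⟩
  obtain ⟨s, hs, rfl⟩ := Triangulation.mem_elements_iff.1 hτ
  exact h s hs

theorem unifLocLip_of_mem_femSpace {T : Triangulation Ω} {k : ℕ} {f : Pt d → ℝ}
    (hf : f ∈ femSpace T k) : UnifLocLip Ω f := by
  have h : ∀ s : T.cells, ∃ K, 0 ≤ K ∧ ∀ x ∈ hull s.1, ∀ y ∈ hull s.1,
      |f y - f x| ≤ K * ‖y - x‖ := by
    rintro ⟨s, hs⟩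
    obtain ⟨p, -, hp⟩ := (mem_femSpace_iff.1 hf).2 s hs
    obtain ⟨K, hK, hKp⟩ := exists_lipschitz_polyFun p (isCompact_hull s) (convex_hull s)
    refine ⟨K, hK, fun x hx y hy => ?_⟩
    rw [hp x hx, hp y hy]
    exact hKp x hx y hy
  choose K hK hKf using h
  refine T.unifLocLip_of_cells (K := ∑ s, K s) (Finset.sum_nonneg fun s _ => hK s)
    fun s hs x hx y hy => (hKf ⟨s, hs⟩ x hx y hy).trans ?_
  gcongr
  exact Finset.single_le_sum (f := K) (fun s _ => hK s) (Finset.mem_univ _)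

theorem affineMap_sum {s : Finset (Pt d)} {w : Pt d → ℝ} (hw : ∑ p ∈ s, w p = 1)
    (t : Pt d →ᵃ[ℝ] ℝ) : t (∑ p ∈ s, w p • p) = ∑ p ∈ s, w p * t p := by
  have h : ∀ x, t x = t.linear x + t 0 := fun x => congrFun t.decomp x
  rw [h, map_sum]
  calc ∑ p ∈ s, t.linear (w p • p) + t 0
      = ∑ p ∈ s, w p * t.linear p + (∑ p ∈ s, w p) * t 0 := by simp [hw]
    _ = ∑ p ∈ s, (w p * t.linear p + w p * t 0) := by
        rw [Finset.sum_add_distrib, Finset.sum_mul]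
    _ = _ := Finset.sum_congr rfl fun p _ => by rw [h p]; ring

/-- On an element with barycentric coordinates `t`, the field of degree at most `k` obtained from
the polynomial `p` and the nodal values of `ζ`, which approximates the product `p ζ`. -/
noncomputable def localProd (k : ℕ) (s : Finset (Pt d)) (t : Pt d → Pt d →ᵃ[ℝ] ℝ) (ζ : Pt d → ℝ)
    (p : MvPolynomial (Fin d) ℝ) (x : Pt d) : ℝ :=
  ∑ q ∈ s, t q x * ζ q * (polyFun p x + (k : ℝ)⁻¹ * polyGrad p x (q - x))

theorem exists_poly_affine (t : Pt d →ᵃ[ℝ] ℝ) :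
    ∃ P : MvPolynomial (Fin d) ℝ, P.totalDegree ≤ 1 ∧ ∀ x, polyFun P x = t x := by
  refine ⟨MvPolynomial.C (t 0) + ∑ i, MvPolynomial.C (t.linear (EuclideanSpace.single i 1)) *
    MvPolynomial.X i, ?_, fun x => ?_⟩
  · refine (MvPolynomial.totalDegree_add _ _).trans (max_le (by simp) ?_)
    refine (MvPolynomial.totalDegree_finsetSum _ _).trans (Finset.sup_le fun i _ => ?_)
    refine (MvPolynomial.totalDegree_mul _ _).trans ?_
    simp
  · have h : t x = t.linear x + t 0 := congrFun t.decomp x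
    have hx : x = ∑ i, x i • EuclideanSpace.single i (1 : ℝ) := by
      ext j
      simp [Finset.sum_apply, Pi.single_apply]
    have h2 : t.linear x = ∑ i, x i * t.linear (EuclideanSpace.single i (1 : ℝ)) := by
      conv_lhs => rw [hx, map_sum]
      simp
    rw [h, h2, polyFun_add, polyFun_C, polyFun_sum, add_comm]
    simp [polyFun_mul, polyFun_C, polyFun_X, mul_comm]

/-- The factor multiplying `t q` equals `k⁻¹ ((k p - x · ∇p) + q · ∇p)` up to the constant `ζ q`. By
Euler's identity it has degree at most `k - 1`, and the affine `t q` adds one. -/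
theorem exists_poly_localProd {k : ℕ} (hk : 1 ≤ k) (s : Finset (Pt d)) (t : Pt d → Pt d →ᵃ[ℝ] ℝ)
    (ζ : Pt d → ℝ) {p : MvPolynomial (Fin d) ℝ} (hp : p.totalDegree ≤ k) :
    ∃ P : MvPolynomial (Fin d) ℝ, P.totalDegree ≤ k ∧ ∀ x, polyFun P x = localProd k s t ζ p x := by
  choose t' ht' hpt using fun q => exists_poly_affine (t q)
  let E := MvPolynomial.C (k : ℝ) * p - ∑ i, MvPolynomial.X i * MvPolynomial.pderiv i p
  let Q : Pt d → MvPolynomial (Fin d) ℝ := fun q => MvPolynomial.C (ζ q * (k : ℝ)⁻¹) *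
    (E + ∑ i, MvPolynomial.C (q i) * MvPolynomial.pderiv i p)
  have hQ : ∀ q, (Q q).totalDegree ≤ k - 1 := by
    intro q
    refine (MvPolynomial.totalDegree_mul _ _).trans ?_
    rw [MvPolynomial.totalDegree_C, zero_add]
    refine (MvPolynomial.totalDegree_add _ _).trans (max_le (totalDegree_euler_le hp) ?_)
    refine (MvPolynomial.totalDegree_finsetSum _ _).trans (Finset.sup_le fun i _ => ?_)
    refine (MvPolynomial.totalDegree_mul _ _).trans ?_
    rw [MvPolynomial.totalDegree_C, zero_add]
    exact totalDegree_pderiv_le hp i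
  refine ⟨∑ q ∈ s, t' q * Q q, ?_, fun x => ?_⟩
  · refine (MvPolynomial.totalDegree_finsetSum _ _).trans (Finset.sup_le fun q _ => ?_)
    refine (MvPolynomial.totalDegree_mul _ _).trans ?_
    have := ht' q
    have := hQ q
    omega
  · have hk0 : (k : ℝ) ≠ 0 := by positivity
    rw [polyFun_sum, localProd]
    refine Finset.sum_congr rfl fun q _ => ?_
    simp only [Q, E, polyFun_mul, polyFun_add, polyFun_sub, polyFun_sum, polyFun_C, polyFun_X, hpt,
      polyGrad_apply, PiLp.sub_apply, mul_sub, Finset.sum_sub_distrib]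
    have e1 : ∑ i, x i * polyFun (MvPolynomial.pderiv i p) x
        = ∑ i, polyFun (MvPolynomial.pderiv i p) x * x i :=
      Finset.sum_congr rfl fun i _ => mul_comm _ _
    have e2 : ∑ i, q i * polyFun (MvPolynomial.pderiv i p) x
        = ∑ i, polyFun (MvPolynomial.pderiv i p) x * q i :=
      Finset.sum_congr rfl fun i _ => mul_comm _ _
    rw [e1, e2]
    field_simp
    ring

/-- Polynomials which agree on a convex set have the same derivatives in tangential directions. -/
theorem polyGrad_eq_of_eqOn {A : Set (Pt d)} (hA : Convex ℝ A) {p p' : MvPolynomial (Fin d) ℝ}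
    (h : ∀ x ∈ A, polyFun p x = polyFun p' x) {x q : Pt d} (hx : x ∈ A) (hq : q ∈ A) :
    polyGrad p x (q - x) = polyGrad p' x (q - x) := by
  have key : ∀ p : MvPolynomial (Fin d) ℝ, HasDerivWithinAt (fun r : ℝ => polyFun p (x + r • (q - x)))
      (polyGrad p x (q - x)) (Icc 0 1) 0 := by
    intro p
    have h1 : HasDerivAt (fun r : ℝ => x + r • (q - x)) (q - x) 0 := by
      simpa using ((hasDerivAt_id (0 : ℝ)).smul_const (q - x)).const_add x
    have h2 : HasFDerivAt (polyFun p) (polyGrad p x) (x + (0 : ℝ) • (q - x)) := by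
      simpa using hasFDerivAt_polyFun p x
    exact (h2.comp_hasDerivAt 0 h1).hasDerivWithinAt
  have h3 : HasDerivWithinAt (fun r : ℝ => polyFun p (x + r • (q - x)))
      (polyGrad p' x (q - x)) (Icc 0 1) 0 :=
    (key p').congr (fun r hr => h _ (hA.add_smul_sub_mem hx hq hr)) (by simpa using h x hx)
  exact (uniqueDiffOn_Icc zero_lt_one 0 (left_mem_Icc.2 zero_le_one)).eq_deriv _ (key p) h3

/-- This gives continuity across faces. At a point of the common face the barycentric coordinates of
both elements reduce to those of the face, so only its vertices `q` contribute. For these the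
direction `q - x` is tangential, where the derivatives of the two polynomials agree. -/
theorem localProd_eq {T : Triangulation Ω} {k : ℕ} {s s' : Finset (Pt d)} (hs : s ∈ T.cells)
    (hs' : s' ∈ T.cells) {t t' : Pt d → Pt d →ᵃ[ℝ] ℝ}
    (ht1 : ∀ x, ∑ p ∈ s, t p x = 1) (ht : ∀ p ∈ s, ∀ q ∈ s, p ≠ q → t p q = 0)
    (ht1' : ∀ x, ∑ p ∈ s', t' p x = 1) (ht' : ∀ p ∈ s', ∀ q ∈ s', p ≠ q → t' p q = 0)
    (ζ : Pt d → ℝ) {f : Pt d → ℝ} {p p' : MvPolynomial (Fin d) ℝ}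
    (hp : ∀ x ∈ hull s, f x = polyFun p x) (hp' : ∀ x ∈ hull s', f x = polyFun p' x)
    {x : Pt d} (hx : x ∈ hull s) (hx' : x ∈ hull s') :
    localProd k s t ζ p x = localProd k s' t' ζ p' x := by
  classical
  have hxF : x ∈ hull (s ∩ s') := by
    rw [← Triangulation.hull_inter_hull hs hs']
    exact ⟨hx, hx'⟩
  obtain ⟨w, -, hw1, hwx⟩ := Finset.mem_convexHull'.1 hxF
  have hpp : ∀ y ∈ hull (s ∩ s'), polyFun p y = polyFun p' y := by
    intro y hy
    rw [← Triangulation.hull_inter_hull hs hs'] at hy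
    rw [← hp y hy.1, ← hp' y hy.2]
  -- Stated for a general element `r` containing the common vertices, so that it serves both sides.
  -- The coordinates are evaluated through a convex combination `w` of the face vertices.
  have key : ∀ {r : Finset (Pt d)} {τ : Pt d → Pt d →ᵃ[ℝ] ℝ}, s ∩ s' ⊆ r →
      (∀ x, ∑ p ∈ r, τ p x = 1) → (∀ p ∈ r, ∀ q ∈ r, p ≠ q → τ p q = 0) →
      ∀ c : Pt d → ℝ, ∑ q ∈ r, τ q x * c q = ∑ q ∈ s ∩ s', w q * c q := by
    intro r τ hr hτ1 hτ c
    have hδ : ∀ q ∈ r, τ q q = 1 := by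
      intro q hq
      rw [← hτ1 q, Finset.sum_eq_single_of_mem q hq fun p hp hpq => hτ p hp q hq hpq]
    have hval : ∀ q ∈ r, τ q x = if q ∈ s ∩ s' then w q else 0 := by
      intro q hq
      rw [← hwx, affineMap_sum hw1]
      split_ifs with hqF
      · rw [Finset.sum_eq_single_of_mem q hqF, hδ q hq, mul_one]
        intro p hp hpq
        rw [hτ q hq p (hr hp) hpq.symm, mul_zero]
      · refine Finset.sum_eq_zero fun p hp => ?_
        rw [hτ q hq p (hr hp) fun h => hqF (h ▸ hp), mul_zero]
    rw [← Finset.sum_subset hr]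
    · exact Finset.sum_congr rfl fun q hq => by rw [hval q (hr hq), if_pos hq]
    · intro q hq hqF
      rw [hval q hq, if_neg hqF, zero_mul]
  simp only [localProd, mul_assoc]
  rw [key Finset.inter_subset_left ht1 ht, key Finset.inter_subset_right ht1' ht']
  refine Finset.sum_congr rfl fun q hq => ?_
  rw [hpp x hxF, polyGrad_eq_of_eqOn (convex_hull _) hpp hxF (mem_hull hq)]

/-- Bounds for the value and the derivative of a function at a point. -/
def DerivBound (f : Pt d → ℝ) (x : Pt d) (a b : ℝ) : Prop :=
  |f x| ≤ a ∧ ∃ f' : Pt d →L[ℝ] ℝ, HasFDerivAt f f' x ∧ ‖f'‖ ≤ b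

namespace DerivBound

variable {f g : Pt d → ℝ} {x : Pt d} {a b a' b' : ℝ}

theorem nonneg (h : DerivBound f x a b) : 0 ≤ a ∧ 0 ≤ b := by
  obtain ⟨h1, f', -, h2⟩ := h
  exact ⟨(abs_nonneg _).trans h1, (norm_nonneg _).trans h2⟩

theorem mono (h : DerivBound f x a b) (ha : a ≤ a') (hb : b ≤ b') : DerivBound f x a' b' := by
  obtain ⟨h1, f', h2, h3⟩ := h
  exact ⟨h1.trans ha, f', h2, h3.trans hb⟩

theorem add (hf : DerivBound f x a b) (hg : DerivBound g x a' b') :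
    DerivBound (fun y => f y + g y) x (a + a') (b + b') := by
  obtain ⟨h1, f', h2, h3⟩ := hf
  obtain ⟨k1, g', k2, k3⟩ := hg
  exact ⟨(abs_add_le _ _).trans (add_le_add h1 k1), f' + g', h2.add k2,
    (norm_add_le _ _).trans (add_le_add h3 k3)⟩

theorem mul (hf : DerivBound f x a b) (hg : DerivBound g x a' b') :
    DerivBound (fun y => f y * g y) x (a * a') (a * b' + a' * b) := by
  have hf0 := hf.nonneg
  have hg0 := hg.nonneg
  obtain ⟨h1, f', h2, h3⟩ := hf
  obtain ⟨k1, g', k2, k3⟩ := hg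
  refine ⟨?_, f x • g' + g x • f', h2.mul k2, ?_⟩
  · rw [abs_mul]
    exact mul_le_mul h1 k1 (abs_nonneg _) hf0.1
  · refine (norm_add_le _ _).trans (add_le_add ?_ ?_)
    · rw [norm_smul]
      exact mul_le_mul h1 k3 (norm_nonneg _) hf0.1
    · rw [norm_smul]
      exact mul_le_mul k1 h3 (norm_nonneg _) hg0.1

theorem sum {ι : Type*} (s : Finset ι) {F : ι → Pt d → ℝ} {A B : ι → ℝ}
    (h : ∀ i ∈ s, DerivBound (F i) x (A i) (B i)) :
    DerivBound (fun y => ∑ i ∈ s, F i y) x (∑ i ∈ s, A i) (∑ i ∈ s, B i) := by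
  classical
  induction s using Finset.induction_on with
  | empty =>
    simp only [Finset.sum_empty]
    exact ⟨by simp, 0, hasFDerivAt_const _ _, by simp⟩
  | insert i s hi ih =>
    simp only [Finset.sum_insert hi]
    exact (h i (by simp)).add (ih fun j hj => h j (by simp [hj]))

theorem const_mul (hf : DerivBound f x a b) {c : ℝ} (hc : |c| ≤ 1) :
    DerivBound (fun y => c * f y) x a b := by
  have hf0 := hf.nonneg
  obtain ⟨h1, f', h2, h3⟩ := hf
  refine ⟨?_, c • f', h2.const_mul c, ?_⟩
  · rw [abs_mul]
    exact (mul_le_mul hc h1 (abs_nonneg _) zero_le_one).trans_eq (one_mul a)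
  · rw [norm_smul]
    exact (mul_le_mul hc h3 (norm_nonneg _) zero_le_one).trans_eq (one_mul b)

theorem congr (hf : DerivBound f x a b) (h : g =ᶠ[𝓝 x] f) : DerivBound g x a b := by
  obtain ⟨h1, f', h2, h3⟩ := hf
  exact ⟨by rwa [h.eq_of_nhds], f', h2.congr_of_eventuallyEq h, h3⟩

theorem abs_pd_le (hf : DerivBound f x a b) (i : Fin d) : |pd i f x| ≤ b := by
  obtain ⟨h1, f', h2, h3⟩ := hf
  rw [pd, h2.fderiv]
  exact (abs_apply_single_le f' i).trans h3

end DerivBound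

theorem derivBound_of_lipschitz {f : Pt d → ℝ} {x : Pt d} {a b : ℝ} (hb : 0 ≤ b)
    (hf : DifferentiableAt ℝ f x) (ha : |f x| ≤ a)
    (h : ∀ᶠ y in 𝓝 x, |f y - f x| ≤ b * ‖y - x‖) : DerivBound f x a b :=
  ⟨ha, fderiv ℝ f x, hf.hasFDerivAt, norm_fderiv_le_of_lip' ℝ hb (by simpa using h)⟩

theorem derivBound_polyFun (p : MvPolynomial (Fin d) ℝ) (x : Pt d) :
    DerivBound (polyFun p) x |polyFun p x| (∑ i, |polyFun (MvPolynomial.pderiv i p) x|) := by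
  refine ⟨le_rfl, _, hasFDerivAt_polyFun p x, (opNorm_le_sum_single _).trans_eq ?_⟩
  simp [polyGrad_apply]

end StrainFEM

/-! ### Pointwise error of the discrete product -/

namespace StrainFEM
open Filter Topology Set
variable {d : ℕ} {Ω : Set (Pt d)}

/-- Barycentric coordinates reproduce affine functions. Hence `a` may be inserted in the first sum,
and `ζ y` may be subtracted in the second, where `∑ t_q ∇p · (q - y) = 0`. Afterwards the first term
contains the second-order small difference of `ζ - a`, and the second term contains two first-order
small factors. -/
theorem localProd_sub_eq {k : ℕ} {s : Finset (Pt d)} {t : Pt d → Pt d →ᵃ[ℝ] ℝ}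
    (ht1 : ∀ x, ∑ q ∈ s, t q x = 1) (htx : ∀ x, ∑ q ∈ s, t q x • q = x) (ζ : Pt d → ℝ)
    (a : Pt d →L[ℝ] ℝ) (p : MvPolynomial (Fin d) ℝ) (y : Pt d) :
    localProd k s t ζ p y - polyFun p y * ζ y
      = polyFun p y * ∑ q ∈ s, t q y * ((ζ q - a q) - (ζ y - a y))
        + (k : ℝ)⁻¹ * ∑ q ∈ s, (t q y * (ζ q - ζ y)) *
          ∑ i, polyFun (MvPolynomial.pderiv i p) y * (q i - y i) := by
  have hlin : ∀ L : Pt d →L[ℝ] ℝ, ∑ q ∈ s, t q y * L q = L y := by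
    intro L
    conv_rhs => rw [← htx y, map_sum]
    simp
  have e1 : ∑ q ∈ s, t q y * ((ζ q - a q) - (ζ y - a y)) = ∑ q ∈ s, t q y * ζ q - ζ y := by
    have : ∀ q ∈ s, t q y * ((ζ q - a q) - (ζ y - a y))
        = t q y * ζ q - t q y * a q - t q y * (ζ y - a y) := fun q _ => by ring
    rw [Finset.sum_congr rfl this, Finset.sum_sub_distrib, Finset.sum_sub_distrib, hlin,
      ← Finset.sum_mul, ht1]
    ring
  have e2 : ∑ q ∈ s, (t q y * (ζ q - ζ y)) *
      ∑ i, polyFun (MvPolynomial.pderiv i p) y * (q i - y i)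
      = ∑ q ∈ s, t q y * ζ q * polyGrad p y (q - y) := by
    have h1 : ∀ q ∈ s, (t q y * (ζ q - ζ y)) *
        ∑ i, polyFun (MvPolynomial.pderiv i p) y * (q i - y i)
        = t q y * ζ q * polyGrad p y (q - y)
          - ζ y * (t q y * polyGrad p y q - t q y * polyGrad p y y) := by
      intro q _
      have : ∑ i, polyFun (MvPolynomial.pderiv i p) y * (q i - y i) = polyGrad p y (q - y) := by
        rw [polyGrad_apply]; rfl
      rw [this, map_sub]
      ring
    rw [Finset.sum_congr rfl h1, Finset.sum_sub_distrib, ← Finset.mul_sum, Finset.sum_sub_distrib,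
      hlin, ← Finset.sum_mul, ht1]
    ring
  have e3 : localProd k s t ζ p y = polyFun p y * ∑ q ∈ s, t q y * ζ q
      + (k : ℝ)⁻¹ * ∑ q ∈ s, t q y * ζ q * polyGrad p y (q - y) := by
    rw [localProd, Finset.mul_sum, Finset.mul_sum, ← Finset.sum_add_distrib]
    exact Finset.sum_congr rfl fun q _ => by ring
  rw [e1, e2, e3]
  ring

/-- An affine function with values in `[0, 1]` changes by at most one between the centre and the
boundary of an inscribed ball. Shape regularity enters here, bounding gradients of barycentric
coordinates by `1 / (ρ h)`. -/
theorem norm_linear_le {s : Finset (Pt d)} {t : Pt d →ᵃ[ℝ] ℝ} (h0 : ∀ x ∈ hull s, 0 ≤ t x)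
    (h1 : ∀ x ∈ hull s, t x ≤ 1) {c : Pt d} {r : ℝ} (hr : 0 < r)
    (hc : Metric.closedBall c r ⊆ hull s) : ‖t.linear.toContinuousLinearMap‖ ≤ 1 / r := by
  refine ContinuousLinearMap.opNorm_le_bound _ (by positivity) fun v => ?_
  rcases eq_or_ne v 0 with rfl | hv
  · simp
  have hv' : 0 < ‖v‖ := norm_pos_iff.2 hv
  set u := (r / ‖v‖) • v with hu
  have hun : ‖u‖ = r := by
    rw [hu, norm_smul, Real.norm_of_nonneg (by positivity)]
    field_simp
  have m1 : u + c ∈ hull s := hc (by simp [hun])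
  have m2 : c ∈ hull s := hc (Metric.mem_closedBall_self hr.le)
  have e : t (u + c) - t c = (r / ‖v‖) * t.linear v := by
    have := t.map_vadd c u
    simp only [vadd_eq_add] at this
    rw [this, hu]
    simp
  have hle : |(r / ‖v‖) * t.linear v| ≤ 1 := by
    rw [← e, abs_le]
    constructor <;> linarith [h0 _ m1, h1 _ m1, h0 _ m2, h1 _ m2]
  rw [abs_mul, abs_of_pos (by positivity)] at hle
  change |t.linear v| ≤ _
  rw [div_mul_eq_mul_div, one_mul, le_div_iff₀ hr]
  rw [div_mul_eq_mul_div, div_le_one hv'] at hle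
  linarith

/-- Here and in `error_deriv_le` the left side is what the product rules of `DerivBound` yield, with
`N` the number of vertices and `n`, `G`, `H` the sizes of `p`, its gradient and its second
derivatives. -/
theorem error_value_le {N L h ρ n G H : ℝ} (hN : 0 ≤ N) (hL : 0 ≤ L) (hh0 : 0 < h) (hh1 : h ≤ 1)
    (hρ : 0 < ρ) (hn0 : 0 ≤ n) (hG0 : 0 ≤ G) (hH0 : 0 ≤ H) :
    n * (N * (1 * (L * h * h))) + N * (1 * (L * h) * (G * h))
      ≤ N * L * (3 + 1 / ρ) * h * (n + G + h * H) := by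
  have hr : 0 < 1 / ρ := by positivity
  have hhH : 0 ≤ h * H := by positivity
  calc n * (N * (1 * (L * h * h))) + N * (1 * (L * h) * (G * h))
      = N * L * h * (h * (n + G)) := by ring
    _ ≤ N * L * h * ((3 + 1 / ρ) * (n + G + h * H)) := by
        refine mul_le_mul_of_nonneg_left ?_ (by positivity)
        exact mul_le_mul (by linarith) (by linarith) (by positivity) (by positivity)
    _ = _ := by ring

theorem error_deriv_le {N L h ρ n G H : ℝ} (hN : 0 ≤ N) (hL : 0 ≤ L) (hh0 : 0 < h) (hh1 : h ≤ 1)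
    (hρ : 0 < ρ) (hn0 : 0 ≤ n) (hG0 : 0 ≤ G) (hH0 : 0 ≤ H) :
    n * (N * (1 * (L * h) + L * h * h * (1 / (ρ * h)))) + N * (1 * (L * h * h)) * G
        + N * (1 * (L * h) * (G + h * H) + G * h * (1 * L + L * h * (1 / (ρ * h))))
      ≤ N * L * (3 + 1 / ρ) * h * (n + G + h * H) := by
  have hr : 0 < 1 / ρ := by positivity
  have e : h * (1 / (ρ * h)) = 1 / ρ := by field_simp
  have h1 : h * G ≤ G := mul_le_of_le_one_left hG0 hh1
  have h2 : 0 ≤ 1 / ρ * (h * H) := by positivity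
  have h3 : 0 ≤ h * H := by positivity
  calc _ = N * L * h * (n * (1 + h * (1 / (ρ * h))) + h * G + (G + h * H)
          + G * (1 + h * (1 / (ρ * h)))) := by ring
    _ ≤ N * L * h * ((3 + 1 / ρ) * (n + G + h * H)) := by
        rw [e]
        refine mul_le_mul_of_nonneg_left ?_ (by positivity)
        linarith
    _ = _ := by ring

/-- Pointwise bound of the error of the discrete product on an element. -/
theorem derivBound_localProd_sub {k : ℕ} (hk : 1 ≤ k) {s : Finset (Pt d)}
    {t : Pt d → Pt d →ᵃ[ℝ] ℝ} (ht1 : ∀ x, ∑ q ∈ s, t q x = 1)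
    (htx : ∀ x, ∑ q ∈ s, t q x • q = x) (ht0 : ∀ x ∈ hull s, ∀ q ∈ s, 0 ≤ t q x)
    {ρ h L : ℝ} (hρ : 0 < ρ) (hh : h = Metric.diam (hull s)) (hh0 : 0 < h) (hh1 : h ≤ 1)
    (hL : 0 ≤ L) {c : Pt d} (hc : Metric.closedBall c (ρ * h) ⊆ hull s) {ζ : Pt d → ℝ}
    (hζ : ∀ x ∈ hull s, ∀ y ∈ hull s, |ζ y - ζ x| ≤ L * ‖y - x‖) {a : Pt d →L[ℝ] ℝ}
    (hζa : ∀ x ∈ hull s, ∀ y ∈ hull s, |(ζ y - a y) - (ζ x - a x)| ≤ L * h * ‖y - x‖)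
    (p : MvPolynomial (Fin d) ℝ) {x : Pt d} (hx : x ∈ interior (hull s))
    (hd : DifferentiableAt ℝ ζ x) {C X : ℝ} (hC : C = s.card * L * (3 + 1 / ρ))
    (hX : X = |polyFun p x| + ∑ i, |polyFun (MvPolynomial.pderiv i p) x|
      + h * ∑ i, ∑ j, |polyFun (MvPolynomial.pderiv j (MvPolynomial.pderiv i p)) x|) :
    DerivBound (fun y => localProd k s t ζ p y - polyFun p y * ζ y) x (C * h * X) (C * h * X) := by
  have hxs : x ∈ hull s := interior_subset hx
  have hnhds : ∀ᶠ y in 𝓝 x, y ∈ hull s := mem_interior_iff_mem_nhds.1 hx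
  have hbd : Bornology.IsBounded (hull s) := (isCompact_hull s).isBounded
  have hdist : ∀ q ∈ s, ‖q - x‖ ≤ h := fun q hq => by
    rw [← dist_eq_norm, hh]
    exact Metric.dist_le_diam_of_mem hbd (mem_hull hq) hxs
  have ht1' : ∀ y ∈ hull s, ∀ q ∈ s, t q y ≤ 1 := fun y hy q hq => by
    rw [← ht1 y]
    exact Finset.single_le_sum (f := fun q => t q y) (fun r hr => ht0 y hy r hr) hq
  -- The orders of value and gradient of the factors: `1` and `1 / (ρ h)` for `t q`; `L h²` and `L
  -- h` for differences of `ζ - a`; `L h` and `L` for differences of `ζ`; `h` and `1` for the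
  -- coordinates of `q - y`.
  have bt : ∀ q ∈ s, DerivBound (fun y => t q y) x 1 (1 / (ρ * h)) := by
    intro q hq
    refine ⟨?_, (t q).linear.toContinuousLinearMap, ?_, norm_linear_le
      (fun y hy => ht0 y hy q hq) (fun y hy => ht1' y hy q hq) (by positivity) hc⟩
    · rw [abs_of_nonneg (ht0 x hxs q hq)]
      exact ht1' x hxs q hq
    · have e : (fun y => t q y) = fun y => (t q).linear.toContinuousLinearMap y + t q 0 :=
        (t q).decomp
      rw [e]
      exact ((t q).linear.toContinuousLinearMap.hasFDerivAt).add_const _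
  have br : ∀ q ∈ s, DerivBound (fun y => (ζ q - a q) - (ζ y - a y)) x (L * h * h) (L * h) := by
    intro q hq
    refine derivBound_of_lipschitz (by positivity) ?_ ?_ ?_
    · exact (hd.sub a.differentiableAt).const_sub _
    · exact (hζa x hxs q (mem_hull hq)).trans
        (mul_le_mul_of_nonneg_left (hdist q hq) (by positivity))
    · filter_upwards [hnhds] with y hy
      rw [norm_sub_rev]
      convert hζa y hy x hxs using 2
      ring
  have bζ : ∀ q ∈ s, DerivBound (fun y => ζ q - ζ y) x (L * h) L := by
    intro q hq
    refine derivBound_of_lipschitz hL (hd.const_sub _) ?_ ?_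
    · exact (hζ x hxs q (mem_hull hq)).trans (mul_le_mul_of_nonneg_left (hdist q hq) hL)
    · filter_upwards [hnhds] with y hy
      rw [norm_sub_rev]
      convert hζ y hy x hxs using 2
      ring
  have bx : ∀ q ∈ s, ∀ i, DerivBound (fun y : Pt d => q i - y i) x h 1 := by
    intro q hq i
    refine derivBound_of_lipschitz zero_le_one ?_ ?_ (Eventually.of_forall fun y => ?_)
    · exact ((EuclideanSpace.proj i : Pt d →L[ℝ] ℝ).differentiableAt).const_sub (q i)
    · exact (PiLp.norm_apply_le (q - x) i).trans (hdist q hq)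
    · rw [one_mul, norm_sub_rev]
      convert PiLp.norm_apply_le (x - y) i using 1
      simp
  set n := |polyFun p x| with hn
  set G := ∑ i, |polyFun (MvPolynomial.pderiv i p) x| with hG
  set H := ∑ i, ∑ j, |polyFun (MvPolynomial.pderiv j (MvPolynomial.pderiv i p)) x| with hH
  have hn0 : 0 ≤ n := abs_nonneg _
  have hG0 : 0 ≤ G := Finset.sum_nonneg fun i _ => abs_nonneg _
  have hH0 : 0 ≤ H := Finset.sum_nonneg fun i _ => Finset.sum_nonneg fun j _ => abs_nonneg _
  have bgrad : ∀ q ∈ s, DerivBound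
      (fun y => ∑ i, polyFun (MvPolynomial.pderiv i p) y * (q i - y i)) x (G * h) (G + h * H) := by
    intro q hq
    refine (DerivBound.sum Finset.univ fun i _ =>
      (derivBound_polyFun (MvPolynomial.pderiv i p) x).mul (bx q hq i)).mono ?_ ?_
    · rw [hG, Finset.sum_mul]
    · rw [Finset.sum_add_distrib, ← Finset.mul_sum]
      simp [hG, hH]
  have b1 := (derivBound_polyFun p x).mul
    (DerivBound.sum s fun q hq => (bt q hq).mul (br q hq))
  -- The factor `k⁻¹` is at most one and is dropped.
  have b2 := (DerivBound.sum s fun q hq =>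
    ((bt q hq).mul (bζ q hq)).mul (bgrad q hq)).const_mul (c := (k : ℝ)⁻¹) (by
      rw [abs_of_nonneg (by positivity)]
      exact inv_le_one_of_one_le₀ (by exact_mod_cast hk))
  have b3 := (b1.add b2).congr (g := fun y => localProd k s t ζ p y - polyFun p y * ζ y)
    (Eventually.of_forall fun y => localProd_sub_eq ht1 htx ζ a p y)
  refine b3.mono ?_ ?_
  · simp only [Finset.sum_const, nsmul_eq_mul]
    rw [hC, hX]
    exact error_value_le (Nat.cast_nonneg _) hL hh0 hh1 hρ hn0 hG0 hH0
  · simp only [Finset.sum_const, nsmul_eq_mul]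
    rw [hC, hX]
    exact error_deriv_le (Nat.cast_nonneg _) hL hh0 hh1 hρ hn0 hG0 hH0

/-- Cauchy–Schwarz with three, `d` and `d ^ 2` summands; `(d + 1) ^ 2` dominates the factors `1`,
`d` and `d ^ 2`. -/
theorem sq_bound_le {n h : ℝ} {g : Fin d → ℝ} {H : Fin d → Fin d → ℝ} :
    (|n| + ∑ i, |g i| + h * ∑ i, ∑ j, |H i j|) ^ 2
      ≤ 3 * (d + 1) ^ 2 * (((∑ i, g i ^ 2) + n ^ 2) + ∑ i, ∑ j, h ^ 2 * H i j ^ 2) := by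
  have h1 : (∑ i, |g i|) ^ 2 ≤ d * ∑ i, g i ^ 2 := by
    simpa using sq_sum_le_card_mul_sum_sq (s := Finset.univ) (f := fun i => |g i|)
  have h2 : (∑ i, ∑ j, |H i j|) ^ 2 ≤ d ^ 2 * ∑ i, ∑ j, H i j ^ 2 := by
    have := sq_sum_le_card_mul_sum_sq (s := (Finset.univ : Finset (Fin d × Fin d)))
      (f := fun a => |H a.1 a.2|)
    rw [Fintype.sum_prod_type, Fintype.sum_prod_type] at this
    simpa [sq] using this
  have h3 : ∑ i, ∑ j, h ^ 2 * H i j ^ 2 = h ^ 2 * ∑ i, ∑ j, H i j ^ 2 := by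
    simp only [Finset.mul_sum]
  rw [h3]
  set a := ∑ i, |g i|
  set b := ∑ i, ∑ j, |H i j|
  set a' := ∑ i, g i ^ 2 with ha'
  set b' := ∑ i, ∑ j, H i j ^ 2 with hb'
  have ha0 : 0 ≤ a' := Finset.sum_nonneg fun i _ => sq_nonneg _
  have hb0 : 0 ≤ b' := Finset.sum_nonneg fun i _ => Finset.sum_nonneg fun j _ => sq_nonneg _
  have hd0 : (0 : ℝ) ≤ d := Nat.cast_nonneg d
  have h4 : (|n| + a + h * b) ^ 2 ≤ 3 * (n ^ 2 + a ^ 2 + h ^ 2 * b ^ 2) := by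
    have : |n| ^ 2 = n ^ 2 := sq_abs n
    nlinarith [sq_nonneg (|n| - a), sq_nonneg (|n| - h * b), sq_nonneg (a - h * b)]
  have h5 : h ^ 2 * b ^ 2 ≤ h ^ 2 * (d ^ 2 * b') := mul_le_mul_of_nonneg_left h2 (sq_nonneg h)
  have h6 : n ^ 2 ≤ (d + 1) ^ 2 * n ^ 2 := le_mul_of_one_le_left (sq_nonneg n) (by nlinarith)
  have h7 : (d : ℝ) * a' ≤ (d + 1) ^ 2 * a' := mul_le_mul_of_nonneg_right (by nlinarith) ha0
  have h8 : h ^ 2 * (d ^ 2 * b') ≤ (d + 1) ^ 2 * (h ^ 2 * b') := by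
    have : (d : ℝ) ^ 2 * (h ^ 2 * b') ≤ (d + 1) ^ 2 * (h ^ 2 * b') :=
      mul_le_mul_of_nonneg_right (by nlinarith) (by positivity)
    linarith
  nlinarith

end StrainFEM

/-! ### Superapproximation -/

namespace StrainFEM
open Filter Topology Set
variable {d : ℕ} {Ω : Set (Pt d)}

theorem Triangulation.isOpen (T : Triangulation Ω) : IsOpen Ω := T.interior_space ▸ isOpen_interior

theorem Triangulation.diam_pos {T : Triangulation Ω} (hd : 1 ≤ d) {s : Finset (Pt d)}
    (hs : s ∈ T.cells) : 0 < Metric.diam (hull s) := by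
  have hc := (Triangulation.mem_cells.1 hs).2
  obtain ⟨p, hp, q, hq, hpq⟩ := Finset.one_lt_card.1 (show 1 < s.card by omega)
  exact (dist_pos.2 hpq).trans_le
    (Metric.dist_le_diam_of_mem (isCompact_hull s).isBounded (mem_hull hp) (mem_hull hq))

/-- The error of the discrete product on one element. -/
theorem exists_cell_error_bound (hd : 1 ≤ d) {k : ℕ} (hk : 1 ≤ k) {ρ L : ℝ} (hρ : 0 < ρ)
    (hL : 0 ≤ L) :
    ∃ C, 0 ≤ C ∧ ∀ (Ω : Set (Pt d)) (T : Triangulation Ω) (s : Finset (Pt d)), s ∈ T.cells →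
      Metric.diam (hull s) ≤ 1 →
      (∃ c, Metric.closedBall c (ρ * Metric.diam (hull s)) ⊆ hull s) →
      ∀ (ζ μ e : Pt d → ℝ) (t : Pt d → Pt d →ᵃ[ℝ] ℝ) (p : MvPolynomial (Fin d) ℝ),
        (∀ x, ∑ q ∈ s, t q x = 1) → (∀ x, ∑ q ∈ s, t q x • q = x) →
        (∀ x ∈ hull s, ∀ q ∈ s, 0 ≤ t q x) →
        UnifLocLip Ω ζ → UnifLocLip Ω μ → UnifLocLip Ω e →
        (∀ x ∈ hull s, ∀ y ∈ hull s, |ζ y - ζ x| ≤ L * ‖y - x‖) →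
        (∃ a : Pt d →L[ℝ] ℝ, ∀ x ∈ hull s, ∀ y ∈ hull s,
          |(ζ y - a y) - (ζ x - a x)| ≤ L * Metric.diam (hull s) * ‖y - x‖) →
        p.totalDegree ≤ k → (∀ x ∈ hull s, μ x = polyFun p x) →
        (∀ x ∈ hull s, e x = localProd k s t ζ p x - polyFun p x * ζ x) →
        ∫ x in interior (hull s), ((∑ i, pd i e x * pd i e x) + e x * e x)
          ≤ C * Metric.diam (hull s) ^ 2 *
            ∫ x in interior (hull s), ((∑ i, pd i μ x * pd i μ x) + μ x * μ x) := by
  obtain ⟨Ci, hCi, hinv⟩ := exists_inverse_inequality d k hρ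
  set C₀ := ((d + 1 : ℕ) : ℝ) * L * (3 + 1 / ρ) with hC₀
  -- The factor `d + 1` counts the partial derivatives and the value, `C₀ ^ 2` comes from the
  -- pointwise bound, whose vertex count is `d + 1`, and the last factor comes from `sq_bound_le`.
  set K := (d + 1 : ℝ) * C₀ ^ 2 * (3 * (d + 1) ^ 2) with hK
  have hK0 : 0 ≤ K := by positivity
  refine ⟨K * (1 + d * Ci), by positivity, ?_⟩
  rintro Ω T s hs hh1 ⟨c, hc⟩ ζ μ e t p ht1 htx ht0 hζu hμu heu hζ ⟨a, ha⟩ hp hμ he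
  set h := Metric.diam (hull s) with hh
  have hh0 : 0 < h := Triangulation.diam_pos hd hs
  set D := interior (hull s) with hD
  have hDo : IsOpen D := isOpen_interior
  have hDΩ : D ⊆ Ω := Triangulation.interior_subset hs
  have hbd : Bornology.IsBounded (hull s) := (isCompact_hull s).isBounded
  have hbD : Bornology.IsBounded D := hbd.subset interior_subset
  have hv : volume Ω ≠ ⊤ := T.volume_ne_top
  have hDball : Metric.ball c (ρ * h) ⊆ D :=
    interior_maximal (Metric.ball_subset_closedBall.trans hc) Metric.isOpen_ball
  have hcs : c ∈ hull s := hc (Metric.mem_closedBall_self (by positivity))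
  have hDcl : D ⊆ Metric.closedBall c h := fun x hx =>
    Metric.mem_closedBall.2 (Metric.dist_le_diam_of_mem hbd (interior_subset hx) hcs)
  have hdensμ : ∀ x ∈ D, (∑ i, pd i μ x * pd i μ x) + μ x * μ x
      = (∑ i, polyFun (MvPolynomial.pderiv i p) x ^ 2) + polyFun p x ^ 2 := by
    intro x hx
    have hev : μ =ᶠ[𝓝 x] polyFun p := by
      filter_upwards [mem_interior_iff_mem_nhds.1 hx] with y hy using hμ y hy
    simp only [pd_congr hev, pd_polyFun, hev.eq_of_nhds, sq]
  set H : Fin d → Fin d → Pt d → ℝ := fun i j x =>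
    polyFun (MvPolynomial.pderiv j (MvPolynomial.pderiv i p)) x with hH
  have hpt : ∀ᵐ x ∂(volume.restrict D), (∑ i, pd i e x * pd i e x) + e x * e x
      ≤ K * h ^ 2 * (((∑ i, pd i μ x * pd i μ x) + μ x * μ x)
        + ∑ i, ∑ j, h ^ 2 * H i j x ^ 2) := by
    filter_upwards [ae_restrict_of_ae_restrict_of_subset hDΩ (hζu.ae_differentiableAt T.isOpen),
      ae_restrict_mem hDo.measurableSet] with x hζd hx
    set X := |polyFun p x| + ∑ i, |polyFun (MvPolynomial.pderiv i p) x|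
      + h * ∑ i, ∑ j, |H i j x| with hX
    have hb := derivBound_localProd_sub (k := k) (C := C₀) (X := X) hk ht1 htx ht0 hρ hh hh0 hh1
      hL hc hζ ha p hx hζd (by rw [(Triangulation.mem_cells.1 hs).2]) rfl
    have hb' := hb.congr (g := e) (by
      filter_upwards [mem_interior_iff_mem_nhds.1 hx] with y hy using he y hy)
    have h1 : ∀ i, pd i e x * pd i e x ≤ (C₀ * h * X) ^ 2 := by
      intro i
      rw [← sq, ← sq_abs]
      exact pow_le_pow_left₀ (abs_nonneg _) (hb'.abs_pd_le i) 2
    have h2 : e x * e x ≤ (C₀ * h * X) ^ 2 := by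
      rw [← sq, ← sq_abs]
      exact pow_le_pow_left₀ (abs_nonneg _) hb'.1 2
    have h3 : X ^ 2 ≤ _ := sq_bound_le (n := polyFun p x) (h := h)
      (g := fun i => polyFun (MvPolynomial.pderiv i p) x) (H := fun i j => H i j x)
    rw [hdensμ x hx]
    calc (∑ i, pd i e x * pd i e x) + e x * e x
        ≤ ∑ _i : Fin d, (C₀ * h * X) ^ 2 + (C₀ * h * X) ^ 2 :=
          add_le_add (Finset.sum_le_sum fun i _ => h1 i) h2
      _ = (d + 1) * C₀ ^ 2 * h ^ 2 * X ^ 2 := by simp; ring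
      _ ≤ (d + 1) * C₀ ^ 2 * h ^ 2 * _ := mul_le_mul_of_nonneg_left h3 (by positivity)
      _ = _ := by rw [hK]; ring
  have hie := ((bddMeas_energy T.isOpen heu heu).integrableOn T.isOpen hv).mono_set hDΩ
  have hiμ := ((bddMeas_energy T.isOpen hμu hμu).integrableOn T.isOpen hv).mono_set hDΩ
  have hiH : ∀ i j, IntegrableOn (fun x => h ^ 2 * H i j x ^ 2) D volume := fun i j =>
    (integrableOn_polyFun_sq _ hbD).const_mul _
  have hiS : IntegrableOn (fun x => ∑ i, ∑ j, h ^ 2 * H i j x ^ 2) D volume :=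
    integrable_finsetSum _ fun i _ => integrable_finsetSum _ fun j _ => hiH i j
  have hig : ∀ i, IntegrableOn (fun x => polyFun (MvPolynomial.pderiv i p) x ^ 2) D volume :=
    fun i => integrableOn_polyFun_sq _ hbD
  -- The inverse inequality applied to each `∂ᵢ p` absorbs the second derivatives. The factor `h` is
  -- the diameter of this very element, so elements of different size are never compared.
  have hI2 : ∫ x in D, ∑ i, ∑ j, h ^ 2 * H i j x ^ 2
      ≤ d * Ci * ∫ x in D, ((∑ i, pd i μ x * pd i μ x) + μ x * μ x) := by
    rw [integral_finsetSum _ fun i _ => integrable_finsetSum _ fun j _ => hiH i j]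
    have h1 : ∀ i, ∫ x in D, ∑ j, h ^ 2 * H i j x ^ 2
        ≤ d * Ci * ∫ x in D, polyFun (MvPolynomial.pderiv i p) x ^ 2 := by
      intro i
      rw [integral_finsetSum _ fun j _ => hiH i j]
      calc ∑ j, ∫ x in D, h ^ 2 * H i j x ^ 2
          ≤ ∑ _j : Fin d, Ci * ∫ x in D, polyFun (MvPolynomial.pderiv i p) x ^ 2 := by
            refine Finset.sum_le_sum fun j _ => ?_
            rw [integral_const_mul]
            exact hinv j _ ((totalDegree_pderiv_le hp i).trans (Nat.sub_le _ _)) c h hh0 D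
              hDball hDcl
        _ = _ := by simp; ring
    refine (Finset.sum_le_sum fun i _ => h1 i).trans ?_
    rw [← Finset.mul_sum, ← integral_finsetSum _ fun i _ => hig i]
    refine mul_le_mul_of_nonneg_left ?_ (by positivity)
    refine setIntegral_mono_on (integrable_finsetSum _ fun i _ => hig i) hiμ hDo.measurableSet
      fun x hx => ?_
    rw [hdensμ x hx]
    exact le_add_of_nonneg_right (sq_nonneg _)
  calc ∫ x in D, ((∑ i, pd i e x * pd i e x) + e x * e x)
      ≤ ∫ x in D, K * h ^ 2 * (((∑ i, pd i μ x * pd i μ x) + μ x * μ x)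
        + ∑ i, ∑ j, h ^ 2 * H i j x ^ 2) :=
        integral_mono_ae hie ((hiμ.add hiS).const_mul _) hpt
    _ = K * h ^ 2 * ((∫ x in D, ((∑ i, pd i μ x * pd i μ x) + μ x * μ x))
        + ∫ x in D, ∑ i, ∑ j, h ^ 2 * H i j x ^ 2) := by
        rw [integral_const_mul, integral_add hiμ hiS]
    _ ≤ K * h ^ 2 * ((∫ x in D, ((∑ i, pd i μ x * pd i μ x) + μ x * μ x))
        + d * Ci * ∫ x in D, ((∑ i, pd i μ x * pd i μ x) + μ x * μ x)) := by
        gcongr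
    _ = _ := by ring

/-- Superapproximation: the product of a finite element function `μ` with a function in `H^{2,∞}`
is approximated in `V_h` with an error of order `h ‖μ‖_1`. -/
theorem exists_discrete_product (hd : 1 ≤ d) {k : ℕ} (hk : 1 ≤ k) {ρ L : ℝ} (hρ : 0 < ρ)
    (hL : 0 ≤ L) :
    ∃ C, 0 ≤ C ∧ ∀ (Ω : Set (Pt d)) (T : Triangulation Ω), T.meshSize ≤ 1 →
      (∀ τ ∈ T.elements, ∃ c, Metric.closedBall c (ρ * Metric.diam τ) ⊆ τ) →
      ∀ ζ : Pt d → ℝ, (∀ s ∈ T.cells,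
        (∀ x ∈ hull s, ∀ y ∈ hull s, |ζ y - ζ x| ≤ L * ‖y - x‖) ∧
        ∃ a : Pt d →L[ℝ] ℝ, ∀ x ∈ hull s, ∀ y ∈ hull s,
          |(ζ y - a y) - (ζ x - a x)| ≤ L * Metric.diam (hull s) * ‖y - x‖) →
      ∀ μ ∈ femSpace T k, ∃ v ∈ femSpace T k,
        energy Ω (fun x => v x - μ x * ζ x) (fun x => v x - μ x * ζ x)
          ≤ C * T.meshSize ^ 2 * energy Ω μ μ := by
  obtain ⟨C, hC, hcell⟩ := exists_cell_error_bound hd hk hρ hL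
  refine ⟨C, hC, fun Ω T hT1 hTρ ζ hζ μ hμ => ?_⟩
  have hζu : UnifLocLip Ω ζ := T.unifLocLip_of_cells hL fun s hs => (hζ s hs).1
  have hμu := unifLocLip_of_mem_femSpace hμ
  have hloc : ∀ s, ∃ (t : Pt d → Pt d →ᵃ[ℝ] ℝ) (p : MvPolynomial (Fin d) ℝ), s ∈ T.cells →
      ((∀ x, ∑ p ∈ s, t p x = 1) ∧ (∀ x, ∑ p ∈ s, t p x • p = x) ∧
        (∀ x ∈ hull s, ∀ p ∈ s, 0 ≤ t p x) ∧ ∀ p ∈ s, ∀ q ∈ s, p ≠ q → t p q = 0) ∧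
      p.totalDegree ≤ k ∧ ∀ x ∈ hull s, μ x = polyFun p x := by
    intro s
    by_cases hs : s ∈ T.cells
    · obtain ⟨t, ht⟩ := Triangulation.exists_barycentric hs
      obtain ⟨p, hp⟩ := (mem_femSpace_iff.1 hμ).2 s hs
      exact ⟨t, p, fun _ => ⟨ht, hp⟩⟩
    · exact ⟨fun _ => 0, 0, fun h => absurd h hs⟩
  choose t p htp using hloc
  -- The nodal values come from one function `ζ` on the closed elements, so neighbouring local
  -- products use the same data.
  obtain ⟨v, hv⟩ := T.exists_glue (F := fun s => localProd k s (t s) ζ (p s))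
    fun s hs s' hs' x hx hx' => localProd_eq hs hs' (htp s hs).1.1 (htp s hs).1.2.2.2
      (htp s' hs').1.1 (htp s' hs').1.2.2.2 ζ (htp s hs).2.2 (htp s' hs').2.2 hx hx'
  have hvpoly : ∀ s ∈ T.cells, ∃ P : MvPolynomial (Fin d) ℝ, P.totalDegree ≤ k ∧
      ∀ x ∈ hull s, v x = polyFun P x := by
    intro s hs
    obtain ⟨P, hP, hPx⟩ := exists_poly_localProd hk s (t s) ζ (htp s hs).2.1
    exact ⟨P, hP, fun x hx => by rw [hv s hs x hx, hPx]⟩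
  have hvV : v ∈ femSpace T k := by
    refine mem_femSpace_iff.2 ⟨T.continuousOn_closure fun s hs => ?_, hvpoly⟩
    obtain ⟨P, -, hP⟩ := hvpoly s hs
    exact (continuous_polyFun P).continuousOn.congr hP
  refine ⟨v, hvV, ?_⟩
  have heu : UnifLocLip Ω fun x => v x - μ x * ζ x :=
    (unifLocLip_of_mem_femSpace hvV).sub (hμu.mul T.isOpen hζu)
  rw [energy, energy,
    T.setIntegral_eq_sum ((bddMeas_energy T.isOpen heu heu).integrableOn T.isOpen T.volume_ne_top),
    T.setIntegral_eq_sum ((bddMeas_energy T.isOpen hμu hμu).integrableOn T.isOpen T.volume_ne_top),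
    Finset.mul_sum]
  refine Finset.sum_le_sum fun s hs => ?_
  have hdm := Triangulation.diam_le_meshSize hs
  refine (hcell Ω T s hs (hdm.trans hT1) (hTρ _ (Triangulation.hull_mem_elements hs)) ζ μ
    (fun x => v x - μ x * ζ x) (t s) (p s) (htp s hs).1.1 (htp s hs).1.2.1 (htp s hs).1.2.2.1
    hζu hμu heu (hζ s hs).1 (hζ s hs).2 (htp s hs).2.1 (htp s hs).2.2
    fun x hx => by simp only [hv s hs x hx, (htp s hs).2.2 x hx]).trans ?_
  refine mul_le_mul_of_nonneg_right ?_ (integral_nonneg fun x => add_nonneg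
    (Finset.sum_nonneg fun i _ => mul_self_nonneg _) (mul_self_nonneg _))
  exact mul_le_mul_of_nonneg_left (pow_le_pow_left₀ Metric.diam_nonneg hdm 2) hC

end StrainFEM

/-! ### Orthogonal projection and bounds for the energy form -/

namespace StrainFEM
open Filter Topology Set
variable {d : ℕ} {Ω : Set (Pt d)}

section Projection

variable {V : Type*} [AddCommGroup V] [Module ℝ V]

/-- Orthogonal decomposition with respect to a positive semidefinite form and the span of a finite
set. -/
theorem exists_orthogonal_of_finset (B : LinearMap.BilinForm ℝ V) (hB : LinearMap.IsSymm B)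
    (hs : ∀ x, 0 ≤ B x x) (S : Finset V) :
    ∀ v, ∃ w ∈ Submodule.span ℝ (S : Set V), ∀ w' ∈ Submodule.span ℝ (S : Set V),
      B (v - w) w' = 0 := by
  classical
  induction S using Finset.induction_on with
  | empty =>
    intro v
    refine ⟨0, Submodule.zero_mem _, fun w' hw' => ?_⟩
    simp only [Finset.coe_empty, Submodule.span_empty, Submodule.mem_bot] at hw'
    simp [hw']
  | insert a S ha ih =>
    intro v
    obtain ⟨pa, hpa, hpa'⟩ := ih a
    obtain ⟨pv, hpv, hpv'⟩ := ih v
    rw [Finset.coe_insert]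
    have hmono : Submodule.span ℝ (S : Set V) ≤ Submodule.span ℝ (insert a (S : Set V)) :=
      Submodule.span_mono (subset_insert _ _)
    set u := a - pa with hu
    have hus : u ∈ Submodule.span ℝ (insert a (S : Set V)) :=
      Submodule.sub_mem _ (Submodule.subset_span (mem_insert _ _)) (hmono hpa)
    have hdec : ∀ w' ∈ Submodule.span ℝ (insert a (S : Set V)),
        ∃ c : ℝ, ∃ y ∈ Submodule.span ℝ (S : Set V), w' = c • u + y := by
      intro w' hw'
      obtain ⟨c, y, hy, rfl⟩ := Submodule.mem_span_insert.1 hw'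
      refine ⟨c, c • pa + y, Submodule.add_mem _ (Submodule.smul_mem _ _ hpa) hy, ?_⟩
      rw [hu, smul_sub]
      abel
    -- Gram–Schmidt for a form that is only semidefinite: a new direction of length zero is
    -- orthogonal to everything by Cauchy–Schwarz, so nothing needs to be subtracted.
    by_cases h0 : B u u = 0
    · refine ⟨pv, hmono hpv, fun w' hw' => ?_⟩
      obtain ⟨c, y, hy, rfl⟩ := hdec w' hw'
      have h1 := B.apply_sq_le_of_symm hs hB (v - pv) u
      rw [h0, mul_zero] at h1
      have h2 : B (v - pv) u = 0 := by
        exact pow_eq_zero_iff two_ne_zero |>.1 (le_antisymm h1 (sq_nonneg _))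
      rw [map_add, map_smul, h2, hpv' y hy]
      simp
    · refine ⟨pv + (B (v - pv) u / B u u) • u,
        Submodule.add_mem _ (hmono hpv) (Submodule.smul_mem _ _ hus), fun w' hw' => ?_⟩
      obtain ⟨c, y, hy, rfl⟩ := hdec w' hw'
      rw [← sub_sub, map_sub, map_smul, LinearMap.sub_apply, LinearMap.smul_apply, map_add,
        map_add, map_smul, map_smul, hpv' y hy, hpa' y hy, smul_eq_mul, smul_eq_mul, smul_eq_mul]
      field_simp
      ring

/-- Orthogonal decomposition with respect to a positive semidefinite form and a subspace which is
finite-dimensional up to null vectors. -/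
theorem exists_orthogonal (B : LinearMap.BilinForm ℝ V) (hB : LinearMap.IsSymm B) (hs : ∀ x, 0 ≤ B x x)
    {Y : Type*} [AddCommGroup Y] [Module ℝ Y] (φ : V →ₗ[ℝ] Y) (N : Submodule ℝ Y)
    [FiniteDimensional ℝ N] (W : Submodule ℝ V) (hW : ∀ w ∈ W, φ w ∈ N)
    (h0 : ∀ w ∈ W, φ w = 0 → B w w = 0) (v : V) : ∃ w ∈ W, ∀ w' ∈ W, B (v - w) w' = 0 := by
  classical
  have hle : W.map φ ≤ N := by
    rintro _ ⟨w, hw, rfl⟩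
    exact hW w hw
  have hfd : FiniteDimensional ℝ (W.map φ) := Submodule.finiteDimensional_of_le hle
  obtain ⟨S, hS⟩ := (Submodule.fg_iff_finiteDimensional _).2 hfd
  have hSW : ∀ y ∈ S, ∃ w ∈ W, φ w = y := by
    intro y hy
    have : y ∈ W.map φ := hS ▸ Submodule.subset_span hy
    simpa using this
  choose! g hg hgφ using hSW
  have hsub : Submodule.span ℝ ((S.image g : Finset V) : Set V) ≤ W := by
    refine Submodule.span_le.2 fun x hx => ?_
    obtain ⟨y, hy, rfl⟩ := Finset.mem_image.1 (Finset.mem_coe.1 hx)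
    exact hg y hy
  obtain ⟨w, hw, hw'⟩ := exists_orthogonal_of_finset B hB hs (S.image g) v
  refine ⟨w, hsub hw, fun x hx => ?_⟩
  have hmap : (Submodule.span ℝ ((S.image g : Finset V) : Set V)).map φ = W.map φ := by
    rw [Submodule.map_span, ← hS]
    congr 1
    ext y
    simp only [Finset.coe_image, mem_image, Finset.mem_coe, exists_exists_and_eq_and]
    constructor
    · rintro ⟨y', hy', rfl⟩
      rwa [hgφ y' hy']
    · exact fun hy => ⟨y, hy, hgφ y hy⟩
  have hxm : φ x ∈ (Submodule.span ℝ ((S.image g : Finset V) : Set V)).map φ := by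
    rw [hmap]
    exact Submodule.mem_map_of_mem hx
  obtain ⟨y, hy, hyx⟩ := hxm
  -- Each vector of `W` differs from one in the finite span by a kernel vector of `φ`, which has
  -- length zero and is invisible to `B`.
  have hnull : B (x - y) (x - y) = 0 :=
    h0 _ (W.sub_mem hx (hsub hy)) (by rw [map_sub, hyx, sub_self])
  have h1 := B.apply_sq_le_of_symm hs hB (v - w) (x - y)
  rw [hnull, mul_zero] at h1
  have h2 : B (v - w) (x - y) = 0 :=
    pow_eq_zero_iff two_ne_zero |>.1 (le_antisymm h1 (sq_nonneg _))
  rw [map_sub, hw' y hy, sub_zero] at h2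
  exact h2

end Projection

/-- The space of bounded functions which are uniformly locally Lipschitz on `Ω`. -/
def lipSub (Ω : Set (Pt d)) : Submodule ℝ (Pt d → ℝ) where
  carrier := {f | UnifLocLip Ω f}
  add_mem' hf hg := UnifLocLip.add hf hg
  zero_mem' := unifLocLip_const Ω 0
  smul_mem' c _ hf := UnifLocLip.const_mul hf c

/-- The `H¹` scalar product as a bilinear form. -/
noncomputable def energyForm (hΩ : IsOpen Ω) (hv : volume Ω ≠ ⊤) :
    LinearMap.BilinForm ℝ (lipSub Ω) :=
  LinearMap.mk₂ ℝ (fun f g => energy Ω f.1 g.1)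
    (fun f f' g => by
      rw [energy_comm, energy_comm f.1, energy_comm f'.1]
      exact energy_add_right hΩ hv g.2 f.2 f'.2)
    (fun c f g => by
      rw [energy_comm, energy_comm f.1]
      exact energy_smul_right hΩ f.2 c)
    (fun f g g' => energy_add_right hΩ hv f.2 g.2 g'.2)
    (fun c _ g => energy_smul_right hΩ g.2 c)

theorem energy_sq_le (hΩ : IsOpen Ω) (hv : volume Ω ≠ ⊤) {f g : Pt d → ℝ} (hf : UnifLocLip Ω f)
    (hg : UnifLocLip Ω g) : energy Ω f g ^ 2 ≤ energy Ω f f * energy Ω g g :=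
  (energyForm hΩ hv).apply_sq_le_of_symm (fun x => energy_self_nonneg x.1)
    ⟨fun f g => energy_comm f.1 g.1⟩ ⟨f, hf⟩ ⟨g, hg⟩

/-- Vector fields whose components belong to `lipSub Ω`. -/
def vlipSub (Ω : Set (Pt d)) : Submodule ℝ (Pt d → Pt d) where
  carrier := {v | ∀ j, UnifLocLip Ω (comp v j)}
  add_mem' hf hg j := (hf j).add (hg j)
  zero_mem' _ := unifLocLip_const Ω 0
  smul_mem' c _ hf j := (hf j).const_mul c

/-- The scalar product of `H¹(Ω)^d` as a bilinear form. -/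
noncomputable def vform (hΩ : IsOpen Ω) (hv : volume Ω ≠ ⊤) :
    LinearMap.BilinForm ℝ (vlipSub Ω) :=
  LinearMap.mk₂ ℝ (fun v w => ∑ j, energy Ω (comp v.1 j) (comp w.1 j))
    (fun v v' w => by
      rw [← Finset.sum_add_distrib]
      refine Finset.sum_congr rfl fun j _ => ?_
      rw [energy_comm, energy_comm (comp v.1 j), energy_comm (comp v'.1 j)]
      exact energy_add_right hΩ hv (w.2 j) (v.2 j) (v'.2 j))
    (fun c v w => by
      rw [smul_eq_mul, Finset.mul_sum]
      refine Finset.sum_congr rfl fun j _ => ?_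
      rw [energy_comm, energy_comm (comp v.1 j)]
      exact energy_smul_right hΩ (v.2 j) c)
    (fun v w w' => by
      rw [← Finset.sum_add_distrib]
      exact Finset.sum_congr rfl fun j _ => energy_add_right hΩ hv (v.2 j) (w.2 j) (w'.2 j))
    (fun c v w => by
      rw [smul_eq_mul, Finset.mul_sum]
      exact Finset.sum_congr rfl fun j _ => energy_smul_right hΩ (w.2 j) c)

theorem vform_apply (hΩ : IsOpen Ω) (hv : volume Ω ≠ ⊤) (v w : vlipSub Ω) :
    vform hΩ hv v w = ∑ j, energy Ω (comp v.1 j) (comp w.1 j) := rfl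

theorem vinner1_eq_vform (hΩ : IsOpen Ω) (hv : volume Ω ≠ ⊤) (v w : vlipSub Ω) :
    vinner1 Ω v.1 w.1 = vform hΩ hv v w :=
  Finset.sum_congr rfl fun j _ => inner1_eq_energy hΩ hv (v.2 j) (w.2 j) ae_eq_rfl ae_eq_rfl

theorem vform_isSymm (hΩ : IsOpen Ω) (hv : volume Ω ≠ ⊤) :
    LinearMap.IsSymm (vform hΩ hv) :=
  ⟨fun v w => by
    rw [RingHom.id_apply, vform_apply, vform_apply]
    exact Finset.sum_congr rfl fun _ _ => energy_comm _ _⟩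

theorem vform_self_nonneg (hΩ : IsOpen Ω) (hv : volume Ω ≠ ⊤) (v : vlipSub Ω) :
    0 ≤ vform hΩ hv v v := by
  rw [vform_apply]
  exact Finset.sum_nonneg fun _ _ => energy_self_nonneg _

/-- The product rule with `(a + b)² ≤ 2 a² + 2 b²`, followed by summation over the `d` directions.
-/
theorem energy_mul_le (hΩ : IsOpen Ω) (hv : volume Ω ≠ ⊤) {f ζ : Pt d → ℝ} {L : ℝ}
    (hf : UnifLocLip Ω f) (hζ : UnifLocLip Ω ζ)
    (hζ1 : ∀ᵐ x ∂(volume.restrict Ω), |ζ x| ≤ 1)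
    (hζL : ∀ x ∈ Ω, ∀ i, |pd i ζ x| ≤ L) :
    energy Ω (fun x => f x * ζ x) (fun x => f x * ζ x) ≤ (2 + 2 * d * L ^ 2) * energy Ω f f := by
  rw [energy, energy, ← integral_const_mul]
  have hfζ := hf.mul hΩ hζ
  refine integral_mono_ae ((bddMeas_energy hΩ hfζ hfζ).integrableOn hΩ hv)
    (((bddMeas_energy hΩ hf hf).integrableOn hΩ hv).const_mul _) ?_
  filter_upwards [hζ1, hf.ae_differentiableAt hΩ, hζ.ae_differentiableAt hΩ,
    ae_restrict_mem hΩ.measurableSet] with x h1 h2 h3 hx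
  have h4 : ζ x ^ 2 ≤ 1 := by
    rw [← sq_abs]
    exact pow_le_one₀ (abs_nonneg _) h1
  have h5 : ∀ i, pd i (fun x => f x * ζ x) x * pd i (fun x => f x * ζ x) x
      ≤ 2 * (pd i f x * pd i f x) + 2 * L ^ 2 * (f x * f x) := by
    intro i
    rw [pd_mul h2 h3]
    have h6 : pd i ζ x ^ 2 ≤ L ^ 2 := by
      rw [← sq_abs]
      exact pow_le_pow_left₀ (abs_nonneg _) (hζL x hx i) 2
    nlinarith [sq_nonneg (pd i f x * ζ x - f x * pd i ζ x),
      mul_le_mul_of_nonneg_left h4 (sq_nonneg (pd i f x)),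
      mul_le_mul_of_nonneg_left h6 (sq_nonneg (f x))]
  calc _ ≤ ∑ i, (2 * (pd i f x * pd i f x) + 2 * L ^ 2 * (f x * f x)) + f x * f x := by
        refine add_le_add (Finset.sum_le_sum fun i _ => h5 i) ?_
        nlinarith [mul_le_mul_of_nonneg_left h4 (sq_nonneg (f x))]
    _ = 2 * ∑ i, pd i f x * pd i f x + (2 * d * L ^ 2 + 1) * (f x * f x) := by
        rw [Finset.sum_add_distrib, ← Finset.mul_sum]
        simp
        ring
    _ ≤ _ := by
        have h7 : 0 ≤ ∑ i, pd i f x * pd i f x := Finset.sum_nonneg fun i _ => mul_self_nonneg _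
        have h8 : 0 ≤ 2 * d * L ^ 2 * ∑ i, pd i f x * pd i f x := by positivity
        nlinarith [mul_self_nonneg (f x)]

theorem energy_sum_le (hΩ : IsOpen Ω) (hv : volume Ω ≠ ⊤) {ι : Type*} (s : Finset ι)
    {F : ι → Pt d → ℝ} (hF : ∀ j ∈ s, UnifLocLip Ω (F j)) :
    energy Ω (fun x => ∑ j ∈ s, F j x) (fun x => ∑ j ∈ s, F j x)
      ≤ s.card * ∑ j ∈ s, energy Ω (F j) (F j) := by
  have hS := UnifLocLip.sum s hF
  simp only [energy]
  rw [← integral_finsetSum _ fun j hj => (bddMeas_energy hΩ (hF j hj) (hF j hj)).integrableOn hΩ hv,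
    ← integral_const_mul]
  refine integral_mono_ae ((bddMeas_energy hΩ hS hS).integrableOn hΩ hv)
    ((integrable_finsetSum _ fun j hj =>
      (bddMeas_energy hΩ (hF j hj) (hF j hj)).integrableOn hΩ hv).const_mul _) ?_
  have hdiff : ∀ᵐ x ∂(volume.restrict Ω), ∀ j ∈ s, DifferentiableAt ℝ (F j) x :=
    (Finset.eventually_all s).2 fun j hj => (hF j hj).ae_differentiableAt hΩ
  filter_upwards [hdiff] with x hx
  have hsq : ∀ c : ι → ℝ, (∑ j ∈ s, c j) * (∑ j ∈ s, c j) ≤ s.card * ∑ j ∈ s, c j * c j := by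
    intro c
    have := sq_sum_le_card_mul_sum_sq (s := s) (f := c)
    simpa only [sq] using this
  simp only [pd_sum s hx]
  rw [Finset.sum_add_distrib, Finset.sum_comm, mul_add]
  exact add_le_add ((Finset.sum_le_sum fun i _ => hsq _).trans_eq (Finset.mul_sum _ _ _).symm)
    (hsq _)

theorem energy_add_le (hΩ : IsOpen Ω) (hv : volume Ω ≠ ⊤) {f g : Pt d → ℝ}
    (hf : UnifLocLip Ω f) (hg : UnifLocLip Ω g) :
    energy Ω (fun x => f x + g x) (fun x => f x + g x) ≤ 2 * (energy Ω f f + energy Ω g g) := by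
  have := energy_sum_le hΩ hv (Finset.univ : Finset (Fin 2)) (F := ![f, g])
    (by intro j _; fin_cases j <;> simpa)
  simpa [Fin.sum_univ_two] using this

end StrainFEM

/-! ### The finite element spaces, the form `b` and the removal of its discrete rigid kernel -/

namespace StrainFEM
open Filter Topology Set
variable {d : ℕ} {Ω : Set (Pt d)} {T : Triangulation Ω} {k : ℕ}

theorem femSpace_add {f g : Pt d → ℝ} (hf : f ∈ femSpace T k) (hg : g ∈ femSpace T k) :
    (fun x => f x + g x) ∈ femSpace T k := by
  rw [mem_femSpace_iff] at *
  refine ⟨hf.1.add hg.1, fun s hs => ?_⟩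
  obtain ⟨p, hp, hpx⟩ := hf.2 s hs
  obtain ⟨q, hq, hqx⟩ := hg.2 s hs
  exact ⟨p + q, (MvPolynomial.totalDegree_add _ _).trans (max_le hp hq), fun x hx => by
    rw [polyFun_add, hpx x hx, hqx x hx]⟩

theorem femSpace_const_mul {f : Pt d → ℝ} (c : ℝ) (hf : f ∈ femSpace T k) :
    (fun x => c * f x) ∈ femSpace T k := by
  rw [mem_femSpace_iff] at *
  refine ⟨continuousOn_const.mul hf.1, fun s hs => ?_⟩
  obtain ⟨p, hp, hpx⟩ := hf.2 s hs
  refine ⟨MvPolynomial.C c * p, (MvPolynomial.totalDegree_mul _ _).trans (by simpa using hp),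
    fun x hx => ?_⟩
  rw [polyFun_mul, polyFun_C, hpx x hx]

theorem femSpace_const (c : ℝ) : (fun _ => c) ∈ femSpace T k :=
  mem_femSpace_iff.2 ⟨continuousOn_const, fun _ _ => ⟨MvPolynomial.C c, by simp, fun x _ =>
    (polyFun_C c x).symm⟩⟩

/-- The space `V_h^d` as a subspace. -/
def vfemSub (T : Triangulation Ω) (k : ℕ) : Submodule ℝ (vlipSub Ω) where
  carrier := {v | v.1 ∈ vfemSpace T k}
  add_mem' hv hw j := femSpace_add (hv j) (hw j)
  zero_mem' _ := femSpace_const 0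
  smul_mem' c _ hv j := femSpace_const_mul c (hv j)

theorem mem_vlipSub_of_mem_vfemSpace {v : Pt d → Pt d} (hv : v ∈ vfemSpace T k) : v ∈ vlipSub Ω :=
  fun j => unifLocLip_of_mem_femSpace (hv j)

/-- Restriction of the components of a field to the union of the open elements. -/
noncomputable def cellRestrict (T : Triangulation Ω) :
    vlipSub Ω →ₗ[ℝ] Fin d → Pt d → ℝ where
  toFun v j := (⋃ s ∈ T.cells, interior (hull s)).indicator (comp v.1 j)
  map_add' v w := by
    ext j x
    simp only [Pi.add_apply]
    by_cases hx : x ∈ ⋃ s ∈ T.cells, interior (hull s)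
    · simp only [indicator_of_mem hx]; rfl
    · simp only [indicator_of_notMem hx, add_zero]
  map_smul' c v := by
    ext j x
    simp only [Pi.smul_apply, RingHom.id_apply]
    by_cases hx : x ∈ ⋃ s ∈ T.cells, interior (hull s)
    · simp only [indicator_of_mem hx]; rfl
    · simp only [indicator_of_notMem hx, smul_zero]

/-- Piecewise polynomial functions on the open elements. -/
noncomputable def piecewisePoly (T : Triangulation Ω) (k : ℕ) :
    (T.cells → Fin d → MvPolynomial.restrictTotalDegree (Fin d) ℝ k) →ₗ[ℝ] Fin d → Pt d → ℝ where
  toFun P j x := ∑ s : T.cells, (interior (hull s.1)).indicator (polyFun (P s j).1) x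
  map_add' P Q := by
    ext j x
    simp only [Pi.add_apply]
    rw [← Finset.sum_add_distrib]
    refine Finset.sum_congr rfl fun s _ => ?_
    by_cases hx : x ∈ interior (hull s.1)
    · simp only [indicator_of_mem hx]; exact polyFun_add _ _ _
    · simp only [indicator_of_notMem hx, add_zero]
  map_smul' c P := by
    ext j x
    simp only [Pi.smul_apply, RingHom.id_apply, smul_eq_mul]
    rw [Finset.mul_sum]
    refine Finset.sum_congr rfl fun s _ => ?_
    by_cases hx : x ∈ interior (hull s.1)
    · simp only [indicator_of_mem hx]; simp [polyFun]
    · simp only [indicator_of_notMem hx, mul_zero]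

/-- Elements of `V_h^d` are functions on all of `ℝ^d` with arbitrary values off `closure Ω`, so the
space is finite-dimensional only modulo null vectors. Restriction to the open elements gives the
finite-dimensional image, and `vform_self_eq_zero` shows that its kernel is null. -/
theorem cellRestrict_mem_range {v : vlipSub Ω} (hv : v ∈ vfemSub T k) :
    cellRestrict T v ∈ LinearMap.range (piecewisePoly T k) := by
  choose P hP hPx using fun (s : T.cells) (j : Fin d) => (mem_femSpace_iff.1 (hv j)).2 s.1 s.2
  refine ⟨fun s j => ⟨P s j, (MvPolynomial.mem_restrictTotalDegree _ _ _).2 (hP s j)⟩, ?_⟩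
  ext j x
  change ∑ s : T.cells, (interior (hull s.1)).indicator (polyFun (P s j)) x
    = (⋃ s ∈ T.cells, interior (hull s)).indicator (comp v.1 j) x
  by_cases hx : x ∈ ⋃ s ∈ T.cells, interior (hull s)
  · rw [indicator_of_mem hx]
    obtain ⟨s, hs, hxs⟩ := mem_iUnion₂.1 hx
    rw [Finset.sum_eq_single_of_mem (⟨s, hs⟩ : T.cells) (Finset.mem_univ _), indicator_of_mem hxs,
      hPx ⟨s, hs⟩ j x (interior_subset hxs)]
    intro s' _ hs'
    refine indicator_of_notMem (fun hxs' => ?_) _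
    have := T.pairwise_disjoint_interior s'.2 hs fun h => hs' (Subtype.ext h)
    exact Set.disjoint_left.1 this hxs' hxs
  · rw [indicator_of_notMem hx]
    refine Finset.sum_eq_zero fun s _ => indicator_of_notMem (fun hxs => hx ?_) _
    exact mem_iUnion₂.2 ⟨s.1, s.2, hxs⟩

theorem vform_self_eq_zero (T : Triangulation Ω) {v : vlipSub Ω} (h : cellRestrict T v = 0) :
    vform T.isOpen T.volume_ne_top v v = 0 := by
  rw [vform_apply]
  refine Finset.sum_eq_zero fun j _ => ?_
  refine integral_eq_zero_of_ae (T.ae_of_ae_interior fun s hs => ?_)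
  filter_upwards [ae_restrict_mem isOpen_interior.measurableSet] with x hx
  have hev : comp v.1 j =ᶠ[𝓝 x] fun _ => 0 := by
    filter_upwards [isOpen_interior.mem_nhds hx] with y hy
    have h1 := congrFun (congrFun h j) y
    have h2 : y ∈ ⋃ s ∈ T.cells, interior (hull s) := mem_iUnion₂.2 ⟨s, hs, hy⟩
    simpa [cellRestrict, indicator_of_mem h2] using h1
  have hpd : ∀ i, pd i (comp v.1 j) x = 0 := fun i => by
    rw [pd_congr hev]
    simp [pd]
  simp [hpd, hev.eq_of_nhds]

/-- A unit field with components that are uniformly locally Lipschitz representatives of the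
components of `z`. -/
structure UnitField (Ω : Set (Pt d)) (z : Pt d → Pt d) (L : ℝ) (ζ : Fin d → Pt d → ℝ) : Prop where
  lip : ∀ j, UnifLocLip Ω (ζ j)
  ae_eq : ∀ j, ζ j =ᵐ[volume.restrict Ω] comp z j
  ae_norm : ∀ᵐ x ∂(volume.restrict Ω), ∑ j, ζ j x * ζ j x = 1
  pd_le : ∀ j, ∀ x ∈ Ω, ∀ i, |pd i (ζ j) x| ≤ L

namespace UnitField

variable {z : Pt d → Pt d} {L : ℝ} {ζ : Fin d → Pt d → ℝ}

theorem ae_abs_le (h : UnitField Ω z L ζ) (j : Fin d) :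
    ∀ᵐ x ∂(volume.restrict Ω), |ζ j x| ≤ 1 := by
  filter_upwards [h.ae_norm] with x hx
  have h1 : ζ j x * ζ j x ≤ 1 := by
    rw [← hx]
    exact Finset.single_le_sum (f := fun j => ζ j x * ζ j x) (fun i _ => mul_self_nonneg _)
      (Finset.mem_univ j)
  exact abs_le_one_iff_mul_self_le_one.2 h1

theorem unifLocLip_dot (h : UnitField Ω z L ζ) (hΩ : IsOpen Ω) {v : Fin d → Pt d → ℝ}
    (hv : ∀ j, UnifLocLip Ω (v j)) : UnifLocLip Ω fun x => ∑ j, v j x * ζ j x :=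
  UnifLocLip.sum _ fun j _ => (hv j).mul hΩ (h.lip j)

/-- Replacing `z` by its Lipschitz representative turns `b` into a classical expression, from which
linearity and boundedness are read off. -/
theorem bForm_eq (h : UnitField Ω z L ζ) (hΩ : IsOpen Ω) (hvol : volume Ω ≠ ⊤) {μ : Pt d → ℝ}
    (hμ : UnifLocLip Ω μ) {v : Pt d → Pt d} (hv : v ∈ vlipSub Ω) :
    bForm Ω z μ v = energy Ω μ fun x => ∑ j, comp v j x * ζ j x := by
  refine inner1_eq_energy hΩ hvol hμ (h.unifLocLip_dot hΩ hv) ae_eq_rfl ?_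
  filter_upwards [ae_all_iff.2 h.ae_eq] with x hx
  rw [PiLp.inner_apply]
  refine Finset.sum_congr rfl fun j _ => ?_
  rw [hx j]
  simp [comp, mul_comm]

theorem energy_dot_le (h : UnitField Ω z L ζ) (hΩ : IsOpen Ω) (hvol : volume Ω ≠ ⊤)
    {v : Fin d → Pt d → ℝ} (hv : ∀ j, UnifLocLip Ω (v j)) :
    energy Ω (fun x => ∑ j, v j x * ζ j x) (fun x => ∑ j, v j x * ζ j x)
      ≤ d * (2 + 2 * d * L ^ 2) * ∑ j, energy Ω (v j) (v j) := by
  refine (energy_sum_le hΩ hvol Finset.univ fun j _ => (hv j).mul hΩ (h.lip j)).trans ?_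
  rw [Finset.card_univ, Fintype.card_fin, mul_assoc]
  have h1 : ∑ j, energy Ω (fun x => v j x * ζ j x) (fun x => v j x * ζ j x)
      ≤ (2 + 2 * d * L ^ 2) * ∑ j, energy Ω (v j) (v j) := by
    refine (Finset.sum_le_sum fun j _ => ?_).trans_eq (Finset.mul_sum _ _ _).symm
    exact energy_mul_le hΩ hvol (hv j) (h.lip j) (h.ae_abs_le j) (h.pd_le j)
  exact mul_le_mul_of_nonneg_left h1 (Nat.cast_nonneg d)

theorem bForm_sq_le (h : UnitField Ω z L ζ) (hΩ : IsOpen Ω) (hvol : volume Ω ≠ ⊤) {μ : Pt d → ℝ}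
    (hμ : UnifLocLip Ω μ) (v : vlipSub Ω) :
    bForm Ω z μ v.1 ^ 2
      ≤ energy Ω μ μ * (d * (2 + 2 * d * L ^ 2) * vform hΩ hvol v v) := by
  rw [h.bForm_eq hΩ hvol hμ v.2]
  refine (energy_sq_le hΩ hvol hμ (h.unifLocLip_dot hΩ v.2)).trans ?_
  exact mul_le_mul_of_nonneg_left (h.energy_dot_le hΩ hvol v.2) (energy_self_nonneg μ)

theorem bForm_add (h : UnitField Ω z L ζ) (hΩ : IsOpen Ω) (hvol : volume Ω ≠ ⊤) {μ : Pt d → ℝ}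
    (hμ : UnifLocLip Ω μ) (v w : vlipSub Ω) :
    bForm Ω z μ (v + w : vlipSub Ω).1 = bForm Ω z μ v.1 + bForm Ω z μ w.1 := by
  rw [h.bForm_eq hΩ hvol hμ v.2, h.bForm_eq hΩ hvol hμ w.2, h.bForm_eq hΩ hvol hμ (v + w).2,
    ← energy_add_right hΩ hvol hμ (h.unifLocLip_dot hΩ v.2) (h.unifLocLip_dot hΩ w.2)]
  congr 1
  ext x
  rw [← Finset.sum_add_distrib]
  refine Finset.sum_congr rfl fun j _ => ?_
  simp [comp, add_mul]

theorem bForm_smul (h : UnitField Ω z L ζ) (hΩ : IsOpen Ω) (hvol : volume Ω ≠ ⊤) {μ : Pt d → ℝ}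
    (hμ : UnifLocLip Ω μ) (c : ℝ) (v : vlipSub Ω) :
    bForm Ω z μ (c • v : vlipSub Ω).1 = c * bForm Ω z μ v.1 := by
  rw [h.bForm_eq hΩ hvol hμ v.2, h.bForm_eq hΩ hvol hμ (c • v).2,
    ← energy_smul_right hΩ (h.unifLocLip_dot hΩ v.2)]
  congr 1
  ext x
  rw [Finset.mul_sum]
  refine Finset.sum_congr rfl fun j _ => ?_
  simp [comp, mul_assoc]

/-- Removing the component in `K_{z,h}` does not change `b(μ, ·)` on `V_h` and does not increase the
norm. -/
theorem exists_star (h : UnitField Ω z L ζ) (T : Triangulation Ω) {k : ℕ} {v : vlipSub Ω}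
    (hv : v ∈ vfemSub T k) :
    ∃ w : vlipSub Ω, w.1 ∈ vfemSpaceStar T k z ∧
      (∀ μ ∈ femSpace T k, bForm Ω z μ w.1 = bForm Ω z μ v.1) ∧
      vform T.isOpen T.volume_ne_top w w ≤ vform T.isOpen T.volume_ne_top v v := by
  set B := vform T.isOpen T.volume_ne_top with hBdef
  -- Projecting onto the span avoids checking that `K_{z,h}` is a subspace. By linearity `b(μ, ·)`
  -- still vanishes on it, and orthogonality to the span implies orthogonality to its generators.
  set W : Submodule ℝ (vlipSub Ω) :=
    Submodule.span ℝ {w | w.1 ∈ discreteRigidKer T k z} with hW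
  have hWfem : W ≤ vfemSub T k := Submodule.span_le.2 fun w hw => hw.1.1
  have hWker : ∀ w ∈ W, ∀ μ ∈ femSpace T k, bForm Ω z μ w.1 = 0 := by
    intro w hw μ hμ
    have hμu := unifLocLip_of_mem_femSpace hμ
    induction hw using Submodule.span_induction with
    | mem w hw => exact hw.1.2 μ hμ
    | zero =>
      have := h.bForm_smul T.isOpen T.volume_ne_top hμu 0 0
      rwa [zero_smul, zero_mul] at this
    | add x y _ _ hx hy => rw [h.bForm_add T.isOpen T.volume_ne_top hμu, hx, hy, add_zero]
    | smul c x _ hx => rw [h.bForm_smul T.isOpen T.volume_ne_top hμu, hx, mul_zero]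
  have hfd : FiniteDimensional ℝ (LinearMap.range (piecewisePoly T k)) := inferInstance
  obtain ⟨w, hw, hort⟩ := exists_orthogonal B (vform_isSymm _ _) (vform_self_nonneg _ _)
    (cellRestrict T) (LinearMap.range (piecewisePoly T k)) W
    (fun w hw => cellRestrict_mem_range (hWfem hw)) (fun w _ h0 => vform_self_eq_zero T h0) v
  refine ⟨v - w, ⟨(vfemSub T k).sub_mem hv (hWfem hw), fun w' hw' => ?_⟩, fun μ hμ => ?_, ?_⟩
  · have hw'V : w' ∈ vlipSub Ω := mem_vlipSub_of_mem_vfemSpace hw'.1.1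
    rw [vinner1_eq_vform T.isOpen T.volume_ne_top (v - w) ⟨w', hw'V⟩]
    exact hort _ (Submodule.subset_span hw')
  · have hμu := unifLocLip_of_mem_femSpace hμ
    have h1 := h.bForm_add T.isOpen T.volume_ne_top hμu (v - w) w
    rw [sub_add_cancel, hWker w hw μ hμ, add_zero] at h1
    exact h1.symm
  · have h1 : B v v = B (v - w) (v - w) + 2 * B (v - w) w + B w w := by
      have hsym : B w (v - w) = B (v - w) w := (vform_isSymm _ _).eq (v - w) w |>.symm
      conv_lhs => rw [← sub_add_cancel v w]
      simp only [map_add, LinearMap.add_apply, hsym]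
      ring
    rw [hort w hw] at h1
    have h2 : 0 ≤ B w w := vform_self_nonneg _ _ w
    linarith

end UnitField

end StrainFEM

/-! ### The inf-sup condition -/

namespace StrainFEM
open Filter Topology Set
variable {d : ℕ} {Ω : Set (Pt d)}

theorem norm1_eq {T : Triangulation Ω} {μ : Pt d → ℝ} (hμ : UnifLocLip Ω μ) :
    norm1 Ω μ = √(energy Ω μ μ) := by
  rw [norm1, inner1_eq_energy T.isOpen T.volume_ne_top hμ hμ ae_eq_rfl ae_eq_rfl]

theorem energy_one_pos (T : Triangulation Ω) (hne : Ω.Nonempty) :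
    0 < energy Ω (fun _ => (1 : ℝ)) fun _ => 1 := by
  have h : energy Ω (fun _ => (1 : ℝ)) (fun _ => 1) = volume.real Ω := by
    simp [energy, pd]
  rw [h]
  exact ENNReal.toReal_pos (T.isOpen.measure_pos volume hne).ne' T.volume_ne_top

/-- The unit field has representatives that are almost affine on the elements, with constants
independent of the triangulation. -/
theorem exists_unitField (hΩb : LocallyConnectedAtBoundary Ω) (hv : volume Ω ≠ ⊤) {m : ℕ}
    {z : Pt d → Pt d} (hz : ∀ j, MemSobolev Ω ⊤ (m + 2) (comp z j))
    (hz1 : ∀ᵐ x ∂(volume.restrict Ω), ‖z x‖ = 1) :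
    ∃ L, 0 ≤ L ∧ ∀ T : Triangulation Ω, ∃ ζ : Fin d → Pt d → ℝ, UnitField Ω z L ζ ∧
      ∀ j, ∀ s ∈ T.cells, (∀ x ∈ hull s, ∀ y ∈ hull s, |ζ j y - ζ j x| ≤ L * ‖y - x‖) ∧
        ∃ a : Pt d →L[ℝ] ℝ, ∀ x ∈ hull s, ∀ y ∈ hull s,
          |(ζ j y - a y) - (ζ j x - a x)| ≤ L * Metric.diam (hull s) * ‖y - x‖ := by
  choose L hL hLT using fun j => exists_cellwise_taylor hΩb hv (hz j)
  have hLj : ∀ j, L j ≤ ∑ j, L j := fun j =>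
    Finset.single_le_sum (fun i _ => hL i) (Finset.mem_univ j)
  have hL0 : 0 ≤ ∑ j, L j := Finset.sum_nonneg fun j _ => hL j
  refine ⟨∑ j, L j, hL0, fun T => ?_⟩
  choose ζ hζz hζ using fun j => hLT j T
  have hcell : ∀ j, ∀ s ∈ T.cells,
      (∀ x ∈ hull s, ∀ y ∈ hull s, |ζ j y - ζ j x| ≤ (∑ j, L j) * ‖y - x‖) ∧
      ∃ a : Pt d →L[ℝ] ℝ, ∀ x ∈ hull s, ∀ y ∈ hull s,
        |(ζ j y - a y) - (ζ j x - a x)| ≤ (∑ j, L j) * Metric.diam (hull s) * ‖y - x‖ := by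
    intro j s hs
    obtain ⟨h1, a, h2⟩ := hζ j s hs
    refine ⟨fun x hx y hy => (h1 x hx y hy).trans ?_, a, fun x hx y hy => (h2 x hx y hy).trans ?_⟩
    · exact mul_le_mul_of_nonneg_right (hLj j) (norm_nonneg _)
    · exact mul_le_mul_of_nonneg_right (mul_le_mul_of_nonneg_right (hLj j) Metric.diam_nonneg)
        (norm_nonneg _)
  refine ⟨ζ, ⟨fun j => T.unifLocLip_of_cells hL0 fun s hs => (hcell j s hs).1, hζz, ?_, ?_⟩, hcell⟩
  · filter_upwards [ae_all_iff.2 hζz, hz1] with x h1 h2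
    have h3 : ‖z x‖ ^ 2 = ∑ j, z x j ^ 2 := EuclideanSpace.real_norm_sq_eq (z x)
    rw [h2, one_pow] at h3
    rw [h3]
    refine Finset.sum_congr rfl fun j _ => ?_
    rw [h1 j, comp, sq]
  · exact fun j x hx i =>
      abs_pd_le hL0 (T.eventually_of_cells (fun s hs => (hcell j s hs).1) hx) i

/-- The uniform test field for the inf-sup condition. -/
theorem exists_test_field (hd : 1 ≤ d) {k : ℕ} (hk : 1 ≤ k) {ρ L : ℝ} (hρ : 0 < ρ) (hL : 0 ≤ L) :
    ∃ A h₀ : ℝ, 0 ≤ A ∧ 0 < h₀ ∧ ∀ (Ω : Set (Pt d)) (T : Triangulation Ω), T.meshSize ≤ h₀ →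
      (∀ τ ∈ T.elements, ∃ c, Metric.closedBall c (ρ * Metric.diam τ) ⊆ τ) →
      ∀ (z : Pt d → Pt d) (ζ : Fin d → Pt d → ℝ), UnitField Ω z L ζ →
      (∀ j, ∀ s ∈ T.cells, (∀ x ∈ hull s, ∀ y ∈ hull s, |ζ j y - ζ j x| ≤ L * ‖y - x‖) ∧
        ∃ a : Pt d →L[ℝ] ℝ, ∀ x ∈ hull s, ∀ y ∈ hull s,
          |(ζ j y - a y) - (ζ j x - a x)| ≤ L * Metric.diam (hull s) * ‖y - x‖) →
      ∀ μ ∈ femSpace T k, ∃ v : vlipSub Ω, v ∈ vfemSub T k ∧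
        energy Ω μ μ / 2 ≤ bForm Ω z μ v.1 ∧
        vform T.isOpen T.volume_ne_top v v ≤ A * energy Ω μ μ := by
  obtain ⟨C, hC, hprod⟩ := exists_discrete_product hd hk hρ hL
  set M := 2 + 2 * (d : ℝ) * L ^ 2 with hM
  have hM0 : 0 ≤ M := by positivity
  set Q := (d : ℝ) * M * (d * C) with hQ
  have hQ0 : 0 ≤ Q := by positivity
  -- `A` collects `2 (‖μ ζⱼ‖² + ‖eⱼ‖²)` over the `d` components. The threshold gives `Q h² ≤ 1 / 4`,
  -- so the perturbation `e · ζ` has norm at most half of `‖μ‖₁`; it also forces `h ≤ 1`.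
  refine ⟨d * (2 * (M + C)), 1 / (2 * (Q + 1)), by positivity, by positivity, ?_⟩
  intro Ω T hT hTρ z ζ hu hcell μ hμ
  have hmesh0 : 0 ≤ T.meshSize := Real.sSup_nonneg (by
    rintro _ ⟨τ, -, rfl⟩
    exact Metric.diam_nonneg)
  have hT1 : T.meshSize ≤ 1 := hT.trans (by
    rw [div_le_one (by positivity)]
    linarith)
  have hTsq : T.meshSize ^ 2 ≤ T.meshSize := by nlinarith
  have hQT : Q * T.meshSize ^ 2 ≤ 1 / 4 := by
    have h1 : T.meshSize ^ 2 ≤ (1 / (2 * (Q + 1))) ^ 2 := pow_le_pow_left₀ hmesh0 hT 2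
    calc Q * T.meshSize ^ 2 ≤ (Q + 1) ^ 2 * (1 / (2 * (Q + 1))) ^ 2 :=
          mul_le_mul (by nlinarith) h1 (sq_nonneg _) (sq_nonneg _)
      _ = 1 / 4 := by field_simp; norm_num
  have hμu := unifLocLip_of_mem_femSpace hμ
  choose v hv hverr using fun j => hprod Ω T hT1 hTρ (ζ j) (hcell j) μ hμ
  have hvu : ∀ j, UnifLocLip Ω (v j) := fun j => unifLocLip_of_mem_femSpace (hv j)
  set e : Fin d → Pt d → ℝ := fun j x => v j x - μ x * ζ j x with he
  have heu : ∀ j, UnifLocLip Ω (e j) := fun j => (hvu j).sub (hμu.mul T.isOpen (hu.lip j))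
  set n := energy Ω μ μ with hn
  have hn0 : 0 ≤ n := energy_self_nonneg μ
  have hesum : ∑ j, energy Ω (e j) (e j) ≤ d * C * T.meshSize ^ 2 * n := by
    refine (Finset.sum_le_sum fun j _ => hverr j).trans_eq ?_
    simp
    ring
  let V : vlipSub Ω := ⟨fun x => WithLp.toLp 2 fun j => v j x, fun j => hvu j⟩
  have hVcomp : ∀ j, comp V.1 j = v j := fun j => rfl
  refine ⟨V, fun j => hv j, ?_, ?_⟩
  · set w : Pt d → ℝ := fun x => ∑ j, e j x * ζ j x with hw
    have hwu : UnifLocLip Ω w := hu.unifLocLip_dot T.isOpen heu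
    -- Since `|ζ| = 1` a.e., the product `v · z` equals `μ + e · ζ`, so `b` is the full square of
    -- the norm plus a small perturbation.
    have hb : bForm Ω z μ V.1 = n + energy Ω μ w := by
      rw [hn, ← energy_add_right T.isOpen T.volume_ne_top hμu hμu hwu]
      refine inner1_eq_energy T.isOpen T.volume_ne_top hμu (hμu.add hwu) ae_eq_rfl ?_
      filter_upwards [ae_all_iff.2 hu.ae_eq, hu.ae_norm] with x h1 h2
      have h3 : ∑ j, e j x * ζ j x = ∑ j, v j x * ζ j x - μ x * ∑ j, ζ j x * ζ j x := by
        rw [Finset.mul_sum, ← Finset.sum_sub_distrib]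
        exact Finset.sum_congr rfl fun j _ => by simp only [he]; ring
      simp only [hw, h3, h2]
      rw [PiLp.inner_apply, mul_one, add_sub_cancel]
      refine Finset.sum_congr rfl fun j _ => ?_
      rw [h1 j]
      simp [V, comp, mul_comm]
    have hwe : energy Ω w w ≤ n / 4 := by
      calc energy Ω w w ≤ d * M * ∑ j, energy Ω (e j) (e j) :=
            hu.energy_dot_le T.isOpen T.volume_ne_top heu
        _ ≤ d * M * (d * C * T.meshSize ^ 2 * n) := by gcongr
        _ = Q * T.meshSize ^ 2 * n := by rw [hQ]; ring
        _ ≤ 1 / 4 * n := by gcongr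
        _ = n / 4 := by ring
    have hcs := energy_sq_le T.isOpen T.volume_ne_top hμu hwu
    have habs : |energy Ω μ w| ≤ n / 2 := by
      refine abs_le_of_sq_le_sq ?_ (by positivity)
      calc energy Ω μ w ^ 2 ≤ n * energy Ω w w := hcs
        _ ≤ n * (n / 4) := by gcongr
        _ = (n / 2) ^ 2 := by ring
    rw [hb]
    linarith [(abs_le.1 habs).1]
  · rw [vform_apply]
    have h1 : ∀ j, energy Ω (comp V.1 j) (comp V.1 j)
        ≤ 2 * (M * n + energy Ω (e j) (e j)) := by
      intro j
      have h2 : comp V.1 j = fun x => μ x * ζ j x + e j x := by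
        ext x
        simp [hVcomp, he]
      rw [h2]
      refine (energy_add_le T.isOpen T.volume_ne_top (hμu.mul T.isOpen (hu.lip j)) (heu j)).trans ?_
      have := energy_mul_le T.isOpen T.volume_ne_top hμu (hu.lip j) (hu.ae_abs_le j) (hu.pd_le j)
      linarith
    have h3 : ∀ j, energy Ω (e j) (e j) ≤ C * n := by
      intro j
      refine (hverr j).trans ?_
      have : C * T.meshSize ^ 2 ≤ C * 1 := mul_le_mul_of_nonneg_left (hTsq.trans hT1) hC
      rw [mul_one] at this
      exact mul_le_mul_of_nonneg_right this hn0
    calc ∑ j, energy Ω (comp V.1 j) (comp V.1 j) ≤ ∑ _j : Fin d, 2 * (M * n + C * n) :=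
          Finset.sum_le_sum fun j _ => (h1 j).trans (by linarith [h3 j])
      _ = _ := by simp; ring

end StrainFEM

theorem mainTheorem5 (d : ℕ) (hd : d = 2 ∨ d = 3) (Ω : Set (StrainFEM.Pt d))
    (hΩo : IsOpen Ω) (hΩc : IsConnected Ω) (hΩb : StrainFEM.LocallyConnectedAtBoundary Ω)
    (k : ℕ) (hk : 1 ≤ k) (z : StrainFEM.Pt d → StrainFEM.Pt d)
    (hz : ∀ j, StrainFEM.MemSobolev Ω ⊤ (k + 1) (StrainFEM.comp z j))
    (hz1 : ∀ᵐ x ∂(MeasureTheory.volume.restrict Ω), ‖z x‖ = 1)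
    {ι : Type*} (T : ι → StrainFEM.Triangulation Ω) (hT : StrainFEM.ShapeRegular T) :
    ∃ β : ℝ, 0 < β ∧ ∃ h₀ : ℝ, 0 < h₀ ∧ ∀ i, (T i).meshSize ≤ h₀ →
      ∀ μ ∈ StrainFEM.femSpace (T i) k,
        ∃ s : ℝ, IsLUB (StrainFEM.infSupQuotients (T i) k z μ) s ∧
          β * StrainFEM.norm1 Ω μ ≤ s := by
  open StrainFEM in
  -- Finite volume of `Ω` is read off from one triangulation; an empty family leaves nothing to
  -- prove.
  rcases isEmpty_or_nonempty ι with hι | ⟨⟨i₀⟩⟩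
  · exact ⟨1, one_pos, 1, one_pos, fun i => (hι.false i).elim⟩
  have hvol : volume Ω ≠ ⊤ := (T i₀).volume_ne_top
  have hd1 : 1 ≤ d := by omega
  obtain ⟨m, rfl⟩ : ∃ m, k = m + 1 := ⟨k - 1, by omega⟩
  obtain ⟨ρ, hρ, hTρ⟩ := hT
  obtain ⟨L, hL, hfield⟩ := exists_unitField hΩb hvol hz hz1
  obtain ⟨A, h₀, hA, hh₀, htest⟩ := exists_test_field hd1 hk hρ hL
  -- Dividing `‖μ‖₁² / 2` by a norm of at most `√A ‖μ‖₁` gives this constant; the added `1` keeps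
  -- the denominator positive.
  refine ⟨1 / (2 * (√A + 1)), by positivity, h₀, hh₀, fun i hi μ hμ => ?_⟩
  obtain ⟨ζ, hu, hcell⟩ := hfield (T i)
  set B := vform (T i).isOpen (T i).volume_ne_top with hB
  set M := (d : ℝ) * (2 + 2 * d * L ^ 2) with hM
  have hM0 : 0 ≤ M := by positivity
  have hvnorm : ∀ v : vlipSub Ω, vnorm1 Ω v.1 = √(B v v) := fun v => by
    rw [vnorm1, vinner1_eq_vform (T i).isOpen (T i).volume_ne_top]
  have hbound : ∀ ν ∈ femSpace (T i) (m + 1), ∀ v : vlipSub Ω,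
      |bForm Ω z ν v.1| ≤ √(energy Ω ν ν * M) * √(B v v) := by
    intro ν hν v
    have h1 := hu.bForm_sq_le (T i).isOpen (T i).volume_ne_top (unifLocLip_of_mem_femSpace hν) v
    rw [← Real.sqrt_mul (mul_nonneg (energy_self_nonneg ν) hM0)]
    refine Real.abs_le_sqrt (h1.trans_eq ?_)
    ring
  have hstar : ∀ ν ∈ femSpace (T i) (m + 1), 0 < energy Ω ν ν →
      ∃ q ∈ infSupQuotients (T i) (m + 1) z ν, 1 / (2 * (√A + 1)) * norm1 Ω ν ≤ q ∧
        ∃ v : vlipSub Ω, v.1 ∈ vfemSpaceStar (T i) (m + 1) z ∧ vnorm1 Ω v.1 ≠ 0 := by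
    intro ν hν hpos
    obtain ⟨v, hv, hbv, hvA⟩ := htest Ω (T i) hi (hTρ i) z ζ hu hcell ν hν
    obtain ⟨w, hw, hbw, hwv⟩ := hu.exists_star (T i) hv
    have hb : energy Ω ν ν / 2 ≤ bForm Ω z ν w.1 := by rwa [hbw ν hν]
    have hBw : B w w ≤ A * energy Ω ν ν := hwv.trans hvA
    -- The projected field cannot be null: `b(ν, w)` is positive and is bounded by a multiple of the
    -- norm of `w`.
    have hw0 : 0 < √(B w w) := by
      refine lt_of_le_of_ne (Real.sqrt_nonneg _) fun h0 => ?_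
      have := hbound ν hν w
      rw [← h0, mul_zero] at this
      linarith [le_abs_self (bForm Ω z ν w.1)]
    refine ⟨_, ⟨w.1, hw, by rw [hvnorm]; exact hw0.ne', rfl⟩, ?_, w, hw, by
      rw [hvnorm]; exact hw0.ne'⟩
    rw [hvnorm, le_div_iff₀ hw0, norm1_eq (T := T i) (unifLocLip_of_mem_femSpace hν)]
    have hsq : √(energy Ω ν ν) * √(energy Ω ν ν) = energy Ω ν ν := Real.mul_self_sqrt hpos.le
    have hle : √(B w w) ≤ (√A + 1) * √(energy Ω ν ν) := by
      refine (Real.sqrt_le_sqrt hBw).trans ?_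
      rw [Real.sqrt_mul hA]
      exact mul_le_mul_of_nonneg_right (by linarith) (Real.sqrt_nonneg _)
    calc 1 / (2 * (√A + 1)) * √(energy Ω ν ν) * √(B w w)
        ≤ 1 / (2 * (√A + 1)) * √(energy Ω ν ν) * ((√A + 1) * √(energy Ω ν ν)) := by gcongr
      _ = √(energy Ω ν ν) * √(energy Ω ν ν) / 2 := by field_simp
      _ ≤ _ := by rw [hsq]; exact hb
  have hbdd : BddAbove (infSupQuotients (T i) (m + 1) z μ) := by
    refine ⟨√(energy Ω μ μ * M), ?_⟩
    rintro _ ⟨v, hv, hv0, rfl⟩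
    have hvV : v ∈ vlipSub Ω := mem_vlipSub_of_mem_vfemSpace hv.1
    have hpos : 0 < vnorm1 Ω v := lt_of_le_of_ne (Real.sqrt_nonneg _) (Ne.symm hv0)
    rw [div_le_iff₀ hpos, hvnorm ⟨v, hvV⟩]
    exact (le_abs_self _).trans (hbound μ hμ ⟨v, hvV⟩)
  -- The constant function `1` supplies an admissible field even when `μ` has norm zero, so that the
  -- set of quotients is never empty.
  obtain ⟨-, -, -, v₁, hv₁, hv₁0⟩ := hstar _ (femSpace_const 1) (energy_one_pos (T i) hΩc.nonempty)
  have hne : (infSupQuotients (T i) (m + 1) z μ).Nonempty := ⟨_, v₁.1, hv₁, hv₁0, rfl⟩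
  refine ⟨_, isLUB_csSup hne hbdd, ?_⟩
  -- For `‖μ‖₁ = 0` the quotient of `v₁` is zero, which is all that is required of the supremum.
  rcases (energy_self_nonneg (Ω := Ω) μ).eq_or_lt with h0 | hpos
  · have hb0 : bForm Ω z μ v₁.1 = 0 := by
      have := hbound μ hμ v₁
      rw [← h0, zero_mul, Real.sqrt_zero, zero_mul] at this
      exact abs_nonpos_iff.1 this
    rw [norm1_eq (T := T i) (unifLocLip_of_mem_femSpace hμ), ← h0, Real.sqrt_zero, mul_zero]
    exact le_csSup hbdd ⟨v₁.1, hv₁, hv₁0, by rw [hb0, zero_div]⟩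
  · obtain ⟨q, hq, hle, -⟩ := hstar μ hμ hpos
    exact hle.trans (le_csSup hbdd hq)
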